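/- Let $m\ge 1$ be an integer, $\mu_0=m+1$ and $w_0^{(m)}(r)=r^m e^{-r^2/2}$. Consider real-valued solutions $w$ of the radial vortex equation $$-w_{rr}-\frac1r w_r+\frac{m^2}{r^2}w+r^2w+2|w|^2w-2\mu w=0,\qquad r>0. \tag{1}$$ Let $X$ be the real vector space of radial profiles $w:(0,\infty)\to\mathbb R$ (modulo equality almost everywhere) such that $u=e^{im\theta}w(r)$ satisfies $u\in H^2(\mathbb R^2,\mathbb R^2)$ and $(x^2+y^2)u\in L^2(\mathbb R^2,\mathbb R^2)$, with the norm $\|w\|_X^2=\|u\|_{H^2}^2+\|(x^2+y^2)u\|_{L^2}^2$. Let $\perp$ denote orthogonality in $L^2(\mathbb R^2,\mathbb R^2)$, that is, $v\perp w$ means $\int_0^\infty v(r)w(r)\,r\,dr=0$. Then $w_0^{(m)}\in X$, and there are $\varepsilon,\delta>0$ and continuously differentiable maps $\tau:(-\varepsilon,\varepsilon)\to\mathbb R$ and $z:(-\varepsilon,\varepsilon)\to X$ with $$\tau(0)=\tau'(0)=0,\qquad z(0)=0,\qquad z(s)\perp w_0^{(m)}\ \text{ for all } s\in(-\varepsilon,\varepsilon),$$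 such that, with $$(\mu(s),w(s))=\bigl(\mu_0+\tau(s),\; s\,w_0^{(m)}+s\,z(s)\bigr)\in\mathbb R\times X,$$ the following hold. 1. For every $s\in(-\varepsilon,\varepsilon)$, $w(s)$ has a representative that is twice continuously differentiable on $(0,\infty)$, solves (1) with $\mu=\mu(s)$, is bounded as $r\to0^+$, and tends to $0$ as $r\to\infty$. 2. If $\mu\in\mathbb R$ and $w\in X$ is a twice continuously differentiable solution of (1) with $|\mu-\mu_0|<\delta$ and $\|w\|_X<\delta$, then either $w=0$ or $(\mu,w)=(\mu(s),w(s))$ for some $s\in(-\varepsilon,\varepsilon)$. -/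

import Mathlib

open MeasureTheory Set Filter Topology
open scoped ContDiff

noncomputable section

namespace Vortex

/-- The space `L²(ℝ², ℝ²)`; the plane `ℝ²` (both as domain and as range) is `ℂ` with Lebesgue
measure. -/
abbrev L2 : Type := Lp ℂ 2 (volume : Measure ℂ)

/-- `g` is the weak partial derivative of `f` on the plane in the direction `v`
(`v = 1` is `∂/∂x`, `v = I` is `∂/∂y`). -/
def IsWeakDeriv (v : ℂ) (f g : L2) : Prop :=
  ∀ φ : ℂ → ℝ, ContDiff ℝ ∞ φ → HasCompactSupport φ →
    ∫ p, fderiv ℝ φ p v • f p = - ∫ p, φ p • g p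

/-- Seven-tuples of `L²` functions, with the Hilbert norm (the square root of the sum of the squares
of the seven `L²` norms). -/
abbrev Jets : Type := PiLp 2 (fun _ : Fin 7 => L2)

/-- The tuple `J` is `(u, u_x, u_y, u_xx, u_xy, u_yy, (x² + y²) u)` with weak derivatives.
It is determined by its first component `u`; such a tuple exists for `u` in `L²` if and only if
`u ∈ H²(ℝ², ℝ²)` and `(x² + y²) u ∈ L²(ℝ², ℝ²)`. -/
structure IsJet (J : Jets) : Prop where
  dx : IsWeakDeriv 1 (J 0) (J 1)
  dy : IsWeakDeriv Complex.I (J 0) (J 2)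
  dxx : IsWeakDeriv 1 (J 1) (J 3)
  dxy : IsWeakDeriv Complex.I (J 1) (J 4)
  dyy : IsWeakDeriv Complex.I (J 2) (J 5)
  weight : ∀ᵐ p : ℂ, J 6 p = ((p.re ^ 2 + p.im ^ 2 : ℝ) : ℂ) * J 0 p

/-- `u` is (almost everywhere) the function `e^{imθ} w(r)` in polar coordinates `(r, θ)`. -/
def HasProfile (m : ℕ) (u : L2) (w : ℝ → ℝ) : Prop :=
  ∀ᵐ p : ℂ, u p = Complex.exp (m * Complex.arg p * Complex.I) * (w ‖p‖ : ℂ)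

lemma integrable_test {φ : ℂ → ℝ} (hφ : Continuous φ) (hc : HasCompactSupport φ) (f : L2) :
    Integrable (fun p => φ p • f p) :=
  ((Lp.memLp f).locallyIntegrable (by norm_num)).integrable_smul_left_of_hasCompactSupport hφ hc

lemma integrable_test_deriv {φ : ℂ → ℝ} (hφ : ContDiff ℝ ∞ φ) (hc : HasCompactSupport φ) (v : ℂ)
    (f : L2) : Integrable (fun p => fderiv ℝ φ p v • f p) :=
  integrable_test ((hφ.continuous_fderiv (by simp)).clm_apply continuous_const)
    (hc.fderiv_apply (𝕜 := ℝ) v) f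

lemma IsWeakDeriv.add {v : ℂ} {f g f' g' : L2} (h : IsWeakDeriv v f g)
    (h' : IsWeakDeriv v f' g') : IsWeakDeriv v (f + f') (g + g') := by
  intro φ hφ hc
  have e1 : ∫ p, fderiv ℝ φ p v • (f + f') p =
      ∫ p, (fderiv ℝ φ p v • f p + fderiv ℝ φ p v • f' p) := by
    apply integral_congr_ae
    filter_upwards [Lp.coeFn_add f f'] with p hp
    rw [hp, Pi.add_apply, smul_add]
  have e2 : ∫ p, φ p • (g + g') p = ∫ p, (φ p • g p + φ p • g' p) := by
    apply integral_congr_ae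
    filter_upwards [Lp.coeFn_add g g'] with p hp
    rw [hp, Pi.add_apply, smul_add]
  rw [e1, e2, integral_add (integrable_test_deriv hφ hc v f) (integrable_test_deriv hφ hc v f'),
    integral_add (integrable_test hφ.continuous hc g) (integrable_test hφ.continuous hc g'),
    h φ hφ hc, h' φ hφ hc, neg_add]

lemma IsWeakDeriv.smul {v : ℂ} {f g : L2} (c : ℝ) (h : IsWeakDeriv v f g) :
    IsWeakDeriv v (c • f) (c • g) := by
  intro φ hφ hc
  have e1 : ∫ p, fderiv ℝ φ p v • (c • f) p = ∫ p, c • (fderiv ℝ φ p v • f p) := by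
    apply integral_congr_ae
    filter_upwards [Lp.coeFn_smul c f] with p hp
    rw [hp, Pi.smul_apply, smul_comm]
  have e2 : ∫ p, φ p • (c • g) p = ∫ p, c • (φ p • g p) := by
    apply integral_congr_ae
    filter_upwards [Lp.coeFn_smul c g] with p hp
    rw [hp, Pi.smul_apply, smul_comm]
  rw [e1, e2, integral_smul, integral_smul, h φ hφ hc, smul_neg]

lemma IsWeakDeriv.zero (v : ℂ) : IsWeakDeriv v 0 0 := by
  have h : IsWeakDeriv v ((0 : ℝ) • (0 : L2)) ((0 : ℝ) • (0 : L2)) := by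
    intro φ hφ hc
    have e : ∀ᵐ p : ℂ, ((0 : ℝ) • (0 : L2)) p = 0 := by
      rw [smul_zero]
      exact Lp.coeFn_zero ℂ 2 volume
    rw [integral_eq_zero_of_ae (by filter_upwards [e] with p hp; rw [hp]; simp),
      integral_eq_zero_of_ae (by filter_upwards [e] with p hp; rw [hp]; simp), neg_zero]
  simpa using h

/-- The real normed space of radial profiles `w` (with real values) such that `u = e^{imθ} w(r)`
satisfies `u ∈ H²(ℝ², ℝ²)` and `(x² + y²) u ∈ L²(ℝ², ℝ²)`. The profile is represented by `u`
together with its weak derivatives up to order two and `(x² + y²) u`, so that the inherited norm is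
`(‖u‖² + ‖u_x‖² + ‖u_y‖² + ‖u_xx‖² + ‖u_xy‖² + ‖u_yy‖² + ‖(x² + y²) u‖²)^{1/2}` with `L²` norms. -/
def X (m : ℕ) : Submodule ℝ Jets where
  carrier := {J | IsJet J ∧ ∃ w : ℝ → ℝ, HasProfile m (J 0) w}
  zero_mem' := by
    refine ⟨⟨IsWeakDeriv.zero _, IsWeakDeriv.zero _, IsWeakDeriv.zero _, IsWeakDeriv.zero _,
      IsWeakDeriv.zero _, ?_⟩, fun _ => 0, ?_⟩
    · filter_upwards [Lp.coeFn_zero ℂ 2 (volume : Measure ℂ)] with p hp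
      simp only [PiLp.zero_apply]
      rw [hp]; simp
    · unfold HasProfile
      filter_upwards [Lp.coeFn_zero ℂ 2 (volume : Measure ℂ)] with p hp
      simp only [PiLp.zero_apply]
      rw [hp]; simp
  add_mem' := by
    rintro J K ⟨hJ, w, hw⟩ ⟨hK, w', hw'⟩
    refine ⟨⟨hJ.dx.add hK.dx, hJ.dy.add hK.dy, hJ.dxx.add hK.dxx, hJ.dxy.add hK.dxy,
      hJ.dyy.add hK.dyy, ?_⟩, fun r => w r + w' r, ?_⟩
    · filter_upwards [Lp.coeFn_add (J 0) (K 0), Lp.coeFn_add (J 6) (K 6), hJ.weight, hK.weight]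
        with p h0 h6 hj hk
      simp only [PiLp.add_apply]
      rw [h0, h6, Pi.add_apply, Pi.add_apply, hj, hk, mul_add]
    · unfold HasProfile at *
      filter_upwards [Lp.coeFn_add (J 0) (K 0), hw, hw'] with p h0 hj hk
      simp only [PiLp.add_apply]
      rw [h0, Pi.add_apply, hj, hk]
      push_cast
      ring
  smul_mem' := by
    rintro c J ⟨hJ, w, hw⟩
    refine ⟨⟨hJ.dx.smul c, hJ.dy.smul c, hJ.dxx.smul c, hJ.dxy.smul c, hJ.dyy.smul c, ?_⟩,
      fun r => c * w r, ?_⟩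
    · filter_upwards [Lp.coeFn_smul c (J 0), Lp.coeFn_smul c (J 6), hJ.weight] with p h0 h6 hj
      simp only [PiLp.smul_apply]
      rw [h0, h6, Pi.smul_apply, Pi.smul_apply, hj, Complex.real_smul, Complex.real_smul]
      ring
    · unfold HasProfile at *
      filter_upwards [Lp.coeFn_smul c (J 0), hw] with p h0 hj
      simp only [PiLp.smul_apply]
      rw [h0, Pi.smul_apply, hj, Complex.real_smul]
      push_cast
      ring

/-- The element `W` of `X m` is the profile `w`. -/
def IsProfile {m : ℕ} (W : X m) (w : ℝ → ℝ) : Prop := HasProfile m ((W : Jets) 0) w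

/-- The `L²(ℝ², ℝ²)` inner product of the functions `e^{imθ} v(r)` and `e^{imθ} w(r)`,
which is `2π ∫₀^∞ v(r) w(r) r dr` for the profiles `v`, `w`. -/
def l2Inner {m : ℕ} (V W : X m) : ℝ := inner ℝ ((V : Jets) 0) ((W : Jets) 0)

/-- The radial vortex equation
`-w'' - w'/r + m² w/r² + r² w + 2|w|² w - 2μw = 0` for `r > 0`, in the classical sense. -/
def SolvesRadialEquation (m : ℕ) (μ : ℝ) (w : ℝ → ℝ) : Prop :=
  ContDiffOn ℝ 2 w (Ioi 0) ∧
  ∀ r : ℝ, 0 < r →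
    -deriv (deriv w) r - 1 / r * deriv w r + (m : ℝ) ^ 2 / r ^ 2 * w r + r ^ 2 * w r
      + 2 * |w r| ^ 2 * w r - 2 * μ * w r = 0

/-- Boundary conditions: `w` is bounded near `0⁺` and tends to `0` at infinity. -/
def SatisfiesBoundaryConditions (w : ℝ → ℝ) : Prop :=
  (∃ C : ℝ, ∀ᶠ r in 𝓝[>] (0 : ℝ), |w r| ≤ C) ∧ Tendsto w atTop (𝓝 0)

/-- The ground state `w₀^{(m)}(r) = r^m e^{-r²/2}` of the linearization at zero. -/
def groundState (m : ℕ) (r : ℝ) : ℝ := r ^ m * Real.exp (-r ^ 2 / 2)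

end Vortex

end

noncomputable section

namespace Vortex

open SchwartzMap LineDeriv Polynomial
open scoped ZeroAtInfty

/-! This is bifurcation from a simple eigenvalue. With `A = -Δ + r² - 2(m + 1)` acting on functions
`e^{imθ} w(r)` with `w` real, equation (1) at `μ = m + 1 + τ` reads `A u = 2τ u - 2|u|² u`, and the
kernel of `A` is spanned by the ground state `w₀`.

Linear part. On `z^m p(|z|²) e^{-|z|²/2}` the operator `A` becomes `4 L_m p`, with `L_m` the
Laguerre operator (`oscillator_wave`). Integration by parts and the identity `(L_m p)' = L_{m+1} p'
+ p'` give the spectral gap `‖p‖ ≤ ‖L_m p‖` for `p ⟂ 1` (`norm_waveL2_le_laguerreOp`). Together with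
the oscillator estimate and a sup bound by the jet norm, this extends the inverse of `A` off the
kernel to a bounded operator `solve` on the closed span `modes` of these functions, with values in
`X m` and with continuous representatives. A moment argument shows that `modes` contains every
square integrable function with a real radial profile (`HasProfile.mem_modes`), so every element of
`X m` is `s w₀ + solve f` with `f ⟂ w₀` (`exists_eq_smul_groundX_add_solve`).

Passage to the ODE. For `u = s w₀ + solve f` with `f ⟂ w₀`, equation (1) for the profile is
equivalent to `f = 2τ u - 2|u|² u`, the relation expressed by `source`. Both directions
(`solvesRadialEquation_profileSum`, `eq_source_of_solves`) rest on a Wronskian identity: the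
derivative of the quotient of the profile of `solve f` by `w₀` is an explicit integral of `f` over a
disc.

Nonlinear part. Put `f = s (y - c w₀)`, where `c` is the `w₀`-coefficient of `y`, and `τ = -c/2`.
After division by `s` the equation becomes `y + c (solve y) + 2s² |u₁|² u₁ = 0`, with `u₁ = w₀ +
solve y`. Thus the one unknown `y` carries both `τ` and the correction, and the linearization at the
origin is the projection onto `y`. The implicit function theorem gives the curve and its local
uniqueness (`exists_curve`), and the absence of a term linear in `s` gives `τ'(0) = 0`. Finally
`exists_small` shows that a small solution has `f = O(ρ|s|)`, so that `y` lies in the uniqueness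
neighbourhood. -/

/-! ### Schwartz calculus in the plane and the harmonic oscillator estimate -/

/-- The class in `L²(ℝ², ℝ²)` of a Schwartz function. -/
def toL2 : 𝓢(ℂ, ℂ) →L[ℝ] L2 := toLpCLM ℝ ℂ 2 volume

lemma coeFn_toL2 (f : 𝓢(ℂ, ℂ)) : toL2 f =ᵐ[volume] f := f.coeFn_toLp 2 volume

lemma inner_toL2_left (f : 𝓢(ℂ, ℂ)) (g : L2) :
    inner ℝ (toL2 f) g = ∫ z, inner ℝ (f z) (g z) := by
  rw [L2.inner_def]
  apply integral_congr_ae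
  filter_upwards [coeFn_toL2 f] with z hf
  rw [hf]

lemma inner_toL2 (f g : 𝓢(ℂ, ℂ)) :
    inner ℝ (toL2 f) (toL2 g) = ∫ z, inner ℝ (f z) (g z) := by
  rw [inner_toL2_left]
  apply integral_congr_ae
  filter_upwards [coeFn_toL2 g] with z hg
  rw [hg]

lemma norm_sq_toL2 (f : 𝓢(ℂ, ℂ)) : ‖toL2 f‖ ^ 2 = ∫ z, ‖f z‖ ^ 2 := by
  rw [← real_inner_self_eq_norm_sq, inner_toL2]
  simp_rw [real_inner_self_eq_norm_sq]

lemma integrable_norm_sq (f : 𝓢(ℂ, ℂ)) : Integrable fun z => ‖f z‖ ^ 2 := by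
  have := (pairing (innerSL ℝ (E := ℂ)) f f).integrable (μ := volume)
  refine this.congr (ae_of_all _ fun z => ?_)
  exact real_inner_self_eq_norm_sq (f z)

/-- Multiplication by the linear function `⟨w, ·⟩`. -/
def coordMul (w : ℂ) : 𝓢(ℂ, ℂ) →L[ℝ] 𝓢(ℂ, ℂ) := smulLeftCLM ℂ (fun z : ℂ => inner ℝ w z)

lemma coordMul_apply (w : ℂ) (f : 𝓢(ℂ, ℂ)) (z : ℂ) :
    coordMul w f z = (inner ℝ w z : ℝ) • f z :=
  smulLeftCLM_apply_apply (Function.hasTemperateGrowth_inner_right w) f z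

lemma lineDeriv_coordMul (v w : ℂ) (f : 𝓢(ℂ, ℂ)) :
    ∂_{v} (coordMul w f) = (inner ℝ w v : ℝ) • f + coordMul w (∂_{v} f) := by
  ext z
  rw [_root_.add_apply, _root_.smul_apply, coordMul_apply, lineDerivOp_apply_eq_fderiv,
    lineDerivOp_apply_eq_fderiv]
  have h : (coordMul w f : ℂ → ℂ) = fun z => (innerSL ℝ w z : ℝ) • f z := by
    ext z; exact coordMul_apply w f z
  have h' : HasFDerivAt (fun z => (innerSL ℝ w z : ℝ) • f z) _ z :=
    (innerSL ℝ w).hasFDerivAt.smul (f.hasFDerivAt z)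
  rw [h, h'.fderiv]
  simp [add_comm]

lemma inner_lineDeriv_left (v : ℂ) (f g : 𝓢(ℂ, ℂ)) :
    inner ℝ (toL2 (∂_{v} f)) (toL2 g) = - inner ℝ (toL2 f) (toL2 (∂_{v} g)) := by
  have := integral_bilinear_lineDerivOp_right_eq_neg_left (μ := volume) f g (innerSL ℝ (E := ℂ)) v
  rw [inner_toL2, inner_toL2]
  exact (neg_eq_iff_eq_neg.mpr this).symm

lemma inner_coordMul_left (w : ℂ) (f g : 𝓢(ℂ, ℂ)) :
    inner ℝ (toL2 (coordMul w f)) (toL2 g) = inner ℝ (toL2 f) (toL2 (coordMul w g)) := by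
  rw [inner_toL2, inner_toL2]
  congr 1
  ext z
  rw [coordMul_apply, coordMul_apply, real_inner_smul_left, real_inner_smul_right]

lemma lineDeriv_comm (v w : ℂ) (f : 𝓢(ℂ, ℂ)) : ∂_{v} (∂_{w} f) = ∂_{w} (∂_{v} f) := by
  ext z
  have h2 : ∀ a b : ℂ, (∂_{a} (∂_{b} f)) z = fderiv ℝ (fderiv ℝ f) z a b := by
    intro a b
    rw [lineDerivOp_apply_eq_fderiv]
    have : ((∂_{b} f : 𝓢(ℂ, ℂ)) : ℂ → ℂ) = fun y => fderiv ℝ f y b := by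
      ext y; exact lineDerivOp_apply_eq_fderiv b f y
    rw [this, fderiv_clm_apply]
    · simp
    · exact ((f.smooth 2).fderiv_right (m := 1) (by norm_num)).differentiable (by norm_num) z
    · fun_prop
  rw [h2, h2]
  exact ((f.smooth 2).contDiffAt.isSymmSndFDerivAt (by simp)).eq v w

/-- The Laplacian `∂²/∂x² + ∂²/∂y²` on Schwartz functions of the plane. -/
def lap (f : 𝓢(ℂ, ℂ)) : 𝓢(ℂ, ℂ) := ∂_{(1 : ℂ)} (∂_{(1 : ℂ)} f) + ∂_{Complex.I} (∂_{Complex.I} f)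

/-- Multiplication by `x² + y²` on Schwartz functions of the plane. -/
def sqMul (f : 𝓢(ℂ, ℂ)) : 𝓢(ℂ, ℂ) :=
  coordMul 1 (coordMul 1 f) + coordMul Complex.I (coordMul Complex.I f)

lemma sqMul_apply (f : 𝓢(ℂ, ℂ)) (z : ℂ) :
    sqMul f z = ((z.re ^ 2 + z.im ^ 2 : ℝ) : ℂ) * f z := by
  simp only [sqMul, _root_.add_apply, coordMul_apply, Complex.real_smul, Complex.inner]
  simp
  ring

lemma inner_one_one : inner ℝ (1 : ℂ) (1 : ℂ) = (1 : ℝ) := by simp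
lemma inner_I_I : inner ℝ Complex.I Complex.I = (1 : ℝ) := by simp
lemma inner_one_I : inner ℝ (1 : ℂ) Complex.I = (0 : ℝ) := by simp [Complex.inner]
lemma inner_I_one : inner ℝ Complex.I (1 : ℂ) = (0 : ℝ) := by simp [Complex.inner]

/-- The virial identity: integrating by parts moves `∂_v` onto `⟨v, ·⟩ f`, and the commutator of the
two operators is the identity. -/
lemma inner_lineDeriv_coordMul (v : ℂ) (hv : inner ℝ v v = (1 : ℝ)) (f : 𝓢(ℂ, ℂ)) :
    2 * inner ℝ (toL2 (∂_{v} f)) (toL2 (coordMul v f)) = - ‖toL2 f‖ ^ 2 := by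
  have h := inner_lineDeriv_left v f (coordMul v f)
  rw [lineDeriv_coordMul, hv, one_smul, map_add, inner_add_right, real_inner_self_eq_norm_sq,
    ← inner_coordMul_left v f] at h
  linarith [real_inner_comm (toL2 (∂_{v} f)) (toL2 (coordMul v f))]

/-- The Laplacian controls the whole Hessian: two integrations by parts turn the cross term `⟨f_xx,
f_yy⟩` into `‖f_xy‖²`. -/
lemma norm_sq_second_derivs (f : 𝓢(ℂ, ℂ)) :
    ‖toL2 (lap f)‖ ^ 2 = ‖toL2 (∂_{(1 : ℂ)} (∂_{(1 : ℂ)} f))‖ ^ 2 +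
      2 * ‖toL2 (∂_{Complex.I} (∂_{(1 : ℂ)} f))‖ ^ 2 +
      ‖toL2 (∂_{Complex.I} (∂_{Complex.I} f))‖ ^ 2 := by
  have h : inner ℝ (toL2 (∂_{(1 : ℂ)} (∂_{(1 : ℂ)} f)))
      (toL2 (∂_{Complex.I} (∂_{Complex.I} f))) = ‖toL2 (∂_{Complex.I} (∂_{(1 : ℂ)} f))‖ ^ 2 := by
    rw [inner_lineDeriv_left, lineDeriv_comm 1 Complex.I, lineDeriv_comm 1 Complex.I,
      ← inner_lineDeriv_left, real_inner_self_eq_norm_sq]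
  rw [lap, map_add, norm_add_sq_real, h]

lemma norm_sq_gradient (f : 𝓢(ℂ, ℂ)) :
    ‖toL2 (∂_{(1 : ℂ)} f)‖ ^ 2 + ‖toL2 (∂_{Complex.I} f)‖ ^ 2 =
      - inner ℝ (toL2 f) (toL2 (lap f)) := by
  rw [← real_inner_self_eq_norm_sq, ← real_inner_self_eq_norm_sq, inner_lineDeriv_left,
    inner_lineDeriv_left, lap, map_add, inner_add_right]
  ring

/-- Only the cross term `2⟨Δf, r²f⟩` has to be bounded above. One integration by parts in each
direction leaves `-⟨∂_v f, r² ∂_v f⟩ ≤ 0` and a virial term equal to `‖f‖²`. Two directions and the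
factor `2` give the constant `4`. -/
lemma norm_sq_oscillator (f : 𝓢(ℂ, ℂ)) :
    ‖toL2 (lap f)‖ ^ 2 + ‖toL2 (sqMul f)‖ ^ 2 ≤
      ‖toL2 (- lap f + sqMul f)‖ ^ 2 + 4 * ‖toL2 f‖ ^ 2 := by
  have key : ∀ v : ℂ,
      inner ℝ (toL2 (∂_{v} (∂_{v} f))) (toL2 (sqMul f)) ≤
      - 2 * inner ℝ (toL2 (∂_{v} f)) (toL2 ((inner ℝ (1 : ℂ) v : ℝ) • coordMul 1 f +
        (inner ℝ Complex.I v : ℝ) • coordMul Complex.I f)) := by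
    intro v
    rw [inner_lineDeriv_left, sqMul, lineDerivOp_add]
    simp only [lineDeriv_coordMul, map_add, map_smul, inner_add_right, inner_smul_right]
    rw [← inner_coordMul_left 1 _ (coordMul 1 _),
      ← inner_coordMul_left Complex.I _ (coordMul Complex.I _)]
    have h1 := real_inner_self_nonneg (x := toL2 (coordMul 1 (∂_{v} f)))
    have h2 := real_inner_self_nonneg (x := toL2 (coordMul Complex.I (∂_{v} f)))
    linarith
  have h1 := key 1
  have h2 := key Complex.I
  simp only [inner_one_one, inner_I_I, inner_one_I, inner_I_one, one_smul, zero_smul, add_zero,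
    zero_add] at h1 h2
  have e1 := inner_lineDeriv_coordMul 1 inner_one_one f
  have e2 := inner_lineDeriv_coordMul Complex.I inner_I_I f
  have e : ‖toL2 (- lap f + sqMul f)‖ ^ 2 = ‖toL2 (lap f)‖ ^ 2 + ‖toL2 (sqMul f)‖ ^ 2
      - 2 * inner ℝ (toL2 (lap f)) (toL2 (sqMul f)) := by
    rw [map_add, map_neg, norm_add_sq_real, norm_neg, inner_neg_left]; ring
  have e3 : inner ℝ (toL2 (lap f)) (toL2 (sqMul f)) =
      inner ℝ (toL2 (∂_{(1 : ℂ)} (∂_{(1 : ℂ)} f))) (toL2 (sqMul f)) +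
      inner ℝ (toL2 (∂_{Complex.I} (∂_{Complex.I} f))) (toL2 (sqMul f)) := by
    rw [lap, map_add, inner_add_left]
  linarith

/-- The `L²` classes of a Schwartz function, of its derivatives up to order two and of its product
with `x² + y²`. -/
def schwartzJet : 𝓢(ℂ, ℂ) →ₗ[ℝ] Jets where
  toFun f := WithLp.toLp 2 ![toL2 f, toL2 (∂_{(1 : ℂ)} f), toL2 (∂_{Complex.I} f),
    toL2 (∂_{(1 : ℂ)} (∂_{(1 : ℂ)} f)), toL2 (∂_{Complex.I} (∂_{(1 : ℂ)} f)),
    toL2 (∂_{Complex.I} (∂_{Complex.I} f)), toL2 (sqMul f)]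
  map_add' f g := by
    ext i : 1
    (fin_cases i <;> simp [lineDerivOp_add, sqMul]); abel
  map_smul' c f := by
    ext i : 1
    fin_cases i <;> simp [lineDerivOp_smul, sqMul]

lemma norm_sq_jet (J : Jets) : ‖J‖ ^ 2 = ‖J 0‖ ^ 2 + ‖J 1‖ ^ 2 + ‖J 2‖ ^ 2 + ‖J 3‖ ^ 2 +
    ‖J 4‖ ^ 2 + ‖J 5‖ ^ 2 + ‖J 6‖ ^ 2 := by
  rw [PiLp.norm_sq_eq_of_L2, Fin.sum_univ_seven]

lemma norm_schwartzJet_sq_le (f : 𝓢(ℂ, ℂ)) :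
    ‖schwartzJet f‖ ^ 2 ≤ 2 * ‖toL2 (- lap f + sqMul f)‖ ^ 2 + 10 * ‖toL2 f‖ ^ 2 := by
  have h0 : ‖schwartzJet f‖ ^ 2 = ‖toL2 f‖ ^ 2 + ‖toL2 (∂_{(1 : ℂ)} f)‖ ^ 2 +
      ‖toL2 (∂_{Complex.I} f)‖ ^ 2 + ‖toL2 (∂_{(1 : ℂ)} (∂_{(1 : ℂ)} f))‖ ^ 2 +
      ‖toL2 (∂_{Complex.I} (∂_{(1 : ℂ)} f))‖ ^ 2 +
      ‖toL2 (∂_{Complex.I} (∂_{Complex.I} f))‖ ^ 2 + ‖toL2 (sqMul f)‖ ^ 2 := norm_sq_jet _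
  have h1 := norm_sq_second_derivs f
  have h2 := norm_sq_gradient f
  have h3 := norm_sq_oscillator f
  have h4 := abs_real_inner_le_norm (toL2 f) (toL2 (lap f))
  have h5 := neg_abs_le (inner ℝ (toL2 f) (toL2 (lap f)))
  nlinarith [sq_nonneg (‖toL2 f‖ - ‖toL2 (lap f)‖), sq_nonneg ‖toL2 (∂_{Complex.I} (∂_{(1 : ℂ)} f))‖,
    sq_nonneg ‖toL2 (sqMul f)‖, sq_nonneg ‖toL2 (lap f)‖]


/-! ### Sup bound by the jet norm -/

lemma exists_schwartz_horizontal (F : 𝓢(ℂ, ℝ)) (y : ℝ) :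
    ∃ G : 𝓢(ℝ, ℝ), ∀ x : ℝ, G x = F (x + y * Complex.I) := by
  have hg : Function.HasTemperateGrowth (fun x : ℝ => (x : ℂ) + y * Complex.I) :=
    Complex.ofRealCLM.hasTemperateGrowth.add (.const _)
  have ha : AntilipschitzWith 1 (fun x : ℝ => (x : ℂ) + y * Complex.I) := by
    refine AntilipschitzWith.of_le_mul_dist fun a b => ?_
    simp [Complex.dist_eq, Real.dist_eq, ← Complex.ofReal_sub]
  exact ⟨compCLMOfAntilipschitz ℝ hg ha F, fun x => rfl⟩

lemma exists_schwartz_vertical (F : 𝓢(ℂ, ℝ)) (x : ℝ) :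
    ∃ G : 𝓢(ℝ, ℝ), ∀ y : ℝ, G y = F (x + y * Complex.I) := by
  have hg : Function.HasTemperateGrowth (fun y : ℝ => (x : ℂ) + y * Complex.I) :=
    (Function.HasTemperateGrowth.const _).add
      (Complex.ofRealCLM.hasTemperateGrowth.mul (.const _))
  have ha : AntilipschitzWith 1 (fun y : ℝ => (x : ℂ) + y * Complex.I) := by
    refine AntilipschitzWith.of_le_mul_dist fun a b => ?_
    simp [Complex.dist_eq, Real.dist_eq, ← sub_mul, ← Complex.ofReal_sub]
  exact ⟨compCLMOfAntilipschitz ℝ hg ha F, fun x => rfl⟩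

lemma abs_schwartz_le_integral (G : 𝓢(ℝ, ℝ)) (x : ℝ) : |G x| ≤ ∫ t, |deriv G t| := by
  have hi : Integrable (deriv G) := (derivCLM ℝ ℝ G).integrable
  have h := integral_Iic_of_hasDerivAt_of_tendsto (f := G) (f' := deriv G) (a := x) (m := 0)
    G.continuous.continuousWithinAt (fun t _ => G.hasDerivAt t) hi.integrableOn
    (G.tendsto_cocompact.mono_left atBot_le_cocompact)
  rw [sub_zero] at h
  rw [← h, ← Real.norm_eq_abs]
  exact (norm_integral_le_integral_norm _).trans
    (setIntegral_le_integral hi.norm (ae_of_all _ fun t => norm_nonneg _))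

/-- The fundamental theorem of calculus from infinity, applied first along a horizontal line and
then along vertical lines. -/
lemma abs_schwartz_le_integral_mixed (F : 𝓢(ℂ, ℝ)) (z : ℂ) :
    |F z| ≤ ∫ p, |∂_{Complex.I} (∂_{(1 : ℂ)} F) p| := by
  have hx : ∀ x y : ℝ, |F (x + y * Complex.I)| ≤
      ∫ t : ℝ, |∂_{(1 : ℂ)} F (t + y * Complex.I)| := by
    intro x y
    obtain ⟨G, hG⟩ := exists_schwartz_horizontal F y
    rw [← hG]
    refine (abs_schwartz_le_integral G x).trans_eq (integral_congr_ae (ae_of_all _ fun t => ?_))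
    have h1 : HasDerivAt (fun t : ℝ => F (t + y * Complex.I))
        (fderiv ℝ F (t + y * Complex.I) 1) t := by
      refine (F.hasFDerivAt _).comp_hasDerivAt t ?_
      exact (Complex.ofRealCLM.hasDerivAt).add_const _
    have h2 : (G : ℝ → ℝ) = fun t : ℝ => F (t + y * Complex.I) := funext hG
    simp only [h2, h1.deriv]
    rfl
  have hy : ∀ (x y : ℝ), |∂_{(1 : ℂ)} F (x + y * Complex.I)| ≤
      ∫ t : ℝ, |∂_{Complex.I} (∂_{(1 : ℂ)} F) (x + t * Complex.I)| := by
    intro x y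
    obtain ⟨G, hG⟩ := exists_schwartz_vertical (∂_{(1 : ℂ)} F) x
    rw [← hG]
    refine (abs_schwartz_le_integral G y).trans_eq (integral_congr_ae (ae_of_all _ fun t => ?_))
    have h1 : HasDerivAt (fun t : ℝ => (∂_{(1 : ℂ)} F) (x + t * Complex.I))
        (fderiv ℝ (∂_{(1 : ℂ)} F : 𝓢(ℂ, ℝ)) (x + t * Complex.I) Complex.I) t := by
      refine ((∂_{(1 : ℂ)} F : 𝓢(ℂ, ℝ)).hasFDerivAt _).comp_hasDerivAt t ?_
      simpa using ((Complex.ofRealCLM.hasDerivAt (x := t)).mul_const Complex.I).const_add (x : ℂ)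
    have h2 : (G : ℝ → ℝ) = fun t : ℝ => (∂_{(1 : ℂ)} F) (x + t * Complex.I) := funext hG
    simp only [h2, h1.deriv]
    rfl
  set K : 𝓢(ℂ, ℝ) := ∂_{Complex.I} (∂_{(1 : ℂ)} F) with hK
  have hKi : Integrable (fun p : ℝ × ℝ => |K (p.1 + p.2 * Complex.I)|) := by
    have := (Complex.volume_preserving_equiv_real_prod.symm).integrable_comp_emb
      (Complex.measurableEquivRealProd.symm.measurableEmbedding) (g := fun p => |K p|)
    have h2 := this.mpr K.integrable.abs
    refine h2.congr (ae_of_all _ fun p => ?_)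
    simp [Complex.measurableEquivRealProd_symm_apply, Complex.mk_eq_add_mul_I]
  have hKe : ∫ p : ℂ, |K p| = ∫ x : ℝ, ∫ y : ℝ, |K (x + y * Complex.I)| := by
    rw [← integral_prod _ hKi, ← Measure.volume_eq_prod,
      ← (Complex.volume_preserving_equiv_real_prod.symm).integral_comp
      (Complex.measurableEquivRealProd.symm.measurableEmbedding)]
    refine integral_congr_ae (ae_of_all _ fun p => ?_)
    simp [Complex.measurableEquivRealProd_symm_apply, Complex.mk_eq_add_mul_I]
  rw [hKe, ← Complex.re_add_im z]
  refine (hx z.re z.im).trans ?_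
  refine integral_mono_of_nonneg (ae_of_all _ fun t => abs_nonneg _) hKi.integral_prod_left
    (ae_of_all _ fun t => hy t z.im)

/-- The mixed-derivative bound is applied to `|f|²`: its derivative `∂_y ∂_x` is `2(⟨f, f_xy⟩ +
⟨f_y, f_x⟩)`, which is quadratic in entries of the jet, so its integral is at most a sum of squared
`L²` norms. -/
lemma norm_apply_le_schwartzJet (f : 𝓢(ℂ, ℂ)) (z : ℂ) : ‖f z‖ ≤ ‖schwartzJet f‖ := by
  have h0 : ‖schwartzJet f‖ ^ 2 = ‖toL2 f‖ ^ 2 + ‖toL2 (∂_{(1 : ℂ)} f)‖ ^ 2 +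
      ‖toL2 (∂_{Complex.I} f)‖ ^ 2 + ‖toL2 (∂_{(1 : ℂ)} (∂_{(1 : ℂ)} f))‖ ^ 2 +
      ‖toL2 (∂_{Complex.I} (∂_{(1 : ℂ)} f))‖ ^ 2 +
      ‖toL2 (∂_{Complex.I} (∂_{Complex.I} f))‖ ^ 2 + ‖toL2 (sqMul f)‖ ^ 2 := norm_sq_jet _
  refine le_of_sq_le_sq ?_ (norm_nonneg _)
  set F : 𝓢(ℂ, ℝ) := pairing (innerSL ℝ (E := ℂ)) f f
  have hF : ∀ p, F p = inner ℝ (f p) (f p) := fun p => rfl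
  have hd : ∀ v p : ℂ, (∂_{v} F) p = 2 * inner ℝ (f p) ((∂_{v} f) p) := by
    intro v p
    have h1 : (F : ℂ → ℝ) = fun p => inner ℝ (f p) (f p) := rfl
    rw [lineDerivOp_apply_eq_fderiv, h1, fderiv_inner_apply ℝ f.differentiableAt f.differentiableAt,
      lineDerivOp_apply_eq_fderiv, real_inner_comm (f p)]
    ring
  have hdd : ∀ p : ℂ, (∂_{Complex.I} (∂_{(1 : ℂ)} F)) p =
      2 * (inner ℝ (f p) ((∂_{Complex.I} (∂_{(1 : ℂ)} f)) p) +
        inner ℝ ((∂_{Complex.I} f) p) ((∂_{(1 : ℂ)} f) p)) := by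
    intro p
    have h1 : ((∂_{(1 : ℂ)} F : 𝓢(ℂ, ℝ)) : ℂ → ℝ) =
        fun p => 2 * inner ℝ (f p) ((∂_{(1 : ℂ)} f) p) := funext (hd 1)
    rw [lineDerivOp_apply_eq_fderiv, h1, fderiv_const_mul
      (f.differentiableAt.inner ℝ (∂_{(1 : ℂ)} f : 𝓢(ℂ, ℂ)).differentiableAt),
      _root_.smul_apply, fderiv_inner_apply ℝ f.differentiableAt
      (∂_{(1 : ℂ)} f : 𝓢(ℂ, ℂ)).differentiableAt]
    rfl
  have h1 : ‖f z‖ ^ 2 ≤ ∫ p, |∂_{Complex.I} (∂_{(1 : ℂ)} F) p| := by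
    have := abs_schwartz_le_integral_mixed F z
    rwa [hF, real_inner_self_eq_norm_sq, abs_of_nonneg (sq_nonneg _)] at this
  have h2 : ∫ p, |∂_{Complex.I} (∂_{(1 : ℂ)} F) p| ≤
      ∫ p, (((‖f p‖ ^ 2 + ‖(∂_{Complex.I} (∂_{(1 : ℂ)} f)) p‖ ^ 2) +
        ‖(∂_{Complex.I} f) p‖ ^ 2) + ‖(∂_{(1 : ℂ)} f) p‖ ^ 2) := by
    refine integral_mono_of_nonneg (ae_of_all _ fun t => abs_nonneg _)
      ((((integrable_norm_sq _).add (integrable_norm_sq _)).add (integrable_norm_sq _)).add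
        (integrable_norm_sq _)) (ae_of_all _ fun p => ?_)
    simp only [hdd]
    have e1 := abs_real_inner_le_norm (f p) ((∂_{Complex.I} (∂_{(1 : ℂ)} f)) p)
    have e2 := abs_real_inner_le_norm ((∂_{Complex.I} f) p) ((∂_{(1 : ℂ)} f) p)
    rw [abs_mul, abs_two]
    have e3 := abs_add_le (inner ℝ (f p) ((∂_{Complex.I} (∂_{(1 : ℂ)} f)) p))
      (inner ℝ ((∂_{Complex.I} f) p) ((∂_{(1 : ℂ)} f) p))
    have e4 := two_mul_le_add_sq ‖f p‖ ‖(∂_{Complex.I} (∂_{(1 : ℂ)} f)) p‖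
    have e5 := two_mul_le_add_sq ‖(∂_{Complex.I} f) p‖ ‖(∂_{(1 : ℂ)} f) p‖
    linarith
  have e : ∀ a b c d : ℂ → ℝ, Integrable a → Integrable b → Integrable c → Integrable d →
      ∫ p, (a p + b p + c p + d p) = (∫ p, a p) + (∫ p, b p) + (∫ p, c p) + ∫ p, d p := by
    intro a b c d ha hb hc hd
    rw [integral_add (f := fun p => a p + b p + c p) ((ha.add hb).add hc) hd,
      integral_add (f := fun p => a p + b p) (ha.add hb) hc, integral_add ha hb]
  rw [e _ _ _ _ (integrable_norm_sq _) (integrable_norm_sq _) (integrable_norm_sq _)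
    (integrable_norm_sq _), ← norm_sq_toL2, ← norm_sq_toL2, ← norm_sq_toL2, ← norm_sq_toL2] at h2
  have := sq_nonneg ‖toL2 (∂_{(1 : ℂ)} (∂_{(1 : ℂ)} f))‖
  have := sq_nonneg ‖toL2 (∂_{Complex.I} (∂_{Complex.I} f))‖
  have := sq_nonneg ‖toL2 (sqMul f)‖
  linarith

/-! ### The Gaussian as a Schwartz function -/

lemma norm_iteratedFDeriv_exp_ofReal (i : ℕ) (t : ℝ) :
    ‖iteratedFDeriv ℝ i (fun t : ℝ => (Real.exp t : ℂ)) t‖ ≤ Real.exp t := by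
  rw [norm_iteratedFDeriv_eq_norm_iteratedDeriv]
  have h : ∀ i : ℕ, iteratedDeriv i (fun t : ℝ => (Real.exp t : ℂ)) = fun t => (Real.exp t : ℂ) := by
    intro i
    induction i with
    | zero => exact iteratedDeriv_zero
    | succ i ih =>
      rw [iteratedDeriv_succ, ih]
      ext t
      exact (Real.hasDerivAt_exp t).ofReal_comp.deriv
  rw [h i, Complex.norm_real, Real.norm_eq_abs, abs_of_pos (Real.exp_pos t)]

lemma pow_mul_exp_neg_sq_le (N : ℕ) {r : ℝ} (hr : 0 ≤ r) :
    (1 + r) ^ N * Real.exp (-r ^ 2 / 2) ≤ N.factorial * Real.exp (3 / 2) := by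
  have h1 : (1 + r) ^ N / N.factorial ≤ Real.exp (1 + r) :=
    Real.pow_div_factorial_le_exp (1 + r) (by linarith) N
  rw [div_le_iff₀ (by positivity)] at h1
  have h2 : Real.exp (1 + r) * Real.exp (-r ^ 2 / 2) ≤ Real.exp (3 / 2) := by
    rw [← Real.exp_add]
    apply Real.exp_le_exp.mpr
    nlinarith [sq_nonneg (r - 1)]
  calc (1 + r) ^ N * Real.exp (-r ^ 2 / 2)
      ≤ (Real.exp (1 + r) * N.factorial) * Real.exp (-r ^ 2 / 2) := by gcongr
    _ = N.factorial * (Real.exp (1 + r) * Real.exp (-r ^ 2 / 2)) := by ring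
    _ ≤ _ := by gcongr

/-- The Gaussian `e^{-|z|²/2}` as a Schwartz function of the plane. -/
def gaussian : 𝓢(ℂ, ℂ) where
  toFun z := (Real.exp (-‖z‖ ^ 2 / 2) : ℂ)
  smooth' := by
    have h : ContDiff ℝ ∞ fun z : ℂ => Real.exp (-‖z‖ ^ 2 / 2) :=
      Real.contDiff_exp.comp ((contDiff_norm_sq ℝ).neg.div_const 2)
    exact Complex.ofRealCLM.contDiff.comp h
  decay' k n := by
    have hf : Function.HasTemperateGrowth (fun z : ℂ => -‖z‖ ^ 2 / 2) := by
      have := (Function.hasTemperateGrowth_norm_sq ℂ).mul (.const (-1 / 2 : ℝ))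
      have e : (fun z : ℂ => -‖z‖ ^ 2 / 2) = (fun z : ℂ => ‖z‖ ^ 2) * fun _ => (-1 / 2 : ℝ) := by
        ext z
        simp only [Pi.mul_apply]
        ring
      rw [e]
      exact this
    obtain ⟨j, C, hC, hb⟩ := hf.norm_iteratedFDeriv_le_uniform n
    refine ⟨n.factorial * (max C 1) ^ n * ((k + j * n).factorial * Real.exp (3 / 2)), fun z => ?_⟩
    have hD : 1 ≤ max C 1 * (1 + ‖z‖) ^ j :=
      one_le_mul_of_one_le_of_one_le (le_max_right _ _)
        (one_le_pow₀ (by linarith [norm_nonneg z]))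
    -- A Faà di Bruno bound: the derivatives of `exp` contribute the Gaussian itself and those of
    -- the quadratic exponent grow polynomially.
    have h := norm_iteratedFDeriv_comp_le (g := fun t : ℝ => (Real.exp t : ℂ))
      (f := fun z : ℂ => -‖z‖ ^ 2 / 2) (n := n) (N := ∞)
      (Complex.ofRealCLM.contDiff.comp Real.contDiff_exp) hf.1 (mod_cast le_top) z
      (C := Real.exp (-‖z‖ ^ 2 / 2)) (D := max C 1 * (1 + ‖z‖) ^ j)
      (fun i _ => norm_iteratedFDeriv_exp_ofReal i _)
      (fun i hi1 hi2 => by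
        refine (hb i hi2 z).trans ?_
        refine le_trans ?_ (le_self_pow₀ hD (by omega))
        gcongr
        exact le_max_left _ _)
    have hk : ‖z‖ ^ k ≤ (1 + ‖z‖) ^ k := by gcongr; linarith
    calc ‖z‖ ^ k * ‖iteratedFDeriv ℝ n (fun z : ℂ => (Real.exp (-‖z‖ ^ 2 / 2) : ℂ)) z‖
        ≤ (1 + ‖z‖) ^ k * (n.factorial * Real.exp (-‖z‖ ^ 2 / 2) *
          (max C 1 * (1 + ‖z‖) ^ j) ^ n) := by
          gcongr
          exact h
      _ = n.factorial * (max C 1) ^ n *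
          ((1 + ‖z‖) ^ (k + j * n) * Real.exp (-‖z‖ ^ 2 / 2)) := by
          rw [mul_pow, ← pow_mul, pow_add]; ring
      _ ≤ _ := mul_le_mul_of_nonneg_left (pow_mul_exp_neg_sq_le _ (norm_nonneg z))
          (by positivity)

lemma gaussian_apply (z : ℂ) : gaussian z = (Real.exp (-‖z‖ ^ 2 / 2) : ℂ) := rfl

/-! ### Waves of angular momentum `m` and the Laguerre operator -/

lemma hasTemperateGrowth_eval (p : ℝ[X]) : Function.HasTemperateGrowth (fun t : ℝ => p.eval t) := by
  simp_rw [Polynomial.eval_eq_sum_range]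
  exact Function.HasTemperateGrowth.sum fun i _ =>
    (Function.HasTemperateGrowth.const _).mul (Function.HasTemperateGrowth.id'.pow i)

lemma hasTemperateGrowth_pow_mul_eval (m : ℕ) (p : ℝ[X]) :
    Function.HasTemperateGrowth (fun z : ℂ => z ^ m * ((p.eval (‖z‖ ^ 2) : ℝ) : ℂ)) :=
  (Function.HasTemperateGrowth.id'.pow m).mul
    ((Complex.ofRealCLM.hasTemperateGrowth).comp
      ((hasTemperateGrowth_eval p).comp (Function.hasTemperateGrowth_norm_sq ℂ)))

/-- The Schwartz function `z^m p(|z|²) e^{-|z|²/2}`, of angular momentum `m`. -/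
def wave (m : ℕ) : ℝ[X] →ₗ[ℝ] 𝓢(ℂ, ℂ) where
  toFun p := smulLeftCLM ℂ (fun z : ℂ => z ^ m * ((p.eval (‖z‖ ^ 2) : ℝ) : ℂ)) gaussian
  map_add' p q := by
    ext z
    rw [_root_.add_apply, smulLeftCLM_apply_apply (hasTemperateGrowth_pow_mul_eval m _),
      smulLeftCLM_apply_apply (hasTemperateGrowth_pow_mul_eval m _),
      smulLeftCLM_apply_apply (hasTemperateGrowth_pow_mul_eval m _)]
    simp only [Polynomial.eval_add, smul_eq_mul]
    push_cast
    ring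
  map_smul' c p := by
    ext z
    rw [_root_.smul_apply, smulLeftCLM_apply_apply (hasTemperateGrowth_pow_mul_eval m _),
      smulLeftCLM_apply_apply (hasTemperateGrowth_pow_mul_eval m _)]
    simp only [Polynomial.eval_smul, smul_eq_mul, RingHom.id_apply, Complex.real_smul]
    push_cast
    ring

/-- The radial function `p(|z|²) e^{-|z|²/2}`. -/
def radialPart (p : ℝ[X]) (z : ℂ) : ℂ := (p.eval (‖z‖ ^ 2) * Real.exp (-‖z‖ ^ 2 / 2) : ℝ)

lemma wave_apply (m : ℕ) (p : ℝ[X]) (z : ℂ) : wave m p z = z ^ m * radialPart p z := by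
  change smulLeftCLM ℂ (fun z : ℂ => z ^ m * ((p.eval (‖z‖ ^ 2) : ℝ) : ℂ)) gaussian z = _
  rw [smulLeftCLM_apply_apply (hasTemperateGrowth_pow_mul_eval m _), gaussian_apply, radialPart,
    smul_eq_mul]
  push_cast
  ring

lemma hasDerivAt_line (z v : ℂ) (s : ℝ) : HasDerivAt (fun s : ℝ => z + s • v) v s := by
  simpa using ((hasDerivAt_id s).smul_const v).const_add z

lemma hasDerivAt_radialPart (p : ℝ[X]) (z v : ℂ) :
    HasDerivAt (fun s : ℝ => radialPart p (z + s • v))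
      (2 * (inner ℝ z v : ℝ) * radialPart (derivative p - C (1 / 2) * p) z) 0 := by
  have h1 : HasDerivAt (fun s : ℝ => ‖z + s • v‖ ^ 2) (2 * inner ℝ z v) 0 := by
    simpa using (hasDerivAt_line z v 0).norm_sq
  have h2 := ((p.hasDerivAt _).comp (0 : ℝ) h1).mul (h1.neg.div_const 2).exp
  have h3 := h2.ofReal_comp
  refine (h3.congr_deriv ?_)
  simp [radialPart]
  ring

lemma lineDeriv_apply_of_hasDerivAt {f : 𝓢(ℂ, ℂ)} {z v d : ℂ}
    (h : HasDerivAt (fun s : ℝ => f (z + s • v)) d 0) : (∂_{v} f) z = d := by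
  rw [lineDerivOp_apply]
  exact h.deriv

lemma lineDeriv_wave (m : ℕ) (p : ℝ[X]) (v z : ℂ) :
    (∂_{v} (wave m p)) z = m * z ^ (m - 1) * v * radialPart p z +
      z ^ m * (2 * (inner ℝ z v : ℝ) * radialPart (derivative p - C (1 / 2) * p) z) := by
  apply lineDeriv_apply_of_hasDerivAt
  simp_rw [wave_apply]
  refine (((hasDerivAt_line z v 0).pow m).mul (hasDerivAt_radialPart p z v)).congr_deriv ?_
  simp

lemma lineDeriv_lineDeriv_wave (m : ℕ) (p : ℝ[X]) (v z : ℂ) :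
    (∂_{v} (∂_{v} (wave m p))) z =
      m * ((m - 1 : ℕ) * z ^ (m - 1 - 1)) * v ^ 2 * radialPart p z +
      4 * m * z ^ (m - 1) * v * (inner ℝ z v : ℝ) * radialPart (derivative p - C (1 / 2) * p) z +
      2 * (‖v‖ ^ 2 : ℝ) * z ^ m * radialPart (derivative p - C (1 / 2) * p) z +
      4 * (inner ℝ z v : ℝ) ^ 2 * z ^ m * radialPart (derivative (derivative p - C (1 / 2) * p) -
        C (1 / 2) * (derivative p - C (1 / 2) * p)) z := by
  apply lineDeriv_apply_of_hasDerivAt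
  simp_rw [lineDeriv_wave]
  have hi : HasDerivAt (fun s : ℝ => ((inner ℝ (z + s • v) v : ℝ) : ℂ)) ((‖v‖ ^ 2 : ℝ) : ℂ) 0 := by
    have := (hasDerivAt_line z v 0).inner ℝ (hasDerivAt_const (0 : ℝ) v)
    simp only [inner_zero_right, zero_add, real_inner_self_eq_norm_sq] at this
    exact this.ofReal_comp
  have h1 := ((((hasDerivAt_line z v 0).pow (m - 1)).const_mul (m : ℂ)).mul_const v).mul
    (hasDerivAt_radialPart p z v)
  have h2 := ((hasDerivAt_line z v 0).pow m).mul
    ((hi.const_mul 2).mul (hasDerivAt_radialPart (derivative p - C (1 / 2) * p) z v))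
  refine (h1.add h2).congr_deriv ?_
  simp
  ring

/-- The Laguerre operator `p ↦ -(X p'' + (m + 1 - Polynomial.X) p')` on polynomials. -/
def laguerreOp (m : ℕ) : ℝ[X] →ₗ[ℝ] ℝ[X] where
  toFun p := -(Polynomial.X * derivative (derivative p) + ((m + 1 : ℝ[X]) - Polynomial.X) * derivative p)
  map_add' p q := by simp only [derivative_add]; ring
  map_smul' c p := by simp only [RingHom.id_apply, Polynomial.smul_eq_C_mul, derivative_C_mul]; ring

lemma laguerreOp_apply (m : ℕ) (p : ℝ[X]) :
    laguerreOp m p = -(Polynomial.X * derivative (derivative p) + ((m + 1 : ℝ[X]) - Polynomial.X) * derivative p) := rfl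

/-- The conjugation that reduces the spectral theory to polynomials: in the variable `t = |z|²`, the
oscillator on these waves is `2(m + 1) + 4 L_m`, and constants span the kernel of `A`. -/
lemma oscillator_wave (m : ℕ) (p : ℝ[X]) :
    - lap (wave m p) + sqMul (wave m p) =
      (2 * (m + 1) : ℝ) • wave m p + (4 : ℝ) • wave m (laguerreOp m p) := by
  ext z
  simp only [_root_.add_apply, _root_.neg_apply, _root_.smul_apply, lap, sqMul_apply,
    lineDeriv_lineDeriv_wave, wave_apply, Complex.real_smul]
  have hz : z = z.re + z.im * Complex.I := (Complex.re_add_im z).symm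
  have hn : ‖z‖ ^ 2 = z.re ^ 2 + z.im ^ 2 := by rw [Complex.sq_norm, Complex.normSq_apply]; ring
  have hm : (m : ℂ) * z ^ (m - 1) * z = m * z ^ m := by
    rcases m with _ | m
    · simp
    · simp [pow_succ]; ring
  have e1 : inner ℝ z 1 = z.re := by simp [Complex.inner]
  have e2 : inner ℝ z Complex.I = z.im := by simp [Complex.inner]
  rw [e1, e2]
  simp only [radialPart, laguerreOp_apply, hn]
  generalize Real.exp (-(z.re ^ 2 + z.im ^ 2) / 2) = E
  simp only [norm_one, Complex.norm_I, Complex.I_sq, derivative_sub, derivative_mul, derivative_C,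
    eval_sub, eval_neg, eval_add, eval_mul, eval_C, eval_X, eval_one, eval_natCast,
    zero_mul, zero_add]
  push_cast
  set P0 := ((p.eval (z.re ^ 2 + z.im ^ 2) : ℝ) : ℂ)
  set P1 := (((derivative p).eval (z.re ^ 2 + z.im ^ 2) : ℝ) : ℂ)
  set P2 := (((derivative (derivative p)).eval (z.re ^ 2 + z.im ^ 2) : ℝ) : ℂ)
  set x : ℂ := (z.re : ℂ)
  set y : ℂ := (z.im : ℂ)
  have hm' : (m : ℂ) * z ^ (m - 1) * (x + y * Complex.I) = m * z ^ m := by rw [← hz]; exact hm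
  -- The terms in `z^(m-2)` cancel because `1 + I² = 0` (`z^m` is harmonic). The cross terms contain
  -- `m z^(m-1) (x + iy)`, which `hm'` turns into `m z^m`.
  linear_combination (-4 * (P1 - 1 / 2 * P0) * E) * hm'

/-! ### The spectral gap of the Laguerre operator -/

/-- The `L²` class of `z^m p(|z|²) e^{-|z|²/2}`. -/
def waveL2 (m : ℕ) : ℝ[X] →ₗ[ℝ] L2 := (toL2 : 𝓢(ℂ, ℂ) →ₗ[ℝ] L2) ∘ₗ wave m

lemma waveL2_apply (m : ℕ) (p : ℝ[X]) : waveL2 m p = toL2 (wave m p) := rfl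

lemma inner_wave_apply (m : ℕ) (p q : ℝ[X]) (z : ℂ) :
    inner ℝ (wave m p z) (wave m q z) =
      ‖z‖ ^ (2 * m) * p.eval (‖z‖ ^ 2) * q.eval (‖z‖ ^ 2) * Real.exp (-‖z‖ ^ 2) := by
  have hE : Real.exp (-‖z‖ ^ 2) = Real.exp (-‖z‖ ^ 2 / 2) * Real.exp (-‖z‖ ^ 2 / 2) := by
    rw [← Real.exp_add]; ring_nf
  have h : ∀ p : ℝ[X], wave m p z =
      (p.eval (‖z‖ ^ 2) * Real.exp (-‖z‖ ^ 2 / 2) : ℝ) • z ^ m := by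
    intro p
    rw [wave_apply, radialPart, Complex.real_smul, mul_comm]
  rw [h, h, real_inner_smul_left, real_inner_smul_right, real_inner_self_eq_norm_sq, norm_pow, hE]
  ring

lemma integrable_inner_schwartz (f g : 𝓢(ℂ, ℂ)) : Integrable fun z => inner ℝ (f z) (g z) :=
  (pairing (innerSL ℝ (E := ℂ)) f g).integrable (μ := volume)

/-- In divergence form `t^m e^{-t} L_m p = -(t^{m+1} e^{-t} p')'`, so integration by parts moves one
derivative onto `q` and raises the weight from `m` to `m + 1`. -/
lemma inner_laguerreOp (m : ℕ) (p q : ℝ[X]) :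
    inner ℝ (waveL2 m (laguerreOp m p)) (waveL2 m q) =
      inner ℝ (waveL2 (m + 1) (derivative p)) (waveL2 (m + 1) (derivative q)) := by
  rw [waveL2_apply, waveL2_apply, waveL2_apply, waveL2_apply, inner_toL2, inner_toL2,
    ← sub_eq_zero, ← integral_sub (integrable_inner_schwartz _ _) (integrable_inner_schwartz _ _)]
  simp_rw [inner_wave_apply]
  rw [integral_fun_norm_addHaar volume (fun r : ℝ => r ^ (2 * m) * (laguerreOp m p).eval (r ^ 2) *
    q.eval (r ^ 2) * Real.exp (-r ^ 2) - r ^ (2 * (m + 1)) * (derivative p).eval (r ^ 2) *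
    (derivative q).eval (r ^ 2) * Real.exp (-r ^ 2))]
  -- The primitive `r^{2(m+1)} p'(r²) q(r²) e^{-r²}` is realised as the restriction of a Schwartz
  -- function to the real axis, which supplies its decay at infinity and the integrability of its
  -- derivative.
  obtain ⟨G, hG⟩ := exists_schwartz_horizontal
    (pairing (innerSL ℝ (E := ℂ)) (wave (m + 1) (derivative p)) (wave (m + 1) q)) 0
  have hG' : (G : ℝ → ℝ) = fun r : ℝ => r ^ (2 * (m + 1)) * (derivative p).eval (r ^ 2) *
      q.eval (r ^ 2) * Real.exp (-r ^ 2) := by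
    ext r
    rw [hG]
    have := inner_wave_apply (m + 1) (derivative p) q (r + (0 : ℝ) * Complex.I)
    simp only [Complex.ofReal_zero, zero_mul, add_zero, Complex.norm_real, Real.norm_eq_abs,
      sq_abs, pow_mul |r|] at this
    simp only [Complex.ofReal_zero, zero_mul, add_zero, pow_mul r]
    exact this
  have hd : ∀ r : ℝ, deriv G r = -2 * (r * (r ^ (2 * m) * (laguerreOp m p).eval (r ^ 2) *
      q.eval (r ^ 2) * Real.exp (-r ^ 2) - r ^ (2 * (m + 1)) * (derivative p).eval (r ^ 2) *
      (derivative q).eval (r ^ 2) * Real.exp (-r ^ 2))) := by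
    intro r
    have h2 : HasDerivAt (fun r : ℝ => r ^ 2) (2 * r) r := by simpa using hasDerivAt_pow 2 r
    have h := (((hasDerivAt_pow (2 * (m + 1)) r).mul
      (((derivative p).hasDerivAt (r ^ 2)).comp r h2)).mul
      ((q.hasDerivAt (r ^ 2)).comp r h2)).mul h2.neg.exp
    rw [hG']
    refine h.deriv.trans ?_
    simp [laguerreOp_apply, show 2 * (m + 1) - 1 = 2 * m + 1 by omega, pow_succ]
    ring
  have h0 : ∫ r in Ioi (0 : ℝ), deriv G r = 0 := by
    have := integral_Ioi_of_hasDerivAt_of_tendsto (f := G) (f' := deriv G) (a := 0) (m := 0)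
      G.continuous.continuousWithinAt (fun t _ => G.hasDerivAt t)
      (derivCLM ℝ ℝ G).integrable.integrableOn (G.tendsto_cocompact.mono_left atTop_le_cocompact)
    rw [this, hG']
    simp
  simp_rw [hd] at h0
  rw [integral_const_mul] at h0
  have h1 := (mul_eq_zero.mp h0).resolve_left (by norm_num)
  simp only [Complex.finrank_real_complex, Nat.add_one_sub_one, pow_one, smul_eq_mul]
  rw [h1]
  simp

/-- Differentiation intertwines `L_m` with `L_{m+1} + 1`; the added identity is the source of the
gap. -/
lemma derivative_laguerreOp (m : ℕ) (p : ℝ[X]) :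
    derivative (laguerreOp m p) = laguerreOp (m + 1) (derivative p) + derivative p := by
  simp [laguerreOp_apply]
  ring

lemma laguerreOp_C (m : ℕ) (c : ℝ) : laguerreOp m (C c) = 0 := by simp [laguerreOp_apply]

lemma inner_laguerreOp_nonneg (m : ℕ) (p : ℝ[X]) :
    0 ≤ inner ℝ (waveL2 m (laguerreOp m p)) (waveL2 m p) := by
  rw [inner_laguerreOp]
  exact real_inner_self_nonneg

lemma inner_laguerreOp_comm (m : ℕ) (p q : ℝ[X]) :
    inner ℝ (waveL2 m (laguerreOp m p)) (waveL2 m q) =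
      inner ℝ (waveL2 m p) (waveL2 m (laguerreOp m q)) := by
  rw [inner_laguerreOp, ← real_inner_comm, ← inner_laguerreOp, real_inner_comm]

lemma inner_laguerreOp_one (m : ℕ) (p : ℝ[X]) :
    inner ℝ (waveL2 m (laguerreOp m p)) (waveL2 m 1) = 0 := by
  rw [inner_laguerreOp]
  simp

/-- By parts, `‖L_m p‖² = ⟨p', (L_m p)'⟩ = ⟨p', L_{m+1} p'⟩ + ‖p'‖²` in weight `m + 1`. The first
term is nonnegative and the second is `⟨L_m p, p⟩`. -/
lemma inner_laguerreOp_le_norm_sq (m : ℕ) (p : ℝ[X]) :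
    inner ℝ (waveL2 m (laguerreOp m p)) (waveL2 m p) ≤ ‖waveL2 m (laguerreOp m p)‖ ^ 2 := by
  rw [← real_inner_self_eq_norm_sq, inner_laguerreOp, inner_laguerreOp m p (laguerreOp m p),
    derivative_laguerreOp, map_add, inner_add_right]
  linarith [inner_laguerreOp_nonneg (m + 1) (derivative p),
    real_inner_comm (waveL2 (m + 1) (laguerreOp (m + 1) (derivative p)))
      (waveL2 (m + 1) (derivative p))]

/-- `L_m` is triangular on monomials: `L_m X^{n+1} = (n+1)(X^{n+1} - (n+1+m) X^n)`, so every
monomial is reached modulo constants by induction. -/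
lemma exists_eq_laguerreOp_add_C (m : ℕ) (q : ℝ[X]) :
    ∃ (p : ℝ[X]) (c : ℝ), q = laguerreOp m p + C c := by
  induction q using Polynomial.induction_on' with
  | add q₁ q₂ h₁ h₂ =>
    obtain ⟨p₁, c₁, h₁⟩ := h₁
    obtain ⟨p₂, c₂, h₂⟩ := h₂
    exact ⟨p₁ + p₂, c₁ + c₂, by rw [h₁, h₂, map_add, C_add]; abel⟩
  | monomial n a =>
    rw [← C_mul_X_pow_eq_monomial]
    have key : ∃ (p : ℝ[X]) (c : ℝ), (Polynomial.X ^ n : ℝ[X]) = laguerreOp m p + C c := by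
      induction n with
      | zero => exact ⟨0, 1, by simp⟩
      | succ n ih =>
        obtain ⟨p, c, h⟩ := ih
        have e : laguerreOp m (Polynomial.X ^ (n + 1)) =
            C ((n : ℝ) + 1) * (Polynomial.X ^ (n + 1) - C ((n : ℝ) + 1 + m) * Polynomial.X ^ n) := by
          rcases n with _ | n
          · simp [laguerreOp_apply]
            ring
          · rw [laguerreOp_apply, derivative_X_pow, derivative_C_mul, derivative_X_pow]
            simp only [Nat.add_sub_cancel, Nat.cast_add, Nat.cast_one, map_add, map_natCast, C_1]
            ring
        refine ⟨C (((n : ℝ) + 1)⁻¹) * Polynomial.X ^ (n + 1) + C ((n : ℝ) + 1 + m) * p,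
          ((n : ℝ) + 1 + m) * c, ?_⟩
        rw [map_add, ← smul_eq_C_mul, ← smul_eq_C_mul, map_smul, map_smul, e, C_mul]
        simp only [smul_eq_C_mul]
        rw [← mul_assoc, ← C_mul, inv_mul_cancel₀ (by positivity), C_1, one_mul]
        rw [h]
        ring
    obtain ⟨p, c, h⟩ := key
    exact ⟨C a * p, a * c, by rw [← smul_eq_C_mul (a := a) (p := p), map_smul, h, smul_eq_C_mul, C_mul]; ring⟩

lemma norm_waveL2_le_laguerreOp (m : ℕ) (q : ℝ[X])
    (h : inner ℝ (waveL2 m q) (waveL2 m 1) = 0) :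
    ‖waveL2 m q‖ ≤ ‖waveL2 m (laguerreOp m q)‖ := by
  obtain ⟨p, c, hq⟩ := exists_eq_laguerreOp_add_C m q
  have hC : waveL2 m (C c) = c • waveL2 m 1 := by
    rw [← map_smul, smul_eq_C_mul, mul_one]
  have h1 : waveL2 m q = waveL2 m (laguerreOp m p) := by
    have hc : c • waveL2 m 1 = 0 := by
      have h2 : inner ℝ (waveL2 m q) (c • waveL2 m 1) = 0 := by rw [inner_smul_right, h, mul_zero]
      have h3 : inner ℝ (waveL2 m (laguerreOp m p)) (c • waveL2 m 1) = 0 := by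
        rw [inner_smul_right, inner_laguerreOp_one, mul_zero]
      rw [hq, map_add, hC, inner_add_left, h3, zero_add] at h2
      exact inner_self_eq_zero.mp h2
    rw [hq, map_add, hC, hc, add_zero]
  -- In `L²` one has `q = L p`. Expanding `⟨L(p - q), p - q⟩ ≥ 0` and using `⟨Lp, p⟩ ≤ ‖Lp‖² = ‖q‖²`
  -- and `⟨Lq, p⟩ = ‖q‖²` leaves `‖q‖² ≤ ⟨Lq, q⟩`.
  have h2 := inner_laguerreOp_nonneg m (p - q)
  have h3 := inner_laguerreOp_le_norm_sq m p
  have h4 := inner_laguerreOp_comm m p q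
  simp only [map_sub, inner_sub_left, inner_sub_right] at h2
  rw [← h1] at h2 h3 h4
  rw [real_inner_self_eq_norm_sq] at h2 h4
  have h6 := real_inner_comm (waveL2 m p) (waveL2 m (laguerreOp m q))
  have h5 : ‖waveL2 m q‖ ^ 2 ≤ ‖waveL2 m (laguerreOp m q)‖ * ‖waveL2 m q‖ := by
    have := real_inner_le_norm (waveL2 m (laguerreOp m q)) (waveL2 m q)
    linarith
  by_contra! hlt
  have : 0 < ‖waveL2 m q‖ := (norm_nonneg _).trans_lt hlt
  nlinarith

/-! ### Weak derivatives tested against Schwartz functions -/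

lemma integrable_inner_L2 (f : 𝓢(ℂ, ℂ)) (g : L2) : Integrable fun z => inner ℝ (f z) (g z) := by
  refine (L2.integrable_inner (𝕜 := ℝ) (toL2 f) g).congr ?_
  filter_upwards [coeFn_toL2 f] with z hf
  rw [hf]

/-- A real test function as a complex valued Schwartz function, multiplied by a constant. -/
def testMul (φ : 𝓢(ℂ, ℝ)) (a : ℂ) : 𝓢(ℂ, ℂ) :=
  postcompCLM (𝕜 := ℝ) ((ContinuousLinearMap.id ℝ ℝ).smulRight a) φ

lemma testMul_apply (φ : 𝓢(ℂ, ℝ)) (a z : ℂ) : testMul φ a z = φ z • a := rfl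

lemma lineDeriv_testMul (φ : 𝓢(ℂ, ℝ)) (a v z : ℂ) :
    (∂_{v} (testMul φ a)) z = fderiv ℝ φ z v • a := by
  rw [lineDerivOp_apply_eq_fderiv]
  have h : HasFDerivAt (fun z => φ z • a) ((fderiv ℝ φ z).smulRight a) z :=
    (φ.hasFDerivAt z).smul_const a
  have e : (testMul φ a : ℂ → ℂ) = fun z => φ z • a := rfl
  rw [e, h.fderiv]
  simp

lemma inner_smul_one_left (c : ℝ) (w : ℂ) : inner ℝ (c • (1 : ℂ)) w = (c • w).re := by
  simp [Complex.inner, mul_comm]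

lemma inner_smul_I_left (c : ℝ) (w : ℂ) : inner ℝ (c • Complex.I) w = (c • w).im := by
  simp [Complex.inner, mul_comm]

/-- Translates between complex integrals against real test functions and real inner products:
testing with the directions `1` and `I` recovers the real and imaginary parts. -/
lemma integral_smul_eq_iff {φ₁ φ₂ : ℂ → ℝ} {f g : ℂ → ℂ} (hf : Integrable fun z => φ₁ z • f z)
    (hg : Integrable fun z => φ₂ z • g z) :
    ∫ z, φ₁ z • f z = - ∫ z, φ₂ z • g z ↔
      (∫ z, inner ℝ (φ₁ z • (1 : ℂ)) (f z) = - ∫ z, inner ℝ (φ₂ z • (1 : ℂ)) (g z)) ∧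
      (∫ z, inner ℝ (φ₁ z • Complex.I) (f z) = - ∫ z, inner ℝ (φ₂ z • Complex.I) (g z)) := by
  simp_rw [inner_smul_one_left, inner_smul_I_left]
  have e1 := Complex.reCLM.integral_comp_comm hf
  have e2 := Complex.reCLM.integral_comp_comm hg
  have e3 := Complex.imCLM.integral_comp_comm hf
  have e4 := Complex.imCLM.integral_comp_comm hg
  simp only [Complex.reCLM_apply, Complex.imCLM_apply] at e1 e2 e3 e4
  rw [e1, e2, e3, e4, Complex.ext_iff, Complex.neg_re, Complex.neg_im]

lemma isWeakDeriv_of_inner {v : ℂ} {f g : L2}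
    (h : ∀ ψ : 𝓢(ℂ, ℂ), inner ℝ (toL2 (∂_{v} ψ)) f = - inner ℝ (toL2 ψ) g) :
    IsWeakDeriv v f g := by
  intro φ hφ hc
  rw [integral_smul_eq_iff (integrable_test_deriv hφ hc v f) (integrable_test hφ.continuous hc g)]
  have key : ∀ a : ℂ, ∫ z, inner ℝ (fderiv ℝ φ z v • a) (f z) = - ∫ z, inner ℝ (φ z • a) (g z) := by
    intro a
    have := h (testMul (hc.toSchwartzMap hφ) a)
    rw [inner_toL2_left, inner_toL2_left] at this
    simp only [lineDeriv_testMul, testMul_apply] at this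
    exact this
  exact ⟨key 1, key Complex.I⟩

lemma IsWeakDeriv.inner_of_hasCompactSupport {v : ℂ} {f g : L2} (h : IsWeakDeriv v f g)
    (ψ : 𝓢(ℂ, ℂ)) (hc : HasCompactSupport ψ) :
    inner ℝ (toL2 (∂_{v} ψ)) f = - inner ℝ (toL2 ψ) g := by
  have hre : ContDiff ℝ ∞ fun z => (ψ z).re := Complex.reCLM.contDiff.comp (ψ.smooth ⊤)
  have him : ContDiff ℝ ∞ fun z => (ψ z).im := Complex.imCLM.contDiff.comp (ψ.smooth ⊤)
  have hcre : HasCompactSupport fun z => (ψ z).re :=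
    HasCompactSupport.comp_left (g := Complex.re) hc Complex.zero_re
  have hcim : HasCompactSupport fun z => (ψ z).im :=
    HasCompactSupport.comp_left (g := Complex.im) hc Complex.zero_im
  have h1 := ((integral_smul_eq_iff (integrable_test_deriv hre hcre v f)
    (integrable_test hre.continuous hcre g)).mp (h _ hre hcre)).1
  have h2 := ((integral_smul_eq_iff (integrable_test_deriv him hcim v f)
    (integrable_test him.continuous hcim g)).mp (h _ him hcim)).2
  have i1 := (integrable_test_deriv hre hcre v f).re
  have i2 := (integrable_test_deriv him hcim v f).im
  have i3 := (integrable_test hre.continuous hcre g).re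
  have i4 := (integrable_test him.continuous hcim g).im
  simp_rw [inner_smul_one_left] at h1
  simp_rw [inner_smul_I_left] at h2
  have d1 : ∀ z, fderiv ℝ (fun z => (ψ z).re) z v = ((∂_{v} ψ) z).re := fun z => by
    rw [lineDerivOp_apply_eq_fderiv]
    exact congrArg (fun L => L v) (Complex.reCLM.hasFDerivAt.comp z (ψ.hasFDerivAt z)).fderiv
  have d2 : ∀ z, fderiv ℝ (fun z => (ψ z).im) z v = ((∂_{v} ψ) z).im := fun z => by
    rw [lineDerivOp_apply_eq_fderiv]
    exact congrArg (fun L => L v) (Complex.imCLM.hasFDerivAt.comp z (ψ.hasFDerivAt z)).fderiv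
  have hin : ∀ a b : ℂ, inner ℝ a b = (a.re • b).re + (a.im • b).im := by
    intro a b
    simp [Complex.inner]
    ring
  rw [inner_toL2_left, inner_toL2_left]
  simp_rw [d1] at h1 i1
  simp_rw [d2] at h2 i2
  simp_rw [hin]
  have e1 := integral_add i1 i2
  have e2 := integral_add i3 i4
  simp only [RCLike.re_to_complex, RCLike.im_to_complex] at e1 e2
  rw [e1, e2, h1, h2]
  ring

/-- Smooth cutoff functions which equal `1` on the disc of radius `n + 1`. -/
lemma exists_cutoff (v : ℂ) : ∃ (χ : ℕ → ℂ → ℝ) (K : ℝ), (∀ n, ContDiff ℝ ∞ (χ n)) ∧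
    (∀ n, HasCompactSupport (χ n)) ∧ (∀ n z, |χ n z| ≤ 1) ∧
    (∀ n z, |fderiv ℝ (χ n) z v| ≤ K) ∧ ∀ (n : ℕ) (z : ℂ), ‖z‖ < n + 1 → χ n =ᶠ[𝓝 z] 1 := by
  let b : ContDiffBump (0 : ℂ) := ⟨1, 2, one_pos, one_lt_two⟩
  have hb : ContDiff ℝ ∞ b := b.contDiff
  obtain ⟨K, hK⟩ := ((hb.continuous_fderiv (by simp)).clm_apply
    (continuous_const (y := v))).bounded_above_of_compact_support
    (b.hasCompactSupport.fderiv_apply (𝕜 := ℝ) v)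
  have hpos : ∀ n : ℕ, (0 : ℝ) < n + 1 := fun n => by positivity
  have hs : ∀ n : ℕ, ContDiff ℝ ∞ fun z : ℂ => ((n : ℝ) + 1)⁻¹ • z := fun n =>
    contDiff_id.const_smul _
  -- Dilating one fixed bump multiplies its gradient by `1/(n+1) ≤ 1`, so a single `K` serves for
  -- every `n`.
  refine ⟨fun n z => b (((n : ℝ) + 1)⁻¹ • z), K, fun n => hb.comp (hs n), fun n => ?_, fun n z => ?_,
    fun n z => ?_, fun n z hz => ?_⟩
  · exact b.hasCompactSupport.comp_smul (inv_ne_zero (hpos n).ne')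
  · rw [abs_of_nonneg b.nonneg]
    exact b.le_one
  · have h1 : HasFDerivAt (fun z : ℂ => ((n : ℝ) + 1)⁻¹ • z)
        (((n : ℝ) + 1)⁻¹ • ContinuousLinearMap.id ℝ ℂ) z :=
      (((n : ℝ) + 1)⁻¹ • ContinuousLinearMap.id ℝ ℂ).hasFDerivAt
    have h2 := ((hb.differentiable (by simp) _).hasFDerivAt.comp z h1).fderiv
    have h3 : fderiv ℝ (fun z => b (((n : ℝ) + 1)⁻¹ • z)) z v =
        ((n : ℝ) + 1)⁻¹ * fderiv ℝ b (((n : ℝ) + 1)⁻¹ • z) v := by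
      refine (congrArg (fun L => L v) h2).trans ?_
      simp
    rw [h3, abs_mul, abs_of_pos (inv_pos.mpr (hpos n))]
    have h4 : |fderiv ℝ b (((n : ℝ) + 1)⁻¹ • z) v| ≤ K := hK _
    refine (mul_le_of_le_one_left (abs_nonneg _) ?_).trans h4
    exact inv_le_one_of_one_le₀ (by linarith [(Nat.cast_nonneg n : (0 : ℝ) ≤ n)])
  · have hopen : IsOpen {z : ℂ | ‖z‖ < n + 1} := isOpen_lt continuous_norm continuous_const
    filter_upwards [hopen.mem_nhds hz] with y hy
    apply b.one_of_mem_closedBall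
    rw [mem_closedBall_zero_iff, norm_smul, Real.norm_of_nonneg (inv_pos.mpr (hpos n)).le]
    rw [inv_mul_le_iff₀ (hpos n)]
    simpa [b] using (le_of_lt hy)

/-- The definition allows only compactly supported test functions, while the waves are Gaussian.
Cutoffs with uniformly bounded gradients and dominated convergence remove the restriction. -/
lemma IsWeakDeriv.inner_schwartz {v : ℂ} {f g : L2} (h : IsWeakDeriv v f g) (ψ : 𝓢(ℂ, ℂ)) :
    inner ℝ (toL2 (∂_{v} ψ)) f = - inner ℝ (toL2 ψ) g := by
  obtain ⟨χ, K, hχ, hχc, hχ1, hχK, hχe⟩ := exists_cutoff v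
  have hc : ∀ n, HasCompactSupport fun z => χ n z • ψ z := fun n => (hχc n).smul_right
  have hs : ∀ n, ContDiff ℝ ∞ fun z => χ n z • ψ z := fun n => (hχ n).smul (ψ.smooth ⊤)
  let ψn : ℕ → 𝓢(ℂ, ℂ) := fun n => (hc n).toSchwartzMap (hs n)
  have hψn : ∀ n z, ψn n z = χ n z • ψ z := fun n z => rfl
  have hdψn : ∀ n z, (∂_{v} (ψn n)) z = χ n z • (∂_{v} ψ) z + fderiv ℝ (χ n) z v • ψ z := by
    intro n z
    rw [lineDerivOp_apply_eq_fderiv]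
    have := (((hχ n).differentiable (by simp) z).hasFDerivAt.smul (ψ.hasFDerivAt z)).fderiv
    refine (congrArg (fun L => L v) this).trans ?_
    simp [lineDerivOp_apply_eq_fderiv]
  have hev : ∀ z : ℂ, ∀ᶠ n : ℕ in atTop, ‖z‖ < n + 1 := by
    intro z
    filter_upwards [eventually_ge_atTop ⌈‖z‖⌉₊] with n hn
    have := (Nat.le_ceil ‖z‖).trans (Nat.cast_le.mpr hn)
    linarith
  have key := fun n => h.inner_of_hasCompactSupport (ψn n) (hc n)
  simp_rw [inner_toL2_left] at key ⊢
  have hK : 0 ≤ K := (abs_nonneg _).trans (hχK 0 0)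
  have L1 : Tendsto (fun n => ∫ z, inner ℝ ((∂_{v} (ψn n)) z) (f z)) atTop
      (𝓝 (∫ z, inner ℝ ((∂_{v} ψ) z) (f z))) := by
    refine tendsto_integral_of_dominated_convergence
      (fun z => ‖(∂_{v} ψ) z‖ * ‖f z‖ + K * (‖ψ z‖ * ‖f z‖))
      (fun n => (integrable_inner_L2 _ f).aestronglyMeasurable) ?_ (fun n => ae_of_all _ fun z => ?_)
      (ae_of_all _ fun z => ?_)
    · have hi : ∀ ζ : 𝓢(ℂ, ℂ), Integrable fun z => ‖ζ z‖ * ‖f z‖ := fun ζ =>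
        (ζ.memLp 2 volume).norm.integrable_mul (Lp.memLp f).norm
      exact (hi _).add ((hi ψ).const_mul K)
    · refine (norm_inner_le_norm (𝕜 := ℝ) _ _).trans ?_
      rw [← mul_assoc, ← add_mul, hdψn]
      gcongr
      refine (norm_add_le _ _).trans ?_
      rw [norm_smul, norm_smul]
      gcongr
      · exact mul_le_of_le_one_left (norm_nonneg _) (hχ1 n z)
      · exact hχK n z
    · apply tendsto_const_nhds.congr'
      filter_upwards [hev z] with n hn
      have e := hχe n z hn
      rw [hdψn, e.fderiv_eq, e.self_of_nhds]
      simp [Pi.one_def]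
  have L2 : Tendsto (fun n => ∫ z, inner ℝ (ψn n z) (g z)) atTop
      (𝓝 (∫ z, inner ℝ (ψ z) (g z))) := by
    refine tendsto_integral_of_dominated_convergence (fun z => ‖ψ z‖ * ‖g z‖)
      (fun n => (integrable_inner_L2 _ g).aestronglyMeasurable) 
      ((ψ.memLp 2 volume).norm.integrable_mul (Lp.memLp g).norm) (fun n => ae_of_all _ fun z => ?_)
      (ae_of_all _ fun z => ?_)
    · refine (norm_inner_le_norm (𝕜 := ℝ) _ _).trans ?_
      rw [hψn, norm_smul]
      gcongr
      exact mul_le_of_le_one_left (norm_nonneg _) (hχ1 n z)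
    · apply tendsto_const_nhds.congr'
      filter_upwards [hev z] with n hn
      rw [hψn, (hχe n z hn).self_of_nhds]
      simp
  exact tendsto_nhds_unique L1 (L2.neg.congr fun n => (key n).symm)

lemma ae_eq_of_inner_schwartz {f g : ℂ → ℂ} (hf : LocallyIntegrable f) (hg : LocallyIntegrable g)
    (h : ∀ ψ : 𝓢(ℂ, ℂ), HasCompactSupport ψ →
      ∫ z, inner ℝ (ψ z) (f z) = ∫ z, inner ℝ (ψ z) (g z)) : f =ᵐ[volume] g := by
  apply ae_eq_of_integral_contDiff_smul_eq hf hg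
  intro φ hφ hc
  have hi : ∀ {f : ℂ → ℂ}, LocallyIntegrable f → Integrable fun z => φ z • f z := fun hf =>
    hf.integrable_smul_left_of_hasCompactSupport hφ.continuous hc
  have hcs : ∀ a : ℂ, HasCompactSupport (testMul (hc.toSchwartzMap hφ) a) := fun a =>
    HasCompactSupport.smul_right (f := φ) (f' := fun _ => a) hc
  have e1 := h (testMul (hc.toSchwartzMap hφ) 1) (hcs 1)
  have e2 := h (testMul (hc.toSchwartzMap hφ) Complex.I) (hcs Complex.I)
  have hneg : Integrable fun z => φ z • (-g z) := by simpa using (hi hg).neg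
  have := (integral_smul_eq_iff (hi hf) hneg).mpr (by
    simp only [inner_neg_right, integral_neg, neg_neg]
    exact ⟨e1, e2⟩)
  rw [this]
  simp [integral_neg]

lemma IsJet.inner_weight {J : Jets} (hJ : IsJet J) (ψ : 𝓢(ℂ, ℂ)) :
    inner ℝ (toL2 ψ) (J 6) = inner ℝ (toL2 (sqMul ψ)) (J 0) := by
  rw [inner_toL2_left, inner_toL2_left]
  apply integral_congr_ae
  filter_upwards [hJ.weight] with z hz
  rw [hz, sqMul_apply, ← Complex.real_smul, ← Complex.real_smul, real_inner_smul_left,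
    real_inner_smul_right]

/-- Each condition here is an equality of continuous functions of the jet, hence survives `L²`
limits; this is how the jet property is carried to the closure. -/
lemma isJet_of_inner {J : Jets}
    (h1 : ∀ ψ, inner ℝ (toL2 (∂_{(1 : ℂ)} ψ)) (J 0) = - inner ℝ (toL2 ψ) (J 1))
    (h2 : ∀ ψ, inner ℝ (toL2 (∂_{Complex.I} ψ)) (J 0) = - inner ℝ (toL2 ψ) (J 2))
    (h3 : ∀ ψ, inner ℝ (toL2 (∂_{(1 : ℂ)} ψ)) (J 1) = - inner ℝ (toL2 ψ) (J 3))
    (h4 : ∀ ψ, inner ℝ (toL2 (∂_{Complex.I} ψ)) (J 1) = - inner ℝ (toL2 ψ) (J 4))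
    (h5 : ∀ ψ, inner ℝ (toL2 (∂_{Complex.I} ψ)) (J 2) = - inner ℝ (toL2 ψ) (J 5))
    (h6 : ∀ ψ, inner ℝ (toL2 ψ) (J 6) = inner ℝ (toL2 (sqMul ψ)) (J 0)) : IsJet J where
  dx := isWeakDeriv_of_inner h1
  dy := isWeakDeriv_of_inner h2
  dxx := isWeakDeriv_of_inner h3
  dxy := isWeakDeriv_of_inner h4
  dyy := isWeakDeriv_of_inner h5
  weight := by
    have hw : Continuous fun p : ℂ => ((p.re ^ 2 + p.im ^ 2 : ℝ) : ℂ) := by fun_prop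
    apply ae_eq_of_inner_schwartz ((Lp.memLp (J 6)).locallyIntegrable (by norm_num))
    · exact ((Lp.memLp (J 0)).locallyIntegrable (by norm_num)).continuous_smul hw
    · intro ψ _
      have := h6 ψ
      rw [inner_toL2_left, inner_toL2_left] at this
      rw [this]
      congr 1
      ext z
      rw [sqMul_apply, ← Complex.real_smul, ← Complex.real_smul, real_inner_smul_left,
        real_inner_smul_right]

/-! ### The space of modes and the a priori estimate for the inverse -/

/-- The closed span in `L²` of the functions `z^m p(|z|²) e^{-|z|²/2}` with `p` a real polynomial. -/
def modes (m : ℕ) : Submodule ℝ L2 := (LinearMap.range (waveL2 m)).topologicalClosure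

instance (m : ℕ) : CompleteSpace (modes m) :=
  (Submodule.isClosed_topologicalClosure _).completeSpace_coe

lemma waveL2_mem_modes (m : ℕ) (p : ℝ[X]) : waveL2 m p ∈ modes m :=
  Submodule.le_topologicalClosure _ (LinearMap.mem_range_self _ p)

/-- The mode `z^m p(|z|²) e^{-|z|²/2}`. -/
def mode (m : ℕ) : ℝ[X] →ₗ[ℝ] modes m := (waveL2 m).codRestrict (modes m) (waveL2_mem_modes m)

lemma coe_mode (m : ℕ) (p : ℝ[X]) : (mode m p : L2) = waveL2 m p := rfl

lemma mode_one_ne_zero (m : ℕ) : mode m 1 ≠ 0 := by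
  intro h
  have h1 : toL2 (wave m 1) = toL2 0 := by
    rw [map_zero]; exact congrArg Subtype.val h
  have h2 : wave m 1 = 0 := SchwartzMap.injective_toLp 2 volume h1
  have h3 := congrArg (fun f : 𝓢(ℂ, ℂ) => f 1) h2
  simp [wave_apply, radialPart] at h3

lemma norm_mode_one_pos (m : ℕ) : 0 < ‖mode m 1‖ := norm_pos_iff.mpr (mode_one_ne_zero m)

lemma denseRange_mode (m : ℕ) : DenseRange (mode m) := by
  intro y
  rw [Metric.mem_closure_range_iff]
  intro ε hε
  have hy : (y : L2) ∈ closure (LinearMap.range (waveL2 m) : Set L2) := y.2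
  obtain ⟨_, ⟨p, rfl⟩, hp⟩ := Metric.mem_closure_iff.mp hy ε hε
  exact ⟨p, hp⟩

/-- The coefficient of the ground state in the orthogonal expansion of a mode. -/
def groundCoeff (m : ℕ) : modes m →L[ℝ] ℝ := (‖mode m 1‖ ^ 2)⁻¹ • innerSL ℝ (mode m 1)

lemma groundCoeff_apply (m : ℕ) (y : modes m) :
    groundCoeff m y = (‖mode m 1‖ ^ 2)⁻¹ * inner ℝ (mode m 1) y := rfl

lemma groundCoeff_one (m : ℕ) : groundCoeff m (mode m 1) = 1 := by
  rw [groundCoeff_apply, real_inner_self_eq_norm_sq]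
  exact inv_mul_cancel₀ (pow_ne_zero _ (norm_mode_one_pos m).ne')

lemma groundCoeff_eq_zero_iff (m : ℕ) (y : modes m) :
    groundCoeff m y = 0 ↔ inner ℝ (mode m 1) y = 0 := by
  rw [groundCoeff_apply, mul_eq_zero, or_iff_right]
  exact inv_ne_zero (pow_ne_zero _ (norm_mode_one_pos m).ne')

lemma modes_inner_smul_left {m : ℕ} (c : ℝ) (x y : modes m) : inner ℝ (c • x) y = c * inner ℝ x y :=
  real_inner_smul_left (x : L2) y c

lemma modes_inner_smul_right {m : ℕ} (c : ℝ) (x y : modes m) :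
    inner ℝ x (c • y) = c * inner ℝ x y :=
  real_inner_smul_right (x : L2) y c

/-- The polynomial of the component of a mode orthogonal to the ground state. -/
def center (m : ℕ) : ℝ[X] →ₗ[ℝ] ℝ[X] :=
  LinearMap.id - ((groundCoeff m : modes m →ₗ[ℝ] ℝ) ∘ₗ mode m).smulRight 1

lemma center_apply (m : ℕ) (p : ℝ[X]) : center m p = p - groundCoeff m (mode m p) • 1 := rfl

lemma groundCoeff_center (m : ℕ) (p : ℝ[X]) : groundCoeff m (mode m (center m p)) = 0 := by
  rw [center_apply, map_sub, map_smul, map_sub, map_smul, groundCoeff_one, smul_eq_mul, mul_one,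
    sub_self]

lemma laguerreOp_center (m : ℕ) (p : ℝ[X]) : laguerreOp m (center m p) = laguerreOp m p := by
  rw [center_apply, map_sub, map_smul, ← C_1, laguerreOp_C, smul_zero, sub_zero]

/-- The operator `-Δ + r² - 2(m + 1)` plus the projection onto the ground state, on the dense
subspace of modes given by polynomials. -/
def modeOp (m : ℕ) : ℝ[X] →ₗ[ℝ] modes m :=
  (4 : ℝ) • (mode m ∘ₗ laguerreOp m) +
    ((groundCoeff m : modes m →ₗ[ℝ] ℝ) ∘ₗ mode m).smulRight (mode m 1)

lemma modeOp_apply (m : ℕ) (p : ℝ[X]) :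
    modeOp m p = (4 : ℝ) • mode m (laguerreOp m p) + groundCoeff m (mode m p) • mode m 1 := rfl

lemma inner_mode_laguerreOp_one (m : ℕ) (p : ℝ[X]) :
    inner ℝ (mode m (laguerreOp m p)) (mode m 1) = 0 := inner_laguerreOp_one m p

lemma norm_mode_laguerreOp_le (m : ℕ) (p : ℝ[X]) :
    4 * ‖mode m (laguerreOp m p)‖ ≤ ‖modeOp m p‖ := by
  refine le_of_sq_le_sq ?_ (norm_nonneg _)
  rw [modeOp_apply, norm_add_sq_real, modes_inner_smul_left, modes_inner_smul_right,
    inner_mode_laguerreOp_one, norm_smul]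
  norm_num

lemma denseRange_modeOp (m : ℕ) : DenseRange (modeOp m) := by
  have h : range (mode m) ⊆ range (modeOp m) := by
    rintro _ ⟨q, rfl⟩
    obtain ⟨p, c, hq⟩ := exists_eq_laguerreOp_add_C m q
    -- The factor `1/4` cancels the `4` in `modeOp`; the added constant is invisible to `laguerreOp`
    -- and adjusts the ground coefficient to be exactly `c`.
    refine ⟨(1 / 4 : ℝ) • p + (c - groundCoeff m (mode m ((1 / 4 : ℝ) • p))) • 1, ?_⟩
    rw [modeOp_apply, map_add, map_smul (laguerreOp m) _ (1 : ℝ[X]), ← C_1, laguerreOp_C, smul_zero,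
      add_zero, C_1, map_add (mode m), map_smul (mode m) _ (1 : ℝ[X]), map_add (groundCoeff m),
      map_smul (groundCoeff m) _ (mode m 1), groundCoeff_one, smul_eq_mul, mul_one,
      add_sub_cancel, map_smul, map_smul, smul_smul, hq, map_add]
    have : (C c : ℝ[X]) = c • 1 := by rw [smul_eq_C_mul, mul_one]
    rw [this, map_smul]
    norm_num
  exact (denseRange_mode m).mono h

/-- The bound that makes the inverse continuous. By the gap the centred polynomial is dominated by
its Laguerre image, so the oscillator applied to it costs at most `2(m + 1) + 4 = 2m + 6`, and
`norm_schwartzJet_sq_le` controls the full jet. -/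
lemma norm_schwartzJet_center_le (m : ℕ) : ∃ K : ℝ, ∀ p : ℝ[X],
    ‖schwartzJet (wave m (center m p))‖ ≤ K * ‖modeOp m p‖ := by
  refine ⟨Real.sqrt (2 * (2 * m + 6) ^ 2 + 10), fun p => ?_⟩
  have h1 := norm_schwartzJet_sq_le (wave m (center m p))
  have h2 : ‖mode m (center m p)‖ ≤ ‖mode m (laguerreOp m p)‖ := by
    have := norm_waveL2_le_laguerreOp m (center m p) (by
      rw [real_inner_comm]
      exact (groundCoeff_eq_zero_iff m _).mp (groundCoeff_center m p))
    rw [laguerreOp_center] at this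
    exact this
  have h3 : ‖toL2 (- lap (wave m (center m p)) + sqMul (wave m (center m p)))‖ ≤
      (2 * m + 6) * ‖mode m (laguerreOp m p)‖ := by
    rw [oscillator_wave, laguerreOp_center, map_add, map_smul, map_smul]
    refine (norm_add_le _ _).trans ?_
    rw [norm_smul, norm_smul, Real.norm_of_nonneg (by positivity), Real.norm_of_nonneg (by norm_num)]
    change 2 * (m + 1) * ‖mode m (center m p)‖ + 4 * ‖mode m (laguerreOp m p)‖ ≤ _
    have : 2 * ((m : ℝ) + 1) * ‖mode m (center m p)‖ ≤
        2 * (m + 1) * ‖mode m (laguerreOp m p)‖ := by gcongr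
    linarith
  have h4 := norm_mode_laguerreOp_le m p
  have h5 : ‖mode m (laguerreOp m p)‖ ≤ ‖modeOp m p‖ := by
    linarith [norm_nonneg (mode m (laguerreOp m p))]
  refine le_of_sq_le_sq ?_ (by positivity)
  rw [mul_pow, Real.sq_sqrt (by positivity)]
  have h6 := pow_le_pow_left₀ (norm_nonneg _) h3 2
  have h7 := pow_le_pow_left₀ (norm_nonneg _) h2 2
  have h8 := pow_le_pow_left₀ (norm_nonneg _) h5 2
  change _ ≤ _ + 10 * ‖mode m (center m p)‖ ^ 2 at h1
  rw [mul_pow] at h6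
  have h9 : (2 * (m : ℝ) + 6) ^ 2 * ‖mode m (laguerreOp m p)‖ ^ 2 ≤
    (2 * m + 6) ^ 2 * ‖modeOp m p‖ ^ 2 := by gcongr
  linarith

lemma norm_toZeroAtInfty_le (f : 𝓢(ℂ, ℂ)) :
    ‖toZeroAtInftyCLM ℝ ℂ ℂ f‖ ≤ ‖schwartzJet f‖ := by
  rw [← ZeroAtInftyContinuousMap.norm_toBCF_eq_norm, BoundedContinuousFunction.norm_le (norm_nonneg _)]
  exact norm_apply_le_schwartzJet f

/-! ### The bounded inverse and its continuous representative -/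

/-- The inverse of `-Δ + r² - 2(m + 1)` on the orthogonal complement of the ground state, extended
by zero, with values in the space of jets. -/
def solveJet (m : ℕ) : modes m →L[ℝ] Jets :=
  LinearMap.extendOfNorm (schwartzJet ∘ₗ wave m ∘ₗ center m) (modeOp m)

/-- The continuous representative of the first component of `solveJet`. -/
def solveRep (m : ℕ) : modes m →L[ℝ] C₀(ℂ, ℂ) :=
  LinearMap.extendOfNorm
    ((toZeroAtInftyCLM ℝ ℂ ℂ : 𝓢(ℂ, ℂ) →ₗ[ℝ] C₀(ℂ, ℂ)) ∘ₗ wave m ∘ₗ center m) (modeOp m)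

lemma solveJet_modeOp (m : ℕ) (p : ℝ[X]) :
    solveJet m (modeOp m p) = schwartzJet (wave m (center m p)) :=
  LinearMap.extendOfNorm_eq (denseRange_modeOp m) (norm_schwartzJet_center_le m) p

lemma solveRep_modeOp (m : ℕ) (p : ℝ[X]) (z : ℂ) :
    solveRep m (modeOp m p) z = wave m (center m p) z := by
  have h : solveRep m (modeOp m p) = toZeroAtInftyCLM ℝ ℂ ℂ (wave m (center m p)) := by
    obtain ⟨K, hK⟩ := norm_schwartzJet_center_le m
    exact LinearMap.extendOfNorm_eq (denseRange_modeOp m)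
      ⟨K, fun p => (norm_toZeroAtInfty_le _).trans (hK p)⟩ p
  rw [h]
  rfl

/-- The inverse is explicit only on the dense range of `modeOp`; its properties are checked there
and extended as closed conditions. -/
lemma modes_induction {m : ℕ} {P : modes m → Prop} (hc : IsClosed {y | P y})
    (h : ∀ p, P (modeOp m p)) (y : modes m) : P y :=
  (denseRange_modeOp m).induction_on y hc h

lemma isJet_schwartzJet (f : 𝓢(ℂ, ℂ)) : IsJet (schwartzJet f) := by
  refine isJet_of_inner ?_ ?_ ?_ ?_ ?_ ?_
  · exact fun ψ => inner_lineDeriv_left _ _ _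
  · exact fun ψ => inner_lineDeriv_left _ _ _
  · exact fun ψ => inner_lineDeriv_left _ _ _
  · exact fun ψ => inner_lineDeriv_left _ _ _
  · exact fun ψ => inner_lineDeriv_left _ _ _
  · intro ψ
    change inner ℝ (toL2 ψ) (toL2 (sqMul f)) = inner ℝ (toL2 (sqMul ψ)) (toL2 f)
    simp only [sqMul, map_add, inner_add_left, inner_add_right, inner_coordMul_left]

lemma continuous_solveJet_component (m : ℕ) (i : Fin 7) :
    Continuous fun y : modes m => solveJet m y i :=
  (PiLp.continuous_apply 2 _ i).comp (solveJet m).continuous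

lemma isJet_solveJet (m : ℕ) (y : modes m) : IsJet (solveJet m y) := by
  have hc := continuous_solveJet_component m
  have key : ∀ (v : ℂ) (i j : Fin 7), (∀ f : 𝓢(ℂ, ℂ), ∀ ψ,
      inner ℝ (toL2 (∂_{v} ψ)) (schwartzJet f i) = - inner ℝ (toL2 ψ) (schwartzJet f j)) →
      ∀ ψ, inner ℝ (toL2 (∂_{v} ψ)) (solveJet m y i) = - inner ℝ (toL2 ψ) (solveJet m y j) := by
    intro v i j h ψ
    refine modes_induction (P := fun y => inner ℝ (toL2 (∂_{v} ψ)) (solveJet m y i) =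
      - inner ℝ (toL2 ψ) (solveJet m y j)) (isClosed_eq ?_ ?_) (fun p => ?_) y
    · exact continuous_const.inner (hc i)
    · exact (continuous_const.inner (hc j)).neg
    · rw [solveJet_modeOp]
      exact h _ ψ
  refine isJet_of_inner ?_ ?_ ?_ ?_ ?_ ?_
  · exact key 1 0 1 fun f => (isJet_schwartzJet f).dx.inner_schwartz
  · exact key Complex.I 0 2 fun f => (isJet_schwartzJet f).dy.inner_schwartz
  · exact key 1 1 3 fun f => (isJet_schwartzJet f).dxx.inner_schwartz
  · exact key Complex.I 1 4 fun f => (isJet_schwartzJet f).dxy.inner_schwartz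
  · exact key Complex.I 2 5 fun f => (isJet_schwartzJet f).dyy.inner_schwartz
  · intro ψ
    refine modes_induction (P := fun y => inner ℝ (toL2 ψ) (solveJet m y 6) =
      inner ℝ (toL2 (sqMul ψ)) (solveJet m y 0)) (isClosed_eq ?_ ?_) (fun p => ?_) y
    · exact continuous_const.inner (hc 6)
    · exact continuous_const.inner (hc 0)
    · rw [solveJet_modeOp]
      exact (isJet_schwartzJet _).inner_weight ψ

/-- Pairing of a continuous function vanishing at infinity with a Schwartz function. -/
lemma continuous_integral_inner (ψ : 𝓢(ℂ, ℂ)) :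
    Continuous fun c : C₀(ℂ, ℂ) => ∫ z, inner ℝ (ψ z) (c z) := by
  have hb : ∀ (c : C₀(ℂ, ℂ)) (z : ℂ), ‖c z‖ ≤ ‖c‖ := fun c z => c.toBCF.norm_coe_le_norm z
  refine continuous_iff_continuousAt.mpr fun c₀ => ?_
  refine continuousAt_of_dominated (bound := fun z => ‖ψ z‖ * (‖c₀‖ + 1)) ?_ ?_ ?_ ?_
  · exact Eventually.of_forall fun c =>
      (ψ.continuous.inner c.continuous_toFun).aestronglyMeasurable
  · filter_upwards [Metric.ball_mem_nhds c₀ one_pos] with c hc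
    refine ae_of_all _ fun z => (norm_inner_le_norm (𝕜 := ℝ) _ _).trans ?_
    have h1 : ‖c‖ ≤ ‖c₀‖ + 1 := by
      rw [mem_ball_iff_norm] at hc
      have := norm_sub_norm_le c c₀
      linarith
    gcongr
    exact (hb c z).trans h1
  · exact ψ.integrable.norm.mul_const _
  · refine ae_of_all _ fun z => ?_
    have h : Continuous fun c : C₀(ℂ, ℂ) => c z := by
      refine LipschitzWith.continuous (K := 1) (LipschitzWith.of_dist_le_mul fun a b => ?_)
      rw [NNReal.coe_one, one_mul, dist_eq_norm, dist_eq_norm]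
      exact hb (a - b) z
    exact (continuous_const.inner h).continuousAt

lemma continuous_eval_zeroAtInfty (z : ℂ) : Continuous fun c : C₀(ℂ, ℂ) => c z := by
  refine LipschitzWith.continuous (K := 1) (LipschitzWith.of_dist_le_mul fun a b => ?_)
  rw [NNReal.coe_one, one_mul, dist_eq_norm, dist_eq_norm]
  exact (a - b).toBCF.norm_coe_le_norm z

lemma solveJet_ae_eq (m : ℕ) (y : modes m) : solveJet m y 0 =ᵐ[volume] solveRep m y := by
  apply ae_eq_of_inner_schwartz ((Lp.memLp _).locallyIntegrable (by norm_num))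
    (solveRep m y).continuous_toFun.locallyIntegrable
  intro ψ _
  rw [← inner_toL2_left]
  refine modes_induction (P := fun y => inner ℝ (toL2 ψ) (solveJet m y 0) =
      ∫ z, inner ℝ (ψ z) (solveRep m y z)) (isClosed_eq ?_ ?_) (fun p => ?_) y
  · exact continuous_const.inner (continuous_solveJet_component m 0)
  · exact (continuous_integral_inner ψ).comp (solveRep m).continuous
  · rw [solveJet_modeOp]
    simp_rw [solveRep_modeOp]
    exact inner_toL2 _ _

lemma exp_arg_mul_norm (m : ℕ) (z : ℂ) :
    z ^ m = Complex.exp (m * Complex.arg z * Complex.I) * (‖z‖ : ℂ) ^ m := by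
  conv_lhs => rw [← Complex.norm_mul_exp_arg_mul_I z]
  rw [mul_pow, ← Complex.exp_nat_mul, mul_comm, mul_assoc]

lemma wave_eq_exp_mul (m : ℕ) (p : ℝ[X]) (z : ℂ) :
    wave m p z = Complex.exp (m * Complex.arg z * Complex.I) * ((wave m p (‖z‖ : ℂ)).re : ℂ) := by
  have h : wave m p (‖z‖ : ℂ) =
      ((‖z‖ ^ m * (p.eval (‖z‖ ^ 2) * Real.exp (-‖z‖ ^ 2 / 2)) : ℝ) : ℂ) := by
    rw [wave_apply, radialPart]
    simp
  rw [h, Complex.ofReal_re, wave_apply, radialPart, exp_arg_mul_norm]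
  push_cast
  ring

/-- Evaluation at a point is continuous on `C₀`, so the angular form passes to limits at every
point, not merely almost everywhere. -/
lemma solveRep_eq_exp_mul (m : ℕ) (y : modes m) (z : ℂ) :
    solveRep m y z =
      Complex.exp (m * Complex.arg z * Complex.I) * ((solveRep m y (‖z‖ : ℂ)).re : ℂ) := by
  refine modes_induction (P := fun y => solveRep m y z =
    Complex.exp (m * Complex.arg z * Complex.I) * ((solveRep m y (‖z‖ : ℂ)).re : ℂ))
    (isClosed_eq ?_ ?_) (fun p => ?_) y
  · exact (continuous_eval_zeroAtInfty z).comp (solveRep m).continuous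
  · have := (continuous_eval_zeroAtInfty (‖z‖ : ℂ)).comp (solveRep m).continuous
    exact continuous_const.mul (Complex.continuous_ofReal.comp (Complex.continuous_re.comp this))
  · rw [solveRep_modeOp, solveRep_modeOp]
    exact wave_eq_exp_mul m _ z

lemma hasProfile_solveJet (m : ℕ) (y : modes m) :
    HasProfile m (solveJet m y 0) fun r => (solveRep m y (r : ℂ)).re := by
  filter_upwards [solveJet_ae_eq m y] with z hz
  rw [hz, solveRep_eq_exp_mul]

/-- The inverse of `-Δ + r² - 2(m + 1)` on the orthogonal complement of the ground state, extended
by zero. -/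
def solve (m : ℕ) : modes m →L[ℝ] X m :=
  (solveJet m).codRestrict (X m) fun y => ⟨isJet_solveJet m y, _, hasProfile_solveJet m y⟩

lemma coe_solve (m : ℕ) (y : modes m) : (solve m y : Jets) = solveJet m y := rfl

lemma solveJet_mem_modes (m : ℕ) (y : modes m) : solveJet m y 0 ∈ modes m := by
  refine modes_induction (P := fun y => solveJet m y 0 ∈ modes m)
    ((Submodule.isClosed_topologicalClosure _).preimage (continuous_solveJet_component m 0))
    (fun p => ?_) y
  rw [solveJet_modeOp]
  exact waveL2_mem_modes m _

lemma inner_solveJet_one (m : ℕ) (y : modes m) :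
    inner ℝ (solveJet m y 0) (waveL2 m 1) = 0 := by
  refine modes_induction (P := fun y => inner ℝ (solveJet m y 0) (waveL2 m 1) = 0)
    (isClosed_eq ((continuous_solveJet_component m 0).inner continuous_const) continuous_const)
    (fun p => ?_) y
  rw [solveJet_modeOp, real_inner_comm]
  exact (groundCoeff_eq_zero_iff m _).mp (groundCoeff_center m p)

/-- Symmetry of the inverse, in the form used to recognise `solve f` by testing against the dense
range of `modeOp`. -/
lemma inner_solveJet_modeOp (m : ℕ) (f : modes m) (p : ℝ[X]) :
    inner ℝ (solveJet m f 0) (modeOp m p : L2) = inner ℝ (f : L2) (waveL2 m (center m p)) := by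
  refine modes_induction (P := fun f => inner ℝ (solveJet m f 0) (modeOp m p : L2) =
    inner ℝ (f : L2) (waveL2 m (center m p))) (isClosed_eq
    ((continuous_solveJet_component m 0).inner continuous_const)
    (continuous_subtype_val.inner continuous_const)) (fun q => ?_) f
  rw [solveJet_modeOp]
  change inner ℝ (mode m (center m q)) (modeOp m p) = inner ℝ (modeOp m q) (mode m (center m p))
  have h1 := (groundCoeff_eq_zero_iff m _).mp (groundCoeff_center m p)
  have h2 := (groundCoeff_eq_zero_iff m _).mp (groundCoeff_center m q)
  have h3 : inner ℝ (mode m (laguerreOp m (center m q))) (mode m (center m p)) =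
    inner ℝ (mode m (center m q)) (mode m (laguerreOp m (center m p))) :=
    inner_laguerreOp_comm m (center m q) (center m p)
  rw [laguerreOp_center, laguerreOp_center] at h3
  rw [modeOp_apply, modeOp_apply, inner_add_left, inner_add_right, modes_inner_smul_left,
    modes_inner_smul_left, modes_inner_smul_right, modes_inner_smul_right, h1, h3,
    real_inner_comm (mode m 1), h2, mul_zero, mul_zero]

/-- The ground state as an element of `X m`. -/
def groundX (m : ℕ) : X m := ⟨schwartzJet (wave m 1), isJet_schwartzJet _,
  fun r => (wave m 1 (r : ℂ)).re, by
    unfold HasProfile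
    filter_upwards [coeFn_toL2 (wave m 1)] with z hz
    exact hz.trans (wave_eq_exp_mul m 1 z)⟩

/-! ### A determinate moment problem -/

-- Exponential integrability makes both complex moment generating functions analytic on `Re z < a`.
-- Equal moments mean equal Taylor series at `0`, hence equality on this half-plane, which contains
-- the imaginary axis, and the characteristic functions agree.
open ProbabilityTheory in
lemma map_eq_map_of_moments_eq {Ω : Type*} [MeasurableSpace Ω] {μ ν : Measure Ω}
    [IsFiniteMeasure μ] [IsFiniteMeasure ν] {Z : Ω → ℝ} (hZ : Measurable Z) {a : ℝ} (ha : 0 < a)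
    (hμ : ∀ t < a, Integrable (fun x => Real.exp (t * Z x)) μ)
    (hν : ∀ t < a, Integrable (fun x => Real.exp (t * Z x)) ν)
    (h : ∀ n : ℕ, ∫ x, Z x ^ n ∂μ = ∫ x, Z x ^ n ∂ν) : μ.map Z = ν.map Z := by
  have hsub : ∀ {μ : Measure Ω}, (∀ t < a, Integrable (fun x => Real.exp (t * Z x)) μ) →
      Iio a ⊆ interior (integrableExpSet Z μ) := fun h =>
    interior_maximal (fun t ht => h t ht) isOpen_Iio
  have hμA : AnalyticOnNhd ℂ (complexMGF Z μ) {z | z.re < a} := fun z hz =>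
    analyticAt_complexMGF (hsub hμ hz)
  have hνA : AnalyticOnNhd ℂ (complexMGF Z ν) {z | z.re < a} := fun z hz =>
    analyticAt_complexMGF (hsub hν hz)
  have h0 : (0 : ℂ) ∈ {z : ℂ | z.re < a} := by simpa using ha
  have hd : ∀ n, iteratedDeriv n (complexMGF Z μ) 0 = iteratedDeriv n (complexMGF Z ν) 0 := by
    intro n
    rw [iteratedDeriv_complexMGF (hsub hμ h0), iteratedDeriv_complexMGF (hsub hν h0)]
    simp only [zero_mul, Complex.exp_zero, mul_one]
    have := congrArg (fun x : ℝ => (x : ℂ)) (h n)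
    simpa only [← integral_complex_ofReal, Complex.ofReal_pow] using this
  have hev : complexMGF Z μ =ᶠ[𝓝 0] complexMGF Z ν := by
    have e1 := (hμA 0 h0).hasFPowerSeriesAt
    have e2 := (hνA 0 h0).hasFPowerSeriesAt
    simp_rw [hd] at e1
    have e3 := e1.sub e2
    rw [sub_self] at e3
    filter_upwards [e3.eventually_eq_zero] with z hz
    exact sub_eq_zero.mp hz
  have heq := hμA.eqOn_of_preconnected_of_eventuallyEq hνA
    (convex_halfSpace_re_lt a).isPreconnected h0 hev
  apply Measure.ext_of_charFun
  ext t
  rw [← complexMGF_mul_I hZ.aemeasurable, ← complexMGF_mul_I hZ.aemeasurable]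
  exact heq (by simpa using ha)

/-- The signed density `κ` is split into its positive and negative parts: the two finite measures
have the same moments of `Z`, hence the same image under `Z`, and therefore the same integral of any
`k ∘ Z`. -/
lemma integral_comp_mul_eq_zero_of_moments {Ω : Type*} [MeasurableSpace Ω] {μ : Measure Ω}
    {Z κ : Ω → ℝ} (hZ : Measurable Z) (hκ : Measurable κ) {a : ℝ} (ha : 0 < a)
    (hi : ∀ t ≤ a, Integrable (fun x => Real.exp (t * Z x) * κ x) μ)
    (hm : ∀ n : ℕ, Integrable (fun x => Z x ^ n * κ x) μ)
    (h : ∀ n : ℕ, ∫ x, Z x ^ n * κ x ∂μ = 0) {k : ℝ → ℝ} (hk : Measurable k)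
    (hki : Integrable (fun x => k (Z x) * κ x) μ) : ∫ x, k (Z x) * κ x ∂μ = 0 := by
  set μp := μ.withDensity fun x => ENNReal.ofReal (κ x)
  set μn := μ.withDensity fun x => ENNReal.ofReal (-κ x)
  have hκn : Measurable fun x => -κ x := hκ.neg
  have hκi : Integrable κ μ := by simpa using hi 0 ha.le
  have : IsFiniteMeasure μp := isFiniteMeasure_withDensity_ofReal hκi.2
  have : IsFiniteMeasure μn := isFiniteMeasure_withDensity_ofReal hκi.neg.2
  have hp : ∀ f : Ω → ℝ, ∫ x, f x ∂μp = ∫ x, max (κ x) 0 * f x ∂μ := by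
    intro f
    rw [integral_withDensity_eq_integral_toReal_smul hκ.ennreal_ofReal (by simp)]
    simp [ENNReal.toReal_ofReal']
  have hn : ∀ f : Ω → ℝ, ∫ x, f x ∂μn = ∫ x, max (-κ x) 0 * f x ∂μ := by
    intro f
    rw [integral_withDensity_eq_integral_toReal_smul hκn.ennreal_ofReal (by simp)]
    simp [ENNReal.toReal_ofReal']
  have hpi : ∀ f : Ω → ℝ, Measurable f → Integrable (fun x => f x * κ x) μ →
      Integrable (fun x => max (κ x) 0 * f x) μ := by
    intro f hf hfi
    refine hfi.mono ((hκ.max measurable_const).mul hf).aestronglyMeasurable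
      (ae_of_all _ fun x => ?_)
    rw [norm_mul, norm_mul, mul_comm]
    gcongr
    rw [Real.norm_eq_abs, Real.norm_eq_abs, abs_of_nonneg (le_max_right _ _)]
    exact max_le (le_abs_self _) (abs_nonneg _)
  have hni : ∀ f : Ω → ℝ, Measurable f → Integrable (fun x => f x * κ x) μ →
      Integrable (fun x => max (-κ x) 0 * f x) μ := by
    intro f hf hfi
    refine hfi.mono ((hκ.neg.max measurable_const).mul hf).aestronglyMeasurable
      (ae_of_all _ fun x => ?_)
    rw [norm_mul, norm_mul, mul_comm]
    gcongr
    rw [Real.norm_eq_abs, Real.norm_eq_abs, abs_of_nonneg (le_max_right _ _)]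
    exact max_le (neg_le_abs _) (abs_nonneg _)
  have hsub : ∀ f : Ω → ℝ, Measurable f → Integrable (fun x => f x * κ x) μ →
      ∫ x, f x * κ x ∂μ = ∫ x, f x ∂μp - ∫ x, f x ∂μn := by
    intro f hf hfi
    rw [hp, hn, ← integral_sub (hpi f hf hfi) (hni f hf hfi)]
    congr 1
    ext x
    rcases le_total 0 (κ x) with h | h
    · rw [max_eq_left h, max_eq_right (by linarith)]; ring
    · rw [max_eq_right h, max_eq_left (by linarith)]; ring
  have hmap : μp.map Z = μn.map Z := by
    refine map_eq_map_of_moments_eq hZ ha (fun t ht => ?_) (fun t ht => ?_) fun n => ?_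
    · rw [integrable_withDensity_iff_integrable_smul' hκ.ennreal_ofReal (by simp)]
      simpa [ENNReal.toReal_ofReal'] using
        hpi _ (hZ.const_mul t).exp (hi t ht.le)
    · rw [integrable_withDensity_iff_integrable_smul' hκn.ennreal_ofReal (by simp)]
      simpa [ENNReal.toReal_ofReal'] using
        hni _ (hZ.const_mul t).exp (hi t ht.le)
    · have := hsub _ (hZ.pow_const n) (hm n)
      rw [h n] at this
      linarith
  rw [hsub (fun x => k (Z x)) (hk.comp hZ) hki, ← integral_map hZ.aemeasurable hk.aestronglyMeasurable,
    ← integral_map hZ.aemeasurable hk.aestronglyMeasurable, hmap, sub_self]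

/-! ### Polar coordinates and density of the modes -/

lemma ae_polarCoord_symm {Q : ℂ → Prop} (h : ∀ᵐ z : ℂ, Q z) :
    ∀ᵐ p ∂((volume : Measure (ℝ × ℝ)).restrict polarCoord.target),
      Q (Complex.polarCoord.symm p) := by
  obtain ⟨N, hN, hNm, hN0⟩ := exists_measurable_superset_of_null (ae_iff.mp h)
  have h1 := Complex.lintegral_comp_polarCoord_symm (N.indicator 1)
  rw [lintegral_indicator_one hNm, hN0] at h1
  have hms : Measurable fun p : ℝ × ℝ => Complex.polarCoord.symm p := by
    simp only [Complex.polarCoord_symm_apply]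
    fun_prop
  rw [lintegral_eq_zero_iff (by
    exact (measurable_fst.ennreal_ofReal).mul ((measurable_one.indicator hNm).comp hms))] at h1
  filter_upwards [h1, ae_restrict_mem polarCoord.open_target.measurableSet] with p hp hpt
  by_contra hQ
  have hmem : Complex.polarCoord.symm p ∈ N := hN hQ
  have hpos : 0 < p.1 := (mem_prod.mp hpt).1
  simp only [Pi.zero_apply, smul_eq_mul, indicator_of_mem hmem, Pi.one_apply, mul_one,
    ENNReal.ofReal_eq_zero] at hp
  exact absurd hpos (not_lt.mpr hp)

lemma ae_ae_polar {Q : ℂ → Prop} (h : ∀ᵐ z : ℂ, Q z) :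
    ∀ᵐ θ ∂((volume : Measure ℝ).restrict (Ioo (-Real.pi) Real.pi)),
      ∀ᵐ r ∂((volume : Measure ℝ).restrict (Ioi 0)), Q (Complex.polarCoord.symm (r, θ)) := by
  have h1 := ae_polarCoord_symm h
  rw [polarCoord_target, Measure.volume_eq_prod, ← Measure.prod_restrict] at h1
  have h2 : ∀ᵐ p ∂((volume : Measure ℝ).restrict (Ioo (-Real.pi) Real.pi)).prod
      ((volume : Measure ℝ).restrict (Ioi 0)), Q (Complex.polarCoord.symm p.swap) := by
    rw [← Measure.prod_swap] at h1
    exact ae_of_ae_map measurable_swap.aemeasurable h1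
  exact Measure.ae_ae_of_ae_prod h2

lemma exists_ae_polar {Q : ℂ → Prop} (h : ∀ᵐ z : ℂ, Q z) : ∃ θ : ℝ,
    ∀ᵐ r ∂((volume : Measure ℝ).restrict (Ioi 0)), Q (Complex.polarCoord.symm (r, θ)) := by
  have h1 := ae_ae_polar h
  have : (ae ((volume : Measure ℝ).restrict (Ioo (-Real.pi) Real.pi))).NeBot := by
    rw [ae_neBot, Ne, Measure.restrict_eq_zero, Real.volume_Ioo, ENNReal.ofReal_eq_zero, not_le]
    linarith [Real.pi_pos]
  exact h1.exists

lemma norm_polarCoord_symm_of_pos {r : ℝ} (hr : 0 < r) (θ : ℝ) :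
    ‖Complex.polarCoord.symm (r, θ)‖ = r := by
  rw [Complex.norm_polarCoord_symm, abs_of_pos hr]

lemma ae_Ioi_of_ae_norm {P : ℝ → Prop} (h : ∀ᵐ z : ℂ, P ‖z‖) :
    ∀ᵐ r ∂((volume : Measure ℝ).restrict (Ioi 0)), P r := by
  obtain ⟨θ, hθ⟩ := exists_ae_polar h
  filter_upwards [hθ, ae_restrict_mem measurableSet_Ioi] with r hr hr0
  rwa [norm_polarCoord_symm_of_pos hr0] at hr

lemma ae_norm_of_ae_Ioi {P : ℝ → Prop}
    (h : ∀ᵐ r ∂((volume : Measure ℝ).restrict (Ioi 0)), P r) : ∀ᵐ z : ℂ, P ‖z‖ := by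
  obtain ⟨N, hN, hNm, hN0⟩ := exists_measurable_superset_of_null (ae_iff.mp h)
  have h1 := Complex.lintegral_comp_polarCoord_symm ((norm ⁻¹' N).indicator 1)
  rw [lintegral_indicator_one (measurable_norm hNm)] at h1
  have h2 : ∀ᵐ p ∂((volume : Measure (ℝ × ℝ)).restrict polarCoord.target), p.1 ∉ N := by
    rw [polarCoord_target, Measure.volume_eq_prod, ← Measure.prod_restrict]
    exact Measure.quasiMeasurePreserving_fst.ae (compl_mem_ae_iff.mpr hN0)
  have h3 : volume ((norm : ℂ → ℝ) ⁻¹' N) = 0 := by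
    rw [← h1, ← lintegral_zero (μ := (volume : Measure (ℝ × ℝ)).restrict polarCoord.target)]
    apply lintegral_congr_ae
    filter_upwards [h2, ae_restrict_mem polarCoord.open_target.measurableSet] with p hp hpt
    have hpos : 0 < p.1 := (mem_prod.mp hpt).1
    rw [indicator_of_notMem, smul_zero]
    rw [mem_preimage, Complex.norm_polarCoord_symm, abs_of_pos hpos]
    exact hp
  filter_upwards [compl_mem_ae_iff.mpr h3] with z hz
  by_contra hP
  exact hz (hN hP)

lemma conj_phase_mul_phase (m : ℕ) (z : ℂ) :
    Complex.exp (-(m * Complex.arg z * Complex.I)) *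
      Complex.exp (m * Complex.arg z * Complex.I) = 1 := by
  rw [← Complex.exp_add, neg_add_cancel, Complex.exp_zero]

/-- The given profile may fail to be measurable off the null set. Removing the phase from `u` and
restricting to a generic ray yields a measurable profile. -/
lemma exists_measurable_profile {m : ℕ} {u : L2} {w : ℝ → ℝ} (h : HasProfile m u w) :
    ∃ w' : ℝ → ℝ, Measurable w' ∧ HasProfile m u w' := by
  set V : ℂ → ℝ := fun z => (Complex.exp (-(m * Complex.arg z * Complex.I)) * u z).re with hV
  have hVm : Measurable V := by
    have := (Lp.stronglyMeasurable u).measurable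
    fun_prop
  have h1 : ∀ᵐ z : ℂ, w ‖z‖ = V z := by
    filter_upwards [h] with z hz
    rw [hV]
    simp only
    rw [hz, ← mul_assoc, conj_phase_mul_phase, one_mul, Complex.ofReal_re]
  obtain ⟨θ, hθ⟩ := exists_ae_polar h1
  refine ⟨fun r => V (Complex.polarCoord.symm (r, θ)), ?_, ?_⟩
  · apply hVm.comp
    simp only [Complex.polarCoord_symm_apply]
    fun_prop
  · have h2 : ∀ᵐ r ∂((volume : Measure ℝ).restrict (Ioi 0)),
        w r = V (Complex.polarCoord.symm (r, θ)) := by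
      filter_upwards [hθ, ae_restrict_mem measurableSet_Ioi] with r hr hr0
      rwa [norm_polarCoord_symm_of_pos hr0] at hr
    filter_upwards [h, ae_norm_of_ae_Ioi h2] with z hz hz2
    rw [hz, hz2]

lemma inner_phase_mul (m : ℕ) (z v : ℂ) (c : ℝ) :
    inner ℝ v (Complex.exp (m * Complex.arg z * Complex.I) * (c : ℂ)) =
      c * (Complex.exp (-(m * Complex.arg z * Complex.I)) * v).re := by
  have h : Complex.exp (-(m * Complex.arg z * Complex.I)) =
      (starRingEnd ℂ) (Complex.exp (m * Complex.arg z * Complex.I)) := by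
    rw [← Complex.exp_conj]
    simp
  rw [h, mul_comm _ (c : ℂ), ← Complex.real_smul, inner_smul_right, Complex.inner, ← Complex.conj_re]
  simp [mul_comm]

lemma integrable_norm_pow_mul_exp (m : ℕ) (v : L2) :
    Integrable fun z : ℂ => ‖z‖ ^ m * Real.exp (-‖z‖ ^ 2 / 4) * ‖v z‖ := by
  -- Rescaling by `1/√2` turns `e^{-|z|²/2}` into `e^{-|z|²/4}`, up to the constant `c^m`.
  set c : ℝ := (Real.sqrt 2)⁻¹ with hc
  have hc0 : c ≠ 0 := by positivity
  set L : ℂ ≃L[ℝ] ℂ := ContinuousLinearEquiv.smulLeft (Units.mk0 c hc0)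
  have hL : ∀ z, L z = c • z := fun z => rfl
  set f := compCLMOfContinuousLinearEquiv ℝ L (wave m 1)
  have hf : ∀ z, ‖f z‖ = c ^ m * (‖z‖ ^ m * Real.exp (-‖z‖ ^ 2 / 4)) := by
    intro z
    change ‖wave m 1 (L z)‖ = _
    rw [wave_apply, radialPart, norm_mul, norm_pow, hL, norm_smul, Complex.norm_real, eval_one,
      one_mul, Real.norm_of_nonneg (Real.exp_pos _).le, Real.norm_of_nonneg (by positivity),
      mul_pow, mul_pow, mul_assoc]
    congr 3
    rw [hc, inv_pow, Real.sq_sqrt (by norm_num)]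
    ring
  have h1 : Integrable fun z => (c ^ m)⁻¹ * (‖f z‖ * ‖v z‖) :=
    ((f.memLp 2 volume).norm.integrable_mul (Lp.memLp v).norm).const_mul _
  refine h1.congr (ae_of_all _ fun z => ?_)
  simp only [hf]
  field_simp

/-- Every square integrable function with a real radial profile is a limit of modes. -/
lemma HasProfile.mem_modes {m : ℕ} {u : L2} {w : ℝ → ℝ} (h : HasProfile m u w) : u ∈ modes m := by
  obtain ⟨w, hw, h⟩ := exists_measurable_profile h
  rw [← Submodule.orthogonal_orthogonal (modes m), Submodule.mem_orthogonal]
  intro v hv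
  set ν : ℂ → ℝ := fun z => (Complex.exp (-(m * Complex.arg z * Complex.I)) * v z).re with hν
  have hνm : Measurable ν := by
    have := (Lp.stronglyMeasurable v).measurable
    fun_prop
  have hνv : ∀ z, |ν z| ≤ ‖v z‖ := by
    intro z
    refine (Complex.abs_re_le_norm _).trans ?_
    rw [norm_mul]
    have : -(m * Complex.arg z * Complex.I) = ((-(m * Complex.arg z) : ℝ) : ℂ) * Complex.I := by
      push_cast; ring
    rw [this, Complex.norm_exp_ofReal_mul_I, one_mul]
  set κ : ℂ → ℝ := fun z => ‖z‖ ^ m * Real.exp (-‖z‖ ^ 2 / 2) * ν z with hκ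
  have hκm : Measurable κ := by fun_prop
  have hwave : ∀ (p : ℝ[X]) (z : ℂ), inner ℝ (v z) (wave m p z) = p.eval (‖z‖ ^ 2) * κ z := by
    intro p z
    rw [wave_apply, radialPart, exp_arg_mul_norm, mul_assoc, ← Complex.ofReal_pow,
      ← Complex.ofReal_mul, inner_phase_mul]
    ring
  have hi : ∀ p : ℝ[X], Integrable fun z : ℂ => p.eval (‖z‖ ^ 2) * κ z := by
    intro p
    simp_rw [← hwave, real_inner_comm (wave m p _)]
    exact integrable_inner_L2 _ v
  have h0 : ∀ p : ℝ[X], ∫ z : ℂ, p.eval (‖z‖ ^ 2) * κ z = 0 := by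
    intro p
    simp_rw [← hwave, real_inner_comm (wave m p _)]
    rw [← inner_toL2_left]
    exact (Submodule.mem_orthogonal _ _).mp hv _ (waveL2_mem_modes m p)
  have hzero : ∀ᵐ z : ℂ, z ≠ 0 := by
    rw [ae_iff]; simp
  have hk : ∀ᵐ z : ℂ, w (Real.sqrt (‖z‖ ^ 2)) / (Real.sqrt (‖z‖ ^ 2) ^ m *
      Real.exp (-(‖z‖ ^ 2) / 2)) * κ z = inner ℝ (v z) (u z) := by
    filter_upwards [h, hzero] with z hz hz0
    have hpos : 0 < ‖z‖ := norm_pos_iff.mpr hz0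
    rw [hz, inner_phase_mul, Real.sqrt_sq hpos.le, hκ]
    field_simp
    rfl
  rw [L2.inner_def, ← integral_congr_ae hk]
  -- Orthogonality of `v` to the modes says that all moments of `|z|²` against `κ` vanish. The
  -- function `k` is `w / w₀` in the variable `t = r²`, so `k(|z|²) κ = ⟨v, u⟩`. The value `a = 1/4`
  -- is admissible because `e^{r²/4}` still leaves the factor `e^{-r²/4}` in `κ`.
  refine integral_comp_mul_eq_zero_of_moments (Z := fun z : ℂ => ‖z‖ ^ 2) (κ := κ) (a := 1 / 4)
    (k := fun t => w (Real.sqrt t) / (Real.sqrt t ^ m * Real.exp (-t / 2)))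
    (by fun_prop) hκm (by norm_num) (fun t ht => ?_) (fun n => ?_) (fun n => ?_) (by fun_prop) ?_
  · refine (integrable_norm_pow_mul_exp m v).mono (by fun_prop) (ae_of_all _ fun z => ?_)
    have e : Real.exp (t * ‖z‖ ^ 2) * κ z =
        ‖z‖ ^ m * Real.exp (t * ‖z‖ ^ 2 + -‖z‖ ^ 2 / 2) * ν z := by
      rw [hκ, Real.exp_add]; ring
    rw [e, norm_mul, norm_mul, norm_mul, norm_mul, Real.norm_of_nonneg (Real.exp_pos _).le,
      Real.norm_of_nonneg (Real.exp_pos _).le, norm_norm, Real.norm_eq_abs (ν z)]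
    gcongr
    · nlinarith [sq_nonneg ‖z‖]
    · exact hνv z
  · simpa using hi (Polynomial.X ^ n)
  · simpa using h0 (Polynomial.X ^ n)
  · exact (L2.integrable_inner (𝕜 := ℝ) v u).congr (hk.mono fun z hz => hz.symm)

/-! ### Orthogonal decomposition of the space `X m` -/

lemma eq_zero_of_inner_schwartz {g : L2} (h : ∀ ψ : 𝓢(ℂ, ℂ), inner ℝ (toL2 ψ) g = 0) : g = 0 := by
  refine Lp.ext ((ae_eq_of_inner_schwartz ((Lp.memLp g).locallyIntegrable (by norm_num))
    (continuous_const (y := (0 : ℂ))).locallyIntegrable fun ψ _ => ?_).trans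
    (Lp.coeFn_zero ℂ 2 volume).symm)
  rw [← inner_toL2_left, h ψ]
  simp

lemma IsJet.eq_zero {J : Jets} (hJ : IsJet J) (h0 : J 0 = 0) : J = 0 := by
  have key : ∀ {v : ℂ} {f g : L2}, IsWeakDeriv v f g → f = 0 → g = 0 := by
    intro v f g h hf
    refine eq_zero_of_inner_schwartz fun ψ => ?_
    have := h.inner_schwartz ψ
    rw [hf, inner_zero_right] at this
    linarith
  have h1 := key hJ.dx h0
  have h2 := key hJ.dy h0
  have h6 : J 6 = 0 := eq_zero_of_inner_schwartz fun ψ => by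
    rw [hJ.inner_weight, h0, inner_zero_right]
  ext i : 1
  fin_cases i
  exacts [h0, h1, h2, key hJ.dxx h1, key hJ.dxy h1, key hJ.dyy h2, h6]

lemma X.ext_of_fst {m : ℕ} {V W : X m} (h : (V : Jets) 0 = (W : Jets) 0) : V = W := by
  have h1 := (V - W).2.1.eq_zero (by
    change (V : Jets) 0 - (W : Jets) 0 = 0
    rw [h, sub_self])
  exact sub_eq_zero.mp (Subtype.ext h1)

/-- `(-Δ + r² - 2(m + 1)) u` for a jet `u`. -/
def jetOp (m : ℕ) (J : Jets) : L2 := - J 3 - J 5 + J 6 - (2 * (m + 1) : ℝ) • J 0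

lemma norm_component_le (J : Jets) (i : Fin 7) : ‖J i‖ ≤ ‖J‖ := PiLp.norm_apply_le J i

lemma norm_jetOp_le (m : ℕ) (J : Jets) : ‖jetOp m J‖ ≤ (2 * m + 5) * ‖J‖ := by
  have h : ‖(2 * (m + 1) : ℝ) • J 0‖ ≤ (2 * (m + 1)) * ‖J‖ := by
    rw [norm_smul, Real.norm_of_nonneg (by positivity)]
    gcongr
    exact norm_component_le J 0
  have h1 := norm_sub_le (- J 3 - J 5 + J 6) ((2 * (m + 1) : ℝ) • J 0)
  have h2 := norm_add_le (- J 3 - J 5) (J 6)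
  have h3 := norm_sub_le (- J 3) (J 5)
  rw [norm_neg] at h3
  have := norm_component_le J 3
  have := norm_component_le J 5
  have := norm_component_le J 6
  unfold jetOp
  linarith

/-- Self-adjointness of `A`: the weak derivatives of the jet are moved onto the wave, where
`oscillator_wave` evaluates the result. -/
lemma inner_waveL2_jetOp (m : ℕ) (p : ℝ[X]) {J : Jets} (hJ : IsJet J) :
    inner ℝ (waveL2 m p) (jetOp m J) = 4 * inner ℝ (waveL2 m (laguerreOp m p)) (J 0) := by
  have h3 : inner ℝ (toL2 (wave m p)) (J 3) =
      inner ℝ (toL2 (∂_{(1 : ℂ)} (∂_{(1 : ℂ)} (wave m p)))) (J 0) := by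
    rw [hJ.dx.inner_schwartz, hJ.dxx.inner_schwartz, neg_neg]
  have h5 : inner ℝ (toL2 (wave m p)) (J 5) =
      inner ℝ (toL2 (∂_{Complex.I} (∂_{Complex.I} (wave m p)))) (J 0) := by
    rw [hJ.dy.inner_schwartz, hJ.dyy.inner_schwartz, neg_neg]
  have h6 := hJ.inner_weight (wave m p)
  have h := congrArg (fun f => inner ℝ (toL2 f) (J 0)) (oscillator_wave m p)
  simp only [lap, map_add, map_neg, map_smul, inner_add_left, inner_neg_left,
    real_inner_smul_left] at h
  simp only [jetOp, waveL2_apply, inner_sub_right, inner_add_right, inner_neg_right,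
    inner_smul_right, h3, h5, h6]
  linarith

lemma ext_of_inner_modeOp {m : ℕ} {u v : L2} (hu : u ∈ modes m) (hv : v ∈ modes m)
    (h : ∀ p, inner ℝ u (modeOp m p : L2) = inner ℝ v (modeOp m p : L2)) : u = v := by
  have h1 : ∀ y : modes m, inner ℝ (u - v) (y : L2) = 0 := by
    refine modes_induction (isClosed_eq (continuous_const.inner continuous_subtype_val)
      continuous_const) fun p => ?_
    rw [inner_sub_left, h p, sub_self]
  exact sub_eq_zero.mp (inner_self_eq_zero.mp (h1 ⟨u - v, (modes m).sub_mem hu hv⟩))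

lemma inner_jet_modeOp (m : ℕ) (u : L2) (p : ℝ[X]) : inner ℝ u (modeOp m p : L2) =
    4 * inner ℝ u (waveL2 m (laguerreOp m p)) +
      groundCoeff m (mode m p) * inner ℝ u (waveL2 m 1) := by
  change inner ℝ u ((4 : ℝ) • waveL2 m (laguerreOp m p) +
    groundCoeff m (mode m p) • waveL2 m 1) = _
  rw [inner_add_right, real_inner_smul_right, real_inner_smul_right]

/-- Orthogonal decomposition of the elements of `X m` along the ground state. -/
lemma exists_eq_smul_groundX_add_solve {m : ℕ} (W : X m) : ∃ (s : ℝ) (f : modes m),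
    W = s • groundX m + solve m f ∧ groundCoeff m f = 0 ∧ ‖f‖ ≤ (2 * m + 5) * ‖W‖ := by
  obtain ⟨w, hw⟩ := W.2.2
  have hJ := W.2.1
  have h0 : (W : Jets) 0 ∈ modes m := hw.mem_modes
  set F := jetOp m (W : Jets) with hF
  -- Whether `F` itself lies in `modes` is not needed: it is only ever tested against modes, and the
  -- projection has the same inner products with them.
  set f := (modes m).orthogonalProjectionOnto F with hf
  have hin : ∀ y : modes m, inner ℝ (f : L2) (y : L2) = inner ℝ F (y : L2) := fun y =>
    Submodule.inner_orthogonalProjectionOnto_eq_of_mem_right y F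
  have hin' : ∀ p, inner ℝ (f : L2) (waveL2 m p) =
      4 * inner ℝ (waveL2 m (laguerreOp m p)) ((W : Jets) 0) := by
    intro p
    rw [← inner_waveL2_jetOp m p hJ, ← coe_mode, hin, real_inner_comm]
  have hf1 : groundCoeff m f = 0 := by
    rw [groundCoeff_eq_zero_iff, real_inner_comm]
    have := hin' 1
    rw [← C_1, laguerreOp_C, map_zero, inner_zero_left, mul_zero, C_1] at this
    exact this
  set s := groundCoeff m ⟨(W : Jets) 0, h0⟩ with hs
  refine ⟨s, f, ?_, hf1, ?_⟩
  · apply X.ext_of_fst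
    change (W : Jets) 0 = s • waveL2 m 1 + solveJet m f 0
    rw [← sub_eq_iff_eq_add']
    have hs1 : inner ℝ ((W : Jets) 0 - s • waveL2 m 1) (waveL2 m 1) = 0 := by
      have h1 : groundCoeff m ((⟨(W : Jets) 0, h0⟩ : modes m) - s • mode m 1) = 0 := by
        rw [map_sub, map_smul, groundCoeff_one, smul_eq_mul, mul_one, hs, sub_self]
      rw [groundCoeff_eq_zero_iff, real_inner_comm] at h1
      exact h1
    refine ext_of_inner_modeOp ((modes m).sub_mem h0 ((modes m).smul_mem _ (waveL2_mem_modes m 1)))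
      (solveJet_mem_modes m f) fun p => ?_
    rw [inner_solveJet_modeOp, inner_jet_modeOp, hs1, mul_zero, add_zero, hin', laguerreOp_center,
      inner_sub_left, real_inner_smul_left, real_inner_comm (waveL2 m (laguerreOp m p)) (waveL2 m 1),
      inner_laguerreOp_one, mul_zero, sub_zero, real_inner_comm]
  · exact ((modes m).norm_orthogonalProjectionOnto_apply_le F).trans (norm_jetOp_le m _)

lemma solve_injective {m : ℕ} {f : modes m} (hf : groundCoeff m f = 0)
    (h : solveJet m f 0 = 0) : f = 0 := by
  have h1 : ∀ p, inner ℝ (f : L2) (waveL2 m p) = 0 := by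
    intro p
    have := inner_solveJet_modeOp m f p
    rw [h, inner_zero_left] at this
    have e : waveL2 m (center m p) = waveL2 m p - groundCoeff m (mode m p) • waveL2 m 1 := by
      rw [center_apply, map_sub, map_smul]
    have h2 : inner ℝ (f : L2) (waveL2 m 1) = 0 := by
      rw [groundCoeff_eq_zero_iff, real_inner_comm] at hf
      exact hf
    rw [e, inner_sub_right, real_inner_smul_right, h2, mul_zero, sub_zero] at this
    exact this.symm
  have h2 := ext_of_inner_modeOp f.2 (modes m).zero_mem fun p => by
    rw [inner_jet_modeOp, h1, h1, inner_zero_left]; simp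
  exact Subtype.ext h2

lemma isProfile_groundX (m : ℕ) : IsProfile (groundX m) (groundState m) := by
  unfold IsProfile HasProfile
  filter_upwards [coeFn_toL2 (wave m 1)] with z hz
  refine hz.trans ?_
  rw [wave_apply, radialPart, exp_arg_mul_norm, groundState, eval_one, one_mul]
  push_cast
  ring

/-! ### The first order equation for the profile -/

/-- Continuous profile of `solve m f`. -/
def solveProfile (m : ℕ) (f : modes m) (r : ℝ) : ℝ := (solveRep m f (r : ℂ)).re

/-- The integral over the disc of radius `r` of the inner product with the ground state. -/
def diskPairing (m : ℕ) (r : ℝ) (f : L2) : ℝ :=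
  ∫ z in Metric.ball (0 : ℂ) r, inner ℝ (wave m 1 z) (f z)

lemma diskPairing_sub (m : ℕ) (r : ℝ) (f g : L2) :
    diskPairing m r (f - g) = diskPairing m r f - diskPairing m r g := by
  rw [diskPairing, diskPairing, diskPairing, ← integral_sub
    (integrable_inner_L2 _ f).integrableOn (integrable_inner_L2 _ g).integrableOn]
  apply integral_congr_ae
  filter_upwards [ae_restrict_of_ae (Lp.coeFn_sub f g)] with z hz
  rw [hz, Pi.sub_apply, inner_sub_right]

/-- Cauchy–Schwarz, with a constant independent of `r`: this makes the passage to the limit in the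
first order equation locally uniform. -/
lemma abs_diskPairing_le (m : ℕ) (r : ℝ) (f : L2) :
    |diskPairing m r f| ≤ ‖waveL2 m 1‖ * ‖f‖ := by
  have hi : Integrable fun z => ‖wave m 1 z‖ * ‖f z‖ :=
    ((wave m 1).memLp 2 volume).norm.integrable_mul (Lp.memLp f).norm
  have hle : ∀ z, ‖inner ℝ (wave m 1 z) (f z)‖ ≤ ‖wave m 1 z‖ * ‖f z‖ := fun z =>
    norm_inner_le_norm _ _
  have h1 : |diskPairing m r f| ≤ ∫ z, ‖wave m 1 z‖ * ‖f z‖ := by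
    rw [diskPairing, ← Real.norm_eq_abs]
    refine (norm_integral_le_integral_norm _).trans ?_
    refine (setIntegral_le_integral (integrable_inner_L2 (wave m 1) f).norm
      (ae_of_all _ fun z => norm_nonneg _)).trans ?_
    exact integral_mono (integrable_inner_L2 _ f).norm hi hle
  refine h1.trans ?_
  have h2 := integral_mul_norm_le_Lp_mul_Lq (μ := volume) (p := 2) (q := 2) (f := wave m 1) (g := f)
    (by constructor <;> norm_num) (by simpa using (wave m 1).memLp 2 volume)
    (by simpa using Lp.memLp f)
  refine h2.trans_eq ?_
  have e : ∀ g : L2, (∫ z, ‖g z‖ ^ (2 : ℝ)) ^ (1 / (2 : ℝ)) = ‖g‖ := by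
    intro g
    rw [← Real.sqrt_eq_rpow, ← Real.sqrt_sq (norm_nonneg g), ← real_inner_self_eq_norm_sq,
      L2.inner_def]
    simp_rw [real_inner_self_eq_norm_sq, Real.rpow_two]
  rw [e f, ← e (waveL2 m 1)]
  congr 2
  apply integral_congr_ae
  filter_upwards [coeFn_toL2 (wave m 1)] with z hz
  rw [waveL2_apply, hz]

lemma setIntegral_ball_norm (h : ℝ → ℝ) {r : ℝ} (hr : 0 ≤ r) :
    ∫ z in Metric.ball (0 : ℂ) r, h ‖z‖ = 2 * Real.pi * ∫ t in (0 : ℝ)..r, t * h t := by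
  have h1 : ∀ z : ℂ, (Metric.ball (0 : ℂ) r).indicator (fun z => h ‖z‖) z =
      (Iio r).indicator h ‖z‖ := by
    intro z
    by_cases hz : ‖z‖ < r
    · rw [indicator_of_mem (by simpa using hz), indicator_of_mem (by simpa using hz)]
    · rw [indicator_of_notMem (by simpa using hz), indicator_of_notMem (by simpa using hz)]
  rw [← integral_indicator Metric.isOpen_ball.measurableSet, funext h1, integral_fun_norm_addHaar]
  have h2 : ∀ t : ℝ, t ^ (Module.finrank ℝ ℂ - 1) • (Iio r).indicator h t =
      (Iio r).indicator (fun t => t * h t) t := by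
    intro t
    rw [Complex.finrank_real_complex, Nat.add_one_sub_one, pow_one, smul_eq_mul]
    by_cases ht : t ∈ Iio r
    · rw [indicator_of_mem ht, indicator_of_mem ht]
    · rw [indicator_of_notMem ht, indicator_of_notMem ht, mul_zero]
  simp_rw [h2]
  rw [setIntegral_indicator measurableSet_Iio, Ioi_inter_Iio, intervalIntegral.integral_of_le hr,
    integral_Ioc_eq_integral_Ioo]
  simp [Measure.real, Complex.finrank_real_complex]
  ring

lemma inner_wave_one_phase (m : ℕ) (z : ℂ) (c : ℝ) :
    inner ℝ (wave m 1 z) (Complex.exp (m * Complex.arg z * Complex.I) * (c : ℂ)) =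
      groundState m ‖z‖ * c := by
  have h : wave m 1 z = Complex.exp (m * Complex.arg z * Complex.I) * (groundState m ‖z‖ : ℂ) := by
    rw [wave_apply, radialPart, exp_arg_mul_norm, groundState, eval_one, one_mul]
    push_cast
    ring
  rw [inner_phase_mul, h, ← mul_assoc, conj_phase_mul_phase, one_mul, Complex.ofReal_re, mul_comm]

lemma diskPairing_of_hasProfile {m : ℕ} {f : L2} {F : ℝ → ℝ} (h : HasProfile m f F) {r : ℝ}
    (hr : 0 ≤ r) :
    diskPairing m r f = 2 * Real.pi * ∫ t in (0 : ℝ)..r, t * (groundState m t * F t) := by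
  rw [← setIntegral_ball_norm (fun t => groundState m t * F t) hr]
  apply integral_congr_ae
  filter_upwards [ae_restrict_of_ae h] with z hz
  rw [hz, inner_wave_one_phase]

lemma groundState_pos (m : ℕ) {r : ℝ} (hr : 0 < r) : 0 < groundState m r := by
  unfold groundState; positivity

lemma continuous_groundState (m : ℕ) : Continuous (groundState m) := by
  unfold groundState; fun_prop

lemma hasDerivAt_groundState (m : ℕ) {r : ℝ} (hr : 0 < r) :
    HasDerivAt (groundState m) ((m / r - r) * groundState m r) r := by
  have h2 : HasDerivAt (fun r : ℝ => r ^ 2) (2 * r) r := by simpa using hasDerivAt_pow 2 r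
  have h3 : HasDerivAt (fun r : ℝ => -r ^ 2 / 2) (-(2 * r) / 2) r := h2.neg.div_const 2
  refine ((hasDerivAt_pow m r).mul h3.exp).congr_deriv ?_
  unfold groundState
  have : (m : ℝ) * r ^ (m - 1) = m / r * r ^ m := by
    rcases m with _ | m
    · simp
    · rw [Nat.add_sub_cancel, pow_succ]; field_simp
  rw [this]
  ring

lemma solveProfile_modeOp (m : ℕ) (p : ℝ[X]) (r : ℝ) (hr : 0 ≤ r) :
    solveProfile m (modeOp m p) r = groundState m r * (center m p).eval (r ^ 2) := by
  rw [solveProfile, solveRep_modeOp, wave_apply, radialPart, groundState]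
  rw [← Complex.ofReal_pow, ← Complex.ofReal_mul, Complex.ofReal_re, Complex.norm_real,
    Real.norm_of_nonneg hr]
  ring

lemma hasProfile_waveL2 (m : ℕ) (p : ℝ[X]) :
    HasProfile m (waveL2 m p) fun r => groundState m r * p.eval (r ^ 2) := by
  filter_upwards [coeFn_toL2 (wave m p)] with z hz
  refine hz.trans ?_
  rw [wave_apply, radialPart, exp_arg_mul_norm, groundState]
  push_cast
  ring

/-- Component of a mode orthogonal to the ground state. -/
def perp (m : ℕ) (f : modes m) : modes m := f - groundCoeff m f • mode m 1

lemma perp_modeOp (m : ℕ) (p : ℝ[X]) : perp m (modeOp m p) = (4 : ℝ) • mode m (laguerreOp m p) := by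
  have h : groundCoeff m (mode m (laguerreOp m p)) = 0 := by
    rw [groundCoeff_eq_zero_iff, real_inner_comm]
    exact inner_laguerreOp_one m p
  rw [perp, modeOp_apply, map_add, map_smul, map_smul, h, groundCoeff_one, smul_zero, zero_add,
    smul_eq_mul, mul_one, add_sub_cancel_right]

/-- The divergence form of `L_m` again, now integrated only up to radius `r`: the boundary term is
`r w₀²` times the derivative of the quotient by `w₀`. -/
lemma diskPairing_perp_modeOp (m : ℕ) (p : ℝ[X]) {r : ℝ} (hr : 0 ≤ r) :
    diskPairing m r (perp m (modeOp m p)) = - (2 * Real.pi) *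
      (r * groundState m r ^ 2 * (2 * r * (derivative (center m p)).eval (r ^ 2))) := by
  have h : HasProfile m (perp m (modeOp m p) : L2)
      fun r => groundState m r * ((4 : ℝ) • laguerreOp m p).eval (r ^ 2) := by
    rw [perp_modeOp, ← map_smul]
    exact hasProfile_waveL2 m _
  rw [diskPairing_of_hasProfile h hr, neg_mul, ← mul_neg]
  congr 1
  set q := center m p with hq
  rw [← laguerreOp_center, ← hq]
  have hd : ∀ t : ℝ, HasDerivAt
      (fun t : ℝ => -(t * groundState m t ^ 2 * (2 * t * (derivative q).eval (t ^ 2))))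
      (t * (groundState m t * (groundState m t * ((4 : ℝ) • laguerreOp m q).eval (t ^ 2)))) t := by
    intro t
    have e : (fun t : ℝ => -(t * groundState m t ^ 2 * (2 * t * (derivative q).eval (t ^ 2)))) =
        fun t => -(2 * (t ^ (2 * m + 2) * (derivative q).eval (t ^ 2) * Real.exp (-t ^ 2))) := by
      ext t
      have hE : Real.exp (-t ^ 2) = Real.exp (-t ^ 2 / 2) * Real.exp (-t ^ 2 / 2) := by
        rw [← Real.exp_add]; ring_nf
      rw [hE, groundState]
      ring
    rw [e]
    have h2 : HasDerivAt (fun r : ℝ => r ^ 2) (2 * t) t := by simpa using hasDerivAt_pow 2 t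
    have h3 : HasDerivAt (fun r : ℝ => -r ^ 2) (-(2 * t)) t := h2.neg
    have h := ((((hasDerivAt_pow (2 * m + 2) t).mul
      (((derivative q).hasDerivAt (t ^ 2)).comp t h2)).mul h3.exp).const_mul 2).neg
    refine h.congr_deriv ?_
    have hE : Real.exp (-t ^ 2) = Real.exp (-t ^ 2 / 2) * Real.exp (-t ^ 2 / 2) := by
      rw [← Real.exp_add]; ring_nf
    rw [hE]
    simp only [laguerreOp_apply, groundState, Polynomial.eval_smul, Function.comp, smul_eq_mul,
      eval_neg, eval_add, eval_mul, eval_sub, eval_X, eval_one, eval_natCast, Pi.mul_apply,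
      show 2 * m + 2 - 1 = 2 * m + 1 by omega, pow_succ, pow_mul']
    push_cast
    ring
  rw [intervalIntegral.integral_eq_sub_of_hasDerivAt (fun t _ => hd t)]
  · simp
  · have := continuous_groundState m
    exact Continuous.intervalIntegrable (by fun_prop) _ _

lemma continuous_perp (m : ℕ) : Continuous (perp m) := by
  unfold perp; fun_prop

/-- The first order equation satisfied by the profile of `solve m f`. -/
lemma hasDerivAt_solveProfile_div (m : ℕ) (f : modes m) {r : ℝ} (hr : 0 < r) :
    HasDerivAt (fun r => solveProfile m f r / groundState m r)
      (-(2 * Real.pi)⁻¹ * diskPairing m r (perp m f) / (r * groundState m r ^ 2)) r := by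
  -- The identity is explicit for polynomial data. On `(r/2, 2r)` the factor `1/(x w₀²)` is bounded,
  -- so the derivatives converge uniformly and the limit may be differentiated.
  obtain ⟨y, hy, hlim⟩ := mem_closure_iff_seq_limit.mp (denseRange_modeOp m f)
  choose p hp using hy
  set s := Ioo (r / 2) (2 * r) with hs
  have hpos : ∀ x ∈ s, 0 < x := fun x hx => (half_pos hr).trans hx.1
  have hbdd : ∃ K : ℝ, ∀ x ∈ s, |(x * groundState m x ^ 2)⁻¹| ≤ K := by
    have hc : ContinuousOn (fun x => (x * groundState m x ^ 2)⁻¹) (Icc (r / 2) (2 * r)) := by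
      have := continuous_groundState m
      refine ContinuousOn.inv₀ (by fun_prop) fun x hx => ?_
      have hx0 : 0 < x := (half_pos hr).trans_le hx.1
      exact (mul_pos hx0 (pow_pos (groundState_pos m hx0) 2)).ne'
    obtain ⟨K, hK⟩ := isCompact_Icc.exists_bound_of_continuousOn hc
    exact ⟨K, fun x hx => hK x (Ioo_subset_Icc_self hx)⟩
  obtain ⟨K, hK⟩ := hbdd
  have hrs : r ∈ s := ⟨by linarith, by linarith⟩
  refine hasDerivAt_of_tendstoUniformlyOn (l := atTop) (s := s)
    (f := fun n x => solveProfile m (y n) x / groundState m x)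
    (f' := fun n x => -(2 * Real.pi)⁻¹ * diskPairing m x (perp m (y n)) /
      (x * groundState m x ^ 2))
    (g := fun r => solveProfile m f r / groundState m r)
    (g' := fun x => -(2 * Real.pi)⁻¹ * diskPairing m x (perp m f) / (x * groundState m x ^ 2))
    isOpen_Ioo ?_ (Eventually.of_forall fun n x hx => ?_)
    (fun x hx => ?_) hrs
  · have hlim2 : Tendsto (fun n => (2 * Real.pi)⁻¹ * (‖waveL2 m 1‖ *
        ‖(perp m f : L2) - (perp m (y n) : L2)‖) * K) atTop (𝓝 0) := by
      have h1 : Tendsto (fun n => (perp m (y n) : L2)) atTop (𝓝 (perp m f : L2)) :=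
        (continuous_subtype_val.tendsto _).comp (((continuous_perp m).tendsto f).comp hlim)
      have h2 := ((tendsto_const_nhds (x := (perp m f : L2))).sub h1).norm
      rw [sub_self, norm_zero] at h2
      simpa using ((h2.const_mul ‖waveL2 m 1‖).const_mul (2 * Real.pi)⁻¹).mul_const K
    rw [Metric.tendstoUniformlyOn_iff]
    intro ε hε
    filter_upwards [hlim2.eventually (gt_mem_nhds hε)] with n hn x hx
    refine lt_of_le_of_lt ?_ hn
    rw [Real.dist_eq, ← sub_div, ← mul_sub, ← diskPairing_sub, div_eq_mul_inv, abs_mul, abs_mul,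
      abs_neg, abs_of_pos (by positivity : 0 < (2 * Real.pi)⁻¹)]
    have hK0 : 0 ≤ K := (abs_nonneg _).trans (hK x hx)
    gcongr
    · exact abs_diskPairing_le _ _ _
    · exact hK x hx
  · have hx0 := hpos x hx
    rw [← hp n]
    have h2 : HasDerivAt (fun r : ℝ => r ^ 2) (2 * x) x := by simpa using hasDerivAt_pow 2 x
    have h3 := ((center m (p n)).hasDerivAt (x ^ 2)).comp x h2
    refine (h3.congr_of_eventuallyEq ?_).congr_deriv ?_
    · filter_upwards [lt_mem_nhds hx0] with t ht
      rw [solveProfile_modeOp m _ t ht.le, mul_div_cancel_left₀ _ (groundState_pos m ht).ne']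
      rfl
    · rw [diskPairing_perp_modeOp m _ hx0.le]
      have := (groundState_pos m hx0).ne'
      have := Real.pi_pos.ne'
      field_simp
  · refine Tendsto.div_const ?_ _
    have h1 : Continuous fun f : modes m => solveProfile m f x :=
      Complex.continuous_re.comp
        ((continuous_eval_zeroAtInfty (x : ℂ)).comp (solveRep m).continuous)
    exact (h1.tendsto f).comp hlim

/-! ### The cubic nonlinearity -/

lemma norm_zeroAtInfty_apply_le (c : C₀(ℂ, ℂ)) (z : ℂ) : ‖c z‖ ≤ ‖c‖ := c.toBCF.norm_coe_le_norm z

lemma ae_norm_mul_le (c : C₀(ℂ, ℂ)) (u : L2) : ∀ᵐ z : ℂ, ‖c z * u z‖ ≤ ‖c‖ * ‖u z‖ :=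
  ae_of_all _ fun z => by
    rw [norm_mul]
    gcongr
    exact norm_zeroAtInfty_apply_le c z

lemma memLp_mul (c : C₀(ℂ, ℂ)) (u : L2) : MemLp (fun z => c z * u z) 2 (volume : Measure ℂ) :=
  (Lp.memLp u).of_le_mul (c.continuous_toFun.aestronglyMeasurable.mul (Lp.aestronglyMeasurable u))
    (ae_norm_mul_le c u)

lemma norm_mul_toLp_le (c : C₀(ℂ, ℂ)) (u : L2) : ‖(memLp_mul c u).toLp‖ ≤ ‖c‖ * ‖u‖ := by
  refine Lp.norm_le_mul_norm_of_ae_le_mul ?_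
  filter_upwards [(memLp_mul c u).coeFn_toLp, ae_norm_mul_le c u] with z h1 h2
  rwa [h1]

/-- Multiplication of an `L²` function by a continuous function vanishing at infinity. -/
def mulL2 : C₀(ℂ, ℂ) →L[ℝ] L2 →L[ℝ] L2 :=
  LinearMap.mkContinuous₂ (LinearMap.mk₂ ℝ (fun c u => (memLp_mul c u).toLp)
    (fun c c' u => by
      apply Lp.ext
      filter_upwards [(memLp_mul (c + c') u).coeFn_toLp, (memLp_mul c u).coeFn_toLp,
        (memLp_mul c' u).coeFn_toLp, Lp.coeFn_add (memLp_mul c u).toLp (memLp_mul c' u).toLp]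
        with z h h1 h2 h3
      rw [h, h3, Pi.add_apply, h1, h2, ZeroAtInftyContinuousMap.add_apply, add_mul])
    (fun a c u => by
      apply Lp.ext
      filter_upwards [(memLp_mul (a • c) u).coeFn_toLp, (memLp_mul c u).coeFn_toLp,
        Lp.coeFn_smul a (memLp_mul c u).toLp] with z h h1 h2
      rw [h, h2, Pi.smul_apply, h1, ZeroAtInftyContinuousMap.smul_apply, smul_mul_assoc])
    (fun c u u' => by
      apply Lp.ext
      filter_upwards [(memLp_mul c (u + u')).coeFn_toLp, (memLp_mul c u).coeFn_toLp,
        (memLp_mul c u').coeFn_toLp, Lp.coeFn_add (memLp_mul c u).toLp (memLp_mul c u').toLp,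
        Lp.coeFn_add u u'] with z h h1 h2 h3 h4
      rw [h, h3, Pi.add_apply, h1, h2, h4, Pi.add_apply, mul_add])
    (fun a c u => by
      apply Lp.ext
      filter_upwards [(memLp_mul c (a • u)).coeFn_toLp, (memLp_mul c u).coeFn_toLp,
        Lp.coeFn_smul a (memLp_mul c u).toLp, Lp.coeFn_smul a u] with z h h1 h2 h3
      rw [h, h2, Pi.smul_apply, h1, h3, Pi.smul_apply, mul_smul_comm]))
    1 (fun c u => by rw [one_mul]; exact norm_mul_toLp_le c u)

lemma coeFn_mulL2 (c : C₀(ℂ, ℂ)) (u : L2) : mulL2 c u =ᵐ[volume] fun z => c z * u z :=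
  (memLp_mul c u).coeFn_toLp

lemma norm_mulL2_le (c : C₀(ℂ, ℂ)) (u : L2) : ‖mulL2 c u‖ ≤ ‖c‖ * ‖u‖ := norm_mul_toLp_le c u

/-- The cubic nonlinearity `|c|² u`, projected to the modes. -/
def cubic (m : ℕ) (c : C₀(ℂ, ℂ)) (u : modes m) : modes m :=
  (modes m).orthogonalProjectionOnto (mulL2 c (mulL2 (starL' ℝ c) (u : L2)))

lemma norm_cubic_le (m : ℕ) (c : C₀(ℂ, ℂ)) (u : modes m) : ‖cubic m c u‖ ≤ ‖c‖ ^ 2 * ‖u‖ := by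
  refine ((modes m).norm_orthogonalProjectionOnto_apply_le _).trans ?_
  refine (norm_mulL2_le _ _).trans ?_
  rw [pow_two, mul_assoc]
  gcongr
  refine (norm_mulL2_le _ _).trans_eq ?_
  rw [starL'_apply, norm_star, Submodule.coe_norm]

lemma cubic_smul (m : ℕ) (s : ℝ) (c : C₀(ℂ, ℂ)) (u : modes m) :
    cubic m (s • c) (s • u) = s ^ 3 • cubic m c u := by
  simp only [cubic, map_smul, _root_.smul_apply, Submodule.coe_smul, smul_smul]
  congr 1
  ring

/-- Keeping one bounded factor in `C₀` and the other in `L²` makes the cubic term a composition of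
bounded bilinear and linear maps. -/
lemma contDiff_cubic (m : ℕ) {E : Type*} [NormedAddCommGroup E] [NormedSpace ℝ E]
    {c : E → C₀(ℂ, ℂ)} {u : E → modes m} (hc : ContDiff ℝ 1 c) (hu : ContDiff ℝ 1 u) :
    ContDiff ℝ 1 fun x => cubic m (c x) (u x) := by
  have h1 : ContDiff ℝ 1 fun x => (u x : L2) := (modes m).subtypeL.contDiff.comp hu
  have h2 : ContDiff ℝ 1 fun x => starL' ℝ (c x) :=
    (starL' ℝ : C₀(ℂ, ℂ) ≃L[ℝ] C₀(ℂ, ℂ)).toContinuousLinearMap.contDiff.comp hc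
  have h3 : ContDiff ℝ 1 fun x => mulL2 (starL' ℝ (c x)) (u x : L2) :=
    (mulL2.contDiff.comp h2).clm_apply h1
  exact (modes m).orthogonalProjectionOnto.contDiff.comp ((mulL2.contDiff.comp hc).clm_apply h3)

lemma hasProfile_cubic {m : ℕ} {c : C₀(ℂ, ℂ)} {u : modes m} {κ : ℝ → ℝ}
    (hc : ∀ z, c z = Complex.exp (m * Complex.arg z * Complex.I) * (κ ‖z‖ : ℂ))
    (hu : HasProfile m (u : L2) κ) : HasProfile m (cubic m c u : L2) fun r => κ r ^ 3 := by
  have h : HasProfile m (mulL2 c (mulL2 (starL' ℝ c) (u : L2))) fun r => κ r ^ 3 := by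
    filter_upwards [coeFn_mulL2 c (mulL2 (starL' ℝ c) (u : L2)), coeFn_mulL2 (starL' ℝ c) (u : L2),
      hu] with z h1 h2 h3
    have h4 : star (Complex.exp (m * Complex.arg z * Complex.I)) =
        Complex.exp (-(m * Complex.arg z * Complex.I)) := by
      rw [Complex.star_def, ← Complex.exp_conj]
      simp
    have h5 := conj_phase_mul_phase m z
    rw [h1, h2, h3, starL'_apply, ZeroAtInftyContinuousMap.star_apply, hc, star_mul', h4,
      Complex.star_def, Complex.conj_ofReal]
    push_cast
    linear_combination Complex.exp (m * Complex.arg z * Complex.I) * (κ ‖z‖ : ℂ) ^ 3 * h5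
  -- The projection in `cubic` changes nothing here, since a function with a real radial profile is
  -- already in `modes`.
  have e : (cubic m c u : L2) = mulL2 c (mulL2 (starL' ℝ c) (u : L2)) :=
    Submodule.starProjection_eq_self_iff.mpr h.mem_modes
  rwa [e]

/-! ### The ansatz `s w₀ + solve f` and the abstract equation -/

/-- `-Δ + r² - 2(m + 1)` inverted on modes, as an operator on modes. -/
def solveMode (m : ℕ) : modes m →L[ℝ] modes m :=
  ((PiLp.proj 2 (fun _ : Fin 7 => L2) 0 : Jets →L[ℝ] L2) ∘L solveJet m).codRestrict (modes m)
    (solveJet_mem_modes m)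

lemma coe_solveMode (m : ℕ) (f : modes m) : (solveMode m f : L2) = solveJet m f 0 := rfl

/-- The mode `s w₀ + solve f`. -/
def modeSum (m : ℕ) (s : ℝ) (f : modes m) : modes m := s • mode m 1 + solveMode m f

/-- The continuous representative of `modeSum m s f`. -/
def repSum (m : ℕ) (s : ℝ) (f : modes m) : C₀(ℂ, ℂ) :=
  s • toZeroAtInftyCLM ℝ ℂ ℂ (wave m 1) + solveRep m f

/-- The profile of `modeSum m s f`. -/
def profileSum (m : ℕ) (s : ℝ) (f : modes m) (r : ℝ) : ℝ := (repSum m s f (r : ℂ)).re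

lemma continuous_profileSum (m : ℕ) (s : ℝ) (f : modes m) : Continuous (profileSum m s f) :=
  Complex.continuous_re.comp ((repSum m s f).continuous_toFun.comp Complex.continuous_ofReal)

lemma tendsto_profileSum (m : ℕ) (s : ℝ) (f : modes m) :
    Tendsto (profileSum m s f) atTop (𝓝 0) := by
  have h1 : Tendsto (fun r : ℝ => (r : ℂ)) atTop (cocompact ℂ) := by
    refine tendsto_norm_atTop_iff_cobounded.mp ?_ |>.mono_right Metric.cobounded_eq_cocompact.le
    simpa using tendsto_abs_atTop_atTop
  have h2 := (Complex.continuous_re.tendsto 0).comp ((repSum m s f).zero_at_infty'.comp h1)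
  rwa [Complex.zero_re] at h2

lemma profileSum_eq (m : ℕ) (s : ℝ) (f : modes m) {r : ℝ} (hr : 0 ≤ r) :
    profileSum m s f r = s * groundState m r + solveProfile m f r := by
  have h : (wave m 1 (r : ℂ)) = (groundState m r : ℂ) := by
    rw [wave_apply, radialPart, groundState, Complex.norm_real, Real.norm_of_nonneg hr]
    simp
  change ((s • wave m 1 (r : ℂ)) + solveRep m f (r : ℂ)).re = _
  rw [h, Complex.add_re, Complex.real_smul, ← Complex.ofReal_mul, Complex.ofReal_re]
  rfl

lemma repSum_apply (m : ℕ) (s : ℝ) (f : modes m) (z : ℂ) : repSum m s f z =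
    Complex.exp (m * Complex.arg z * Complex.I) * (profileSum m s f ‖z‖ : ℂ) := by
  rw [profileSum_eq m s f (norm_nonneg z), solveProfile, Complex.ofReal_add, mul_add,
    ← solveRep_eq_exp_mul]
  change s • wave m 1 z + solveRep m f z = _
  rw [wave_apply, radialPart, exp_arg_mul_norm, groundState, eval_one, Complex.real_smul]
  push_cast
  ring

lemma hasProfile_modeSum (m : ℕ) (s : ℝ) (f : modes m) :
    HasProfile m (modeSum m s f : L2) (profileSum m s f) := by
  unfold HasProfile
  filter_upwards [Lp.coeFn_add (s • waveL2 m 1) (solveJet m f 0), Lp.coeFn_smul s (waveL2 m 1),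
    coeFn_toL2 (wave m 1), solveJet_ae_eq m f] with z h1 h2 h3 h4
  rw [← repSum_apply]
  change (s • waveL2 m 1 + solveJet m f 0 : L2) z = _
  rw [h1, Pi.add_apply, h2, Pi.smul_apply, waveL2_apply, h3, h4]
  rfl

lemma isProfile_smul_groundX_add_solve (m : ℕ) (s : ℝ) (f : modes m) :
    IsProfile (s • groundX m + solve m f) (profileSum m s f) := hasProfile_modeSum m s f

/-- Right hand side of the equation `(-Δ + r² - 2(m + 1)) u = 2τu - 2|u|²u` at
`u = modeSum m s f`. -/
def source (m : ℕ) (τ s : ℝ) (f : modes m) : modes m :=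
  (2 * τ) • modeSum m s f - (2 : ℝ) • cubic m (repSum m s f) (modeSum m s f)

lemma HasProfile.add {m : ℕ} {u v : L2} {κ κ' : ℝ → ℝ} (hu : HasProfile m u κ)
    (hv : HasProfile m v κ') : HasProfile m (u + v) fun r => κ r + κ' r := by
  unfold HasProfile at *
  filter_upwards [hu, hv, Lp.coeFn_add u v] with z h1 h2 h3
  rw [h3, Pi.add_apply, h1, h2]
  push_cast
  ring

lemma HasProfile.smul {m : ℕ} {u : L2} {κ : ℝ → ℝ} (c : ℝ) (hu : HasProfile m u κ) :
    HasProfile m (c • u) fun r => c * κ r := by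
  unfold HasProfile at *
  filter_upwards [hu, Lp.coeFn_smul c u] with z h1 h2
  rw [h2, Pi.smul_apply, h1, Complex.real_smul]
  push_cast
  ring

lemma hasProfile_source (m : ℕ) (τ s : ℝ) (f : modes m) : HasProfile m (source m τ s f : L2)
    fun r => 2 * τ * profileSum m s f r - 2 * profileSum m s f r ^ 3 := by
  have h1 := (hasProfile_modeSum m s f).smul (2 * τ)
  have h2 := (hasProfile_cubic (repSum_apply m s f) (hasProfile_modeSum m s f)).smul (-2)
  have h3 : (source m τ s f : L2) = (2 * τ) • (modeSum m s f : L2) +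
      (-2 : ℝ) • (cubic m (repSum m s f) (modeSum m s f) : L2) := by
    rw [neg_smul, ← sub_eq_add_neg]
    rfl
  rw [h3]
  convert h1.add h2 using 2
  ring

/-! ### From the abstract equation to a classical solution -/

lemma perp_eq_self {m : ℕ} {f : modes m} (hf : groundCoeff m f = 0) : perp m f = f := by
  rw [perp, hf, zero_smul, sub_zero]

lemma hasDerivAt_diskPairing {m : ℕ} {f : L2} {F : ℝ → ℝ} (h : HasProfile m f F)
    (hF : Continuous F) {r : ℝ} (hr : 0 < r) : HasDerivAt (fun r => diskPairing m r f)
      (2 * Real.pi * (r * (groundState m r * F r))) r := by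
  have hg := continuous_groundState m
  have hc : Continuous fun t => t * (groundState m t * F t) := by fun_prop
  have h1 := (intervalIntegral.integral_hasDerivAt_right (hc.intervalIntegrable 0 r)
    (hc.stronglyMeasurableAtFilter _ _) hc.continuousAt).const_mul (2 * Real.pi)
  refine h1.congr_of_eventuallyEq ?_
  filter_upwards [lt_mem_nhds hr] with t ht
  exact diskPairing_of_hasProfile h ht.le

lemma hasDerivAt_profileSum {m : ℕ} {f : modes m} (hf : groundCoeff m f = 0) (s : ℝ) {r : ℝ}
    (hr : 0 < r) : HasDerivAt (profileSum m s f) ((m / r - r) * profileSum m s f r -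
      (2 * Real.pi)⁻¹ * diskPairing m r f / (r * groundState m r)) r := by
  have h1 := ((hasDerivAt_solveProfile_div m f hr).const_add s).mul (hasDerivAt_groundState m hr)
  have hg := (groundState_pos m hr).ne'
  refine (h1.congr_of_eventuallyEq ?_).congr_deriv ?_
  · filter_upwards [lt_mem_nhds hr] with t ht
    have := (groundState_pos m ht).ne'
    rw [profileSum_eq m s f ht.le, Pi.mul_apply]
    field_simp
  · rw [profileSum_eq m s f hr.le, perp_eq_self hf]
    field_simp
    ring

/-- The radial operator `w'' + w'/r - m² w/r² - r² w + 2(m + 1) w` in terms of the first order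
quantity `(m/r - r) w - q/(r w₀)`. -/
lemma hasDerivAt_first_order {m : ℕ} {κ q : ℝ → ℝ} {r q' : ℝ} (hr : 0 < r)
    (hκ : HasDerivAt κ ((m / r - r) * κ r - q r / (r * groundState m r)) r)
    (hq : HasDerivAt q q' r) :
    HasDerivAt (fun r => (m / r - r) * κ r - q r / (r * groundState m r))
      (-(1 / r * ((m / r - r) * κ r - q r / (r * groundState m r))) + m ^ 2 / r ^ 2 * κ r +
        r ^ 2 * κ r - 2 * (m + 1) * κ r - q' / (r * groundState m r)) r := by
  have hg := (groundState_pos m hr).ne'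
  have h1 : HasDerivAt (fun r : ℝ => m / r - r) (-(m / r ^ 2) - 1) r := by
    have := ((hasDerivAt_inv hr.ne').const_mul (m : ℝ)).sub (hasDerivAt_id r)
    refine (this.congr_deriv ?_).congr_of_eventuallyEq ?_
    · ring
    · exact Eventually.of_forall fun t => by simp [div_eq_mul_inv]
  have h2 := (h1.mul hκ).sub (hq.div ((hasDerivAt_id r).mul (hasDerivAt_groundState m hr))
    (by simpa using ⟨hr.ne', hg⟩))
  refine h2.congr_deriv ?_
  simp only [Pi.mul_apply, id]
  field_simp
  ring

/-- Regularity comes from the first order identity: the source has a continuous profile, so its disc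
pairing is continuously differentiable, so the expression for `κ'` can be differentiated once more,
and the result is (1). -/
lemma solvesRadialEquation_profileSum {m : ℕ} {τ s : ℝ} {f : modes m} (hf : groundCoeff m f = 0)
    (h : f = source m τ s f) : SolvesRadialEquation m (m + 1 + τ) (profileSum m s f) := by
  set κ := profileSum m s f with hκ
  have hκc : Continuous κ := continuous_profileSum m s f
  set F : ℝ → ℝ := fun r => 2 * τ * κ r - 2 * κ r ^ 3 with hF
  have hFc : Continuous F := by fun_prop
  have hFp : HasProfile m (f : L2) F := by
    rw [h]
    exact hasProfile_source m τ s f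
  set q : ℝ → ℝ := fun r => (2 * Real.pi)⁻¹ * diskPairing m r f with hq
  have hqd : ∀ r : ℝ, 0 < r → HasDerivAt q (r * (groundState m r * F r)) r := fun r hr => by
    refine ((hasDerivAt_diskPairing hFp hFc hr).const_mul (2 * Real.pi)⁻¹).congr_deriv ?_
    have := Real.pi_pos.ne'
    field_simp
  have hd1 : ∀ r : ℝ, 0 < r → HasDerivAt κ ((m / r - r) * κ r - q r / (r * groundState m r)) r :=
    fun r hr => hasDerivAt_profileSum hf s hr
  have hd2 := fun (r : ℝ) (hr : 0 < r) => hasDerivAt_first_order hr (hd1 r hr) (hqd r hr)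
  have e1 : EqOn (deriv κ) (fun r => (m / r - r) * κ r - q r / (r * groundState m r)) (Ioi 0) :=
    fun r hr => (hd1 r hr).deriv
  have e2 : ∀ r : ℝ, 0 < r → HasDerivAt (deriv κ) _ r := fun r hr =>
    (hd2 r hr).congr_of_eventuallyEq (e1.eventuallyEq_of_mem (Ioi_mem_nhds hr))
  constructor
  · have hcd : ContinuousOn (fun r => (m / r - r) * κ r - q r / (r * groundState m r)) (Ioi 0) :=
      fun r hr => (hd2 r hr).continuousAt.continuousWithinAt
    have hqc : ContinuousOn q (Ioi 0) := fun r hr => (hqd r hr).continuousAt.continuousWithinAt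
    have hgc := (continuous_groundState m).continuousOn (s := Ioi 0)
    rw [show (2 : WithTop ℕ∞) = 1 + 1 by norm_num, contDiffOn_succ_iff_deriv_of_isOpen isOpen_Ioi]
    refine ⟨fun r hr => (hd1 r hr).differentiableAt.differentiableWithinAt, by simp, ?_⟩
    rw [show (1 : WithTop ℕ∞) = 0 + 1 by norm_num, contDiffOn_succ_iff_deriv_of_isOpen isOpen_Ioi]
    refine ⟨fun r hr => (e2 r hr).differentiableAt.differentiableWithinAt, by simp, ?_⟩
    rw [contDiffOn_zero]
    refine ContinuousOn.congr ?_ fun r hr => (e2 r hr).deriv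
    have hne : ∀ r ∈ Ioi (0 : ℝ), r * groundState m r ≠ 0 := fun r hr =>
      mul_ne_zero (ne_of_gt hr) (groundState_pos m hr).ne'
    have hr0 : ∀ r ∈ Ioi (0 : ℝ), r ≠ 0 := fun r hr => ne_of_gt hr
    have hr2 : ∀ r ∈ Ioi (0 : ℝ), r ^ 2 ≠ 0 := fun r hr => pow_ne_zero 2 (ne_of_gt hr)
    have hκo := hκc.continuousOn (s := Ioi 0)
    have hFo := hFc.continuousOn (s := Ioi 0)
    have hid := continuousOn_id (s := Ioi (0 : ℝ))
    refine ContinuousOn.sub (ContinuousOn.sub (ContinuousOn.add (ContinuousOn.add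
      (ContinuousOn.neg (ContinuousOn.mul (continuousOn_const.div hid hr0) hcd))
      (ContinuousOn.mul (continuousOn_const.div (hid.pow 2) hr2) hκo)) ((hid.pow 2).mul hκo))
      (continuousOn_const.mul hκo)) ((hid.mul (hgc.mul hFo)).div (hid.mul hgc) hne)
  · intro r hr
    rw [(e2 r hr).deriv, e1 hr, sq_abs]
    have hg := (groundState_pos m hr).ne'
    have : r * (groundState m r * F r) / (r * groundState m r) = F r := by field_simp
    rw [this, hF]
    ring

lemma satisfiesBoundaryConditions_profileSum (m : ℕ) (s : ℝ) (f : modes m) :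
    SatisfiesBoundaryConditions (profileSum m s f) :=
  ⟨⟨‖repSum m s f‖, Eventually.of_forall fun _ =>
    (Complex.abs_re_le_norm _).trans (norm_zeroAtInfty_apply_le _ _)⟩, tendsto_profileSum m s f⟩

/-! ### From a classical solution to the abstract equation -/

lemma tendsto_diskPairing_zero (m : ℕ) (f : L2) :
    Tendsto (fun n : ℕ => diskPairing m (1 / ((n : ℝ) + 1)) f) atTop (𝓝 0) := by
  have h := tendsto_setIntegral_of_antitone (μ := (volume : Measure ℂ))
    (f := fun z => inner ℝ (wave m 1 z) (f z))
    (s := fun n : ℕ => Metric.ball (0 : ℂ) (1 / ((n : ℝ) + 1)))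
    (fun n => Metric.isOpen_ball.measurableSet)
    (fun a b hab => Metric.ball_subset_ball (by gcongr))
    ⟨0, (integrable_inner_L2 _ f).integrableOn⟩
  have e : (⋂ n : ℕ, Metric.ball (0 : ℂ) (1 / ((n : ℝ) + 1))) = {0} := by
    ext z
    simp only [mem_iInter, mem_ball_zero_iff, mem_singleton_iff]
    refine ⟨fun hz => norm_le_zero_iff.mp (ge_of_tendsto' tendsto_one_div_add_atTop_nhds_zero_nat
      fun n => (hz n).le), fun hz n => ?_⟩
    rw [hz, norm_zero]
    positivity
  rwa [e, setIntegral_measure_zero _ (measure_singleton 0)] at h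

lemma tendsto_diskPairing_atTop (m : ℕ) (f : L2) :
    Tendsto (fun n : ℕ => diskPairing m n f) atTop (𝓝 (inner ℝ (waveL2 m 1) f)) := by
  have h := tendsto_setIntegral_of_monotone (μ := (volume : Measure ℂ))
    (f := fun z => inner ℝ (wave m 1 z) (f z)) (s := fun n : ℕ => Metric.ball (0 : ℂ) n)
    (fun n => Metric.isOpen_ball.measurableSet)
    (fun a b hab => Metric.ball_subset_ball (by exact_mod_cast hab))
    (integrable_inner_L2 _ f).integrableOn
  rw [Metric.iUnion_ball_nat, Measure.restrict_univ, ← inner_toL2_left] at h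
  exact h

/-- Letting `r → 0` shows the constant is `0`, and `r → ∞` then gives `f ⟂ w₀`. The first order
equation makes `solve f` a multiple of `w₀`; being orthogonal to `w₀` it vanishes, and `solve` is
injective on `w₀^⊥`. -/
lemma eq_zero_of_diskPairing_const {m : ℕ} {f : modes m} {k : ℝ}
    (h : ∀ r : ℝ, 0 < r → diskPairing m r (f : L2) = k) : f = 0 := by
  have hk : k = 0 := by
    refine tendsto_nhds_unique (tendsto_const_nhds.congr fun n => ?_)
      (tendsto_diskPairing_zero m (f : L2))
    exact (h _ (by positivity)).symm
  have hf : groundCoeff m f = 0 := by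
    rw [groundCoeff_eq_zero_iff]
    refine tendsto_nhds_unique (tendsto_diskPairing_atTop m (f : L2))
      (tendsto_const_nhds.congr' ?_)
    filter_upwards [eventually_gt_atTop 0] with n hn
    rw [h n (by exact_mod_cast hn), hk]
  have hd : ∀ r : ℝ, 0 < r → HasDerivAt (fun r => solveProfile m f r / groundState m r) 0 r := by
    intro r hr
    refine (hasDerivAt_solveProfile_div m f hr).congr_deriv ?_
    rw [perp_eq_self hf, h r hr, hk, mul_zero, zero_div]
  obtain ⟨a, ha⟩ := isOpen_Ioi.exists_is_const_of_deriv_eq_zero isPreconnected_Ioi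
    (fun r hr => (hd r hr).differentiableAt.differentiableWithinAt)
    (fun r hr => (hd r hr).deriv)
  have h0 : solveJet m f 0 = a • waveL2 m 1 := by
    apply Lp.ext
    have hne : ∀ᵐ z : ℂ, z ≠ 0 := by simp [ae_iff]
    filter_upwards [hasProfile_solveJet m f, (hasProfile_waveL2 m 1).smul a, hne] with z h1 h2 hz
    rw [h1, h2, eval_one, mul_one]
    have hz' := norm_pos_iff.mpr hz
    have := ha ‖z‖ hz'
    rw [div_eq_iff (groundState_pos m hz').ne'] at this
    rw [← this, solveProfile]
  have h1 := inner_solveJet_one m f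
  rw [h0, real_inner_smul_left, real_inner_self_eq_norm_sq] at h1
  have hpos : ‖waveL2 m 1‖ ≠ 0 := (norm_mode_one_pos m).ne'
  have ha0 : a = 0 := by simpa [hpos] using h1
  exact solve_injective hf (by rw [h0, ha0, zero_smul])

/-- The first order identity expresses the disc pairing of `f` through `w` and `w'`. Differentiating
it and inserting the ODE shows that `f` minus the source has constant disc pairing, hence is zero.
-/
lemma eq_source_of_solves {m : ℕ} {τ s : ℝ} {f : modes m} {w : ℝ → ℝ} (hf : groundCoeff m f = 0)
    (hw : IsProfile (s • groundX m + solve m f) w)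
    (h : SolvesRadialEquation m (m + 1 + τ) w) : f = source m τ s f := by
  set κ := profileSum m s f with hκ
  have hκc : Continuous κ := continuous_profileSum m s f
  have heq : EqOn w κ (Ioi 0) := by
    refine Measure.eqOn_open_of_ae_eq (μ := volume) ?_ isOpen_Ioi h.1.continuousOn
      hκc.continuousOn
    refine ae_Ioi_of_ae_norm (P := fun r => w r = κ r) ?_
    filter_upwards [hw, isProfile_smul_groundX_add_solve m s f] with z h1 h2
    rw [h1] at h2
    exact_mod_cast mul_left_cancel₀ (Complex.exp_ne_zero _) h2
  have hw2 : ∀ r : ℝ, 0 < r → HasDerivAt w (deriv w r) r ∧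
      HasDerivAt (deriv w) (deriv (deriv w) r) r := by
    have h1 := h.1
    rw [show (2 : WithTop ℕ∞) = 1 + 1 by norm_num,
      contDiffOn_succ_iff_deriv_of_isOpen isOpen_Ioi] at h1
    intro r hr
    have hr' := Ioi_mem_nhds hr
    exact ⟨((h1.1 r hr).differentiableAt hr').hasDerivAt,
      (((h1.2.2.differentiableOn one_ne_zero) r hr).differentiableAt hr').hasDerivAt⟩
  have hΦ : ∀ r : ℝ, 0 < r → diskPairing m r f =
      -(2 * Real.pi) * (r * groundState m r * (deriv w r - (m / r - r) * w r)) := by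
    intro r hr
    have h1 := (hasDerivAt_profileSum hf s hr).congr_of_eventuallyEq
      (heq.eventuallyEq_of_mem (Ioi_mem_nhds hr))
    rw [h1.deriv, heq hr]
    have := (groundState_pos m hr).ne'
    have := Real.pi_pos.ne'
    field_simp
    ring
  have hFp := hasProfile_source m τ s f
  have hder : ∀ r : ℝ, 0 < r →
      HasDerivAt (fun r => diskPairing m r ((f - source m τ s f : modes m) : L2)) 0 r := by
    intro r hr
    have hr' := hr.ne'
    have h1 : HasDerivAt (fun r : ℝ => m / r - r) (-(m / r ^ 2) - 1) r := by
      have := ((hasDerivAt_inv hr').const_mul (m : ℝ)).sub (hasDerivAt_id r)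
      refine (this.congr_deriv ?_).congr_of_eventuallyEq ?_
      · ring
      · exact Eventually.of_forall fun t => by simp [div_eq_mul_inv]
    have h2 := (((hasDerivAt_id r).mul (hasDerivAt_groundState m hr)).mul
      ((hw2 r hr).2.sub (h1.mul (hw2 r hr).1))).const_mul (-(2 * Real.pi))
    have h3 := h2.sub (hasDerivAt_diskPairing hFp
      ((hκc.const_mul _).sub ((hκc.pow 3).const_mul 2)) hr)
    refine (h3.congr_of_eventuallyEq ?_).congr_deriv ?_
    · filter_upwards [lt_mem_nhds hr] with t ht
      change diskPairing m t ((f : L2) - (source m τ s f : L2)) = _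
      rw [diskPairing_sub, hΦ t ht]
      rfl
    · have ho := h.2 r hr
      rw [sq_abs] at ho
      have ho' : deriv (deriv w) r = - 1 / r * deriv w r + (m : ℝ) ^ 2 / r ^ 2 * w r + r ^ 2 * w r
        + 2 * w r ^ 2 * w r - 2 * (m + 1 + τ) * w r := by linear_combination -ho
      simp only [Pi.mul_apply, Pi.sub_apply, id, ← hκ, ← heq hr, ho']
      field_simp
      ring
  obtain ⟨a, ha⟩ := isOpen_Ioi.exists_is_const_of_deriv_eq_zero isPreconnected_Ioi
    (fun r hr => (hder r hr).differentiableAt.differentiableWithinAt)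
    (fun r hr => (hder r hr).deriv)
  exact sub_eq_zero.mp (eq_zero_of_diskPairing_const fun r hr => ha r hr)

/-! ### The bifurcation curve by the implicit function theorem -/

lemma modeOp_one (m : ℕ) : modeOp m 1 = mode m 1 := by
  rw [modeOp_apply, ← C_1, laguerreOp_C, map_zero, smul_zero, zero_add, C_1, groundCoeff_one,
    one_smul]

lemma center_one (m : ℕ) : center m 1 = 0 := by
  rw [center_apply, groundCoeff_one, one_smul, sub_self]

lemma solveJet_mode_one (m : ℕ) : solveJet m (mode m 1) = 0 := by
  rw [← modeOp_one, solveJet_modeOp, center_one, map_zero, map_zero]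

lemma solveRep_mode_one (m : ℕ) : solveRep m (mode m 1) = 0 := by
  ext z
  rw [← modeOp_one, solveRep_modeOp, center_one, map_zero]
  rfl

lemma solveMode_mode_one (m : ℕ) : solveMode m (mode m 1) = 0 :=
  Subtype.ext (by rw [coe_solveMode, solveJet_mode_one]; rfl)

lemma solve_mode_one (m : ℕ) : solve m (mode m 1) = 0 :=
  Subtype.ext (by rw [coe_solve, solveJet_mode_one]; rfl)

lemma solve_perp (m : ℕ) (y : modes m) : solve m (perp m y) = solve m y := by
  rw [perp, map_sub, map_smul, solve_mode_one, smul_zero, sub_zero]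

lemma groundCoeff_perp (m : ℕ) (y : modes m) : groundCoeff m (perp m y) = 0 := by
  rw [perp, map_sub, map_smul, groundCoeff_one, smul_eq_mul, mul_one, sub_self]

lemma modeSum_smul_perp (m : ℕ) (s : ℝ) (y : modes m) :
    modeSum m s (s • perp m y) = s • modeSum m 1 y := by
  rw [modeSum, modeSum, perp, map_smul, map_sub, map_smul, solveMode_mode_one]
  module

lemma repSum_smul_perp (m : ℕ) (s : ℝ) (y : modes m) :
    repSum m s (s • perp m y) = s • repSum m 1 y := by
  rw [repSum, repSum, perp, map_smul, map_sub, map_smul, solveRep_mode_one]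
  module

lemma source_smul_perp (m : ℕ) (τ s : ℝ) (y : modes m) : source m τ s (s • perp m y) =
    (2 * τ) • s • (mode m 1 + solveMode m y) -
      (2 * s ^ 3) • cubic m (repSum m 1 y) (modeSum m 1 y) := by
  rw [source, modeSum_smul_perp, repSum_smul_perp, cubic_smul, smul_smul 2, modeSum, one_smul]

/-- The equation for the bifurcation curve, after division by the amplitude. -/
def curveEq (m : ℕ) (v : ℝ × modes m) : modes m :=
  v.2 + groundCoeff m v.2 • solveMode m v.2 +
    (2 * v.1 ^ 2) • cubic m (repSum m 1 v.2) (modeSum m 1 v.2)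

/-- With `2τ` equal to minus the ground coefficient of `y`, the multiples of `w₀` on the two sides
cancel, and what remains is `s` times `curveEq`. -/
lemma eq_source_of_curveEq {m : ℕ} {s : ℝ} {y : modes m} (h : curveEq m (s, y) = 0) :
    s • perp m y = source m (-groundCoeff m y / 2) s (s • perp m y) := by
  rw [source_smul_perp, perp]
  simp only [curveEq] at h
  linear_combination (norm := module) s • h

lemma curveEq_of_eq_source {m : ℕ} {τ s : ℝ} {f : modes m} (hs : s ≠ 0) (hf : groundCoeff m f = 0)
    (h : f = source m τ s f) : curveEq m (s, s⁻¹ • f - (2 * τ) • mode m 1) = 0 := by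
  set y := s⁻¹ • f - (2 * τ) • mode m 1 with hy
  have hg : groundCoeff m y = -(2 * τ) := by
    rw [hy, map_sub, map_smul, map_smul, hf, groundCoeff_one, smul_zero, zero_sub, smul_eq_mul,
      mul_one]
  have hp : f = s • perp m y := by
    rw [perp, hg, hy, smul_sub, smul_sub, smul_inv_smul₀ hs]
    module
  rw [hp, source_smul_perp, perp, hg] at h
  refine (smul_eq_zero_iff_right hs).mp ?_
  simp only [curveEq, hg]
  linear_combination (norm := module) h

lemma contDiff_curveEq (m : ℕ) : ContDiff ℝ 1 (curveEq m) := by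
  have h2 : ContDiff ℝ 1 fun v : ℝ × modes m => v.2 := contDiff_snd
  have h1 : ContDiff ℝ 1 fun v : ℝ × modes m => v.1 := contDiff_fst
  refine (h2.add (((groundCoeff m).contDiff.comp h2).smul ((solveMode m).contDiff.comp h2))).add
    ((contDiff_const.mul (h1.pow 2)).smul (contDiff_cubic m ?_ ?_))
  · exact contDiff_const.add ((solveRep m).contDiff.comp h2)
  · exact contDiff_const.add ((solveMode m).contDiff.comp h2)

lemma curveEq_zero (m : ℕ) : curveEq m 0 = 0 := by
  simp [curveEq]

/-- Apart from `y` itself, every term vanishes to second order at the origin: one is quadratic in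
`y`, the other carries `s²`. Hence the curve is solvable for `y` and has zero derivative at `s = 0`.
-/
lemma fderiv_curveEq_zero (m : ℕ) :
    fderiv ℝ (curveEq m) 0 = ContinuousLinearMap.snd ℝ ℝ (modes m) := by
  have h2 : HasFDerivAt (fun v : ℝ × modes m => v.2) (ContinuousLinearMap.snd ℝ ℝ (modes m)) 0 :=
    hasFDerivAt_snd
  have h1 : HasFDerivAt (fun v : ℝ × modes m => v.1) (ContinuousLinearMap.fst ℝ ℝ (modes m)) 0 :=
    hasFDerivAt_fst
  have hN : DifferentiableAt ℝ
      (fun v : ℝ × modes m => cubic m (repSum m 1 v.2) (modeSum m 1 v.2)) 0 := by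
    have h2' : ContDiff ℝ 1 fun v : ℝ × modes m => v.2 := contDiff_snd
    refine (contDiff_cubic m ?_ ?_).differentiable one_ne_zero 0
    · exact contDiff_const.add ((solveRep m).contDiff.comp h2')
    · exact contDiff_const.add ((solveMode m).contDiff.comp h2')
  have h := (h2.add (((groundCoeff m).hasFDerivAt.comp 0 h2).smul
    ((solveMode m).hasFDerivAt.comp 0 h2))).add (((h1.pow 2).const_mul 2).smul hN.hasFDerivAt)
  refine (h.congr_fderiv ?_).fderiv
  ext v <;> simp

lemma isInvertible_fderiv_curveEq (m : ℕ) :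
    (fderiv ℝ (curveEq m) 0 ∘L .inr ℝ ℝ (modes m)).IsInvertible := by
  rw [fderiv_curveEq_zero, ContinuousLinearMap.snd_comp_inr]
  exact ⟨ContinuousLinearEquiv.refl ℝ _, rfl⟩

/-- The solution curve `s ↦ y` of `curveEq m (s, y) = 0`. -/
lemma exists_curve (m : ℕ) : ∃ ψ : ℝ → modes m, ψ 0 = 0 ∧ HasDerivAt ψ 0 0 ∧ ContDiffAt ℝ 1 ψ 0 ∧
    (∀ᶠ s in 𝓝 0, curveEq m (s, ψ s) = 0) ∧ ∀ᶠ v in 𝓝 0, curveEq m v = 0 → ψ v.1 = v.2 := by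
  have hc : ContDiffAt ℝ 1 (curveEq m) (0 : ℝ × modes m) := (contDiff_curveEq m).contDiffAt
  have hi := isInvertible_fderiv_curveEq m
  refine ⟨hc.implicitFunction one_ne_zero hi, hc.implicitFunction_apply_self one_ne_zero hi, ?_,
    hc.contDiffAt_implicitFunction one_ne_zero hi, ?_, ?_⟩
  · have h := (hc.hasStrictFDerivAt_implicitFunction one_ne_zero hi).hasFDerivAt.hasDerivAt
    refine h.congr_deriv ?_
    rw [fderiv_curveEq_zero]
    simp
  · filter_upwards [hc.eventually_apply_implicitFunction one_ne_zero hi] with s hs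
    rw [hs, curveEq_zero]
  · filter_upwards [hc.eventually_apply_eq_iff_implicitFunction one_ne_zero hi] with v hv h
    exact hv.mp (h.trans (curveEq_zero m).symm)

/-! ### A priori estimates for small solutions -/

/-- Projecting off `w₀` removes the term `2τ s w₀`, the only one of first order in `s`; what is left
is `τ` times `f` plus cubic terms, so `f` is small relative to `s`. -/
lemma perp_source {m : ℕ} (τ s : ℝ) (f : modes m) : perp m (source m τ s f) =
    (2 * τ) • solveMode m f - (2 : ℝ) • perp m (cubic m (repSum m s f) (modeSum m s f)) := by
  have h : groundCoeff m (solveMode m f) = 0 := by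
    rw [groundCoeff_eq_zero_iff, real_inner_comm]
    exact inner_solveJet_one m f
  simp only [perp, source, modeSum, map_sub, map_smul, map_add, h, groundCoeff_one, smul_eq_mul]
  module

lemma norm_perp_le (m : ℕ) (f : modes m) :
    ‖perp m f‖ ≤ (1 + ‖groundCoeff m‖ * ‖mode m 1‖) * ‖f‖ := by
  refine (norm_sub_le _ _).trans ?_
  rw [norm_smul, add_mul, one_mul]
  have := mul_le_mul_of_nonneg_right ((groundCoeff m).le_opNorm f) (norm_nonneg (mode m 1))
  linarith

lemma abs_amplitude_le {m : ℕ} (s : ℝ) (f : modes m) :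
    |s| * ‖mode m 1‖ ≤ ‖s • groundX m + solve m f‖ + ‖solveMode m‖ * ‖f‖ := by
  have h1 : ‖modeSum m s f‖ ≤ ‖s • groundX m + solve m f‖ :=
    norm_component_le (s • groundX m + solve m f : X m) 0
  have h2 : s • mode m 1 = modeSum m s f - solveMode m f := by rw [modeSum, add_sub_cancel_right]
  rw [← Real.norm_eq_abs, ← norm_smul, h2]
  exact (norm_sub_le _ _).trans (add_le_add h1 ((solveMode m).le_opNorm f))

/-- An absorption argument, with `n = ‖f‖` and `x` bounding the solution. Using `x² ≤ 4K⁴δ`, the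
bound becomes `n ≤ (2K + 8K⁶) δ (n + s)`; the denominator of `δ` makes this factor `ρ/2`, and `ρ ≤
1` allows the `n` on the right to be absorbed. -/
lemma le_of_cubic_bound {K ρ δ t s n x : ℝ} (hK : 1 ≤ K) (hρ : 0 < ρ) (hρ1 : ρ ≤ 1)
    (hδ : δ = ρ / (4 * K + 16 * K ^ 6)) (hs0 : 0 ≤ s) (ht : t ≤ δ) (ht0 : 0 ≤ t)
    (hs : s ≤ K * δ) (hn0 : 0 ≤ n) (hn : n ≤ K * δ) (hx0 : 0 ≤ x) (hx : x ≤ K * s + K * n)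
    (h : n ≤ 2 * t * (K * n) + 2 * (K * (x ^ 2 * x))) : s < ρ ∧ n ≤ ρ * s ∧ 2 * t * K < ρ := by
  have hD : 0 < 4 * K + 16 * K ^ 6 := by positivity
  have hδ0 : 0 < δ := by rw [hδ]; positivity
  have hδD : δ * (4 * K + 16 * K ^ 6) = ρ := by rw [hδ]; field_simp
  have hK6 : 1 ≤ K ^ 6 := one_le_pow₀ hK
  have hδ1 : δ ≤ 1 := by nlinarith
  have hx1 : x ≤ 2 * K ^ 2 * δ := by nlinarith
  have hx2 : x ^ 2 ≤ 4 * K ^ 4 * δ := by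
    calc x ^ 2 ≤ (2 * K ^ 2 * δ) ^ 2 := by gcongr
      _ = 4 * K ^ 4 * (δ * δ) := by ring
      _ ≤ 4 * K ^ 4 * (δ * 1) := by gcongr
      _ = _ := by ring
  have hm : n ≤ 2 * δ * (K * n) + 2 * (K * (4 * K ^ 4 * δ * (K * s + K * n))) := by
    refine h.trans ?_
    gcongr
  have hm2 : n ≤ ρ / 2 * n + ρ / 2 * s := by
    refine hm.trans ?_
    have : 0 ≤ 2 * δ * K * s := by positivity
    rw [← hδD]
    nlinarith
  have hKδ : 4 * (K * δ) < ρ := by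
    rw [← hδD]
    nlinarith [mul_pos hδ0 (pow_pos (zero_lt_one.trans_le hK) 6)]
  refine ⟨?_, ?_, ?_⟩
  · nlinarith
  · nlinarith
  · nlinarith

/-- Small solutions are tangent to the ground state. -/
lemma exists_small (m : ℕ) {ρ : ℝ} (hρ : 0 < ρ) (hρ1 : ρ ≤ 1) : ∃ δ > 0, ∀ (τ s : ℝ) (f : modes m),
    |τ| < δ → ‖s • groundX m + solve m f‖ < δ → groundCoeff m f = 0 →
    ‖f‖ ≤ (2 * m + 5) * ‖s • groundX m + solve m f‖ → f = source m τ s f →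
    |s| < ρ ∧ ‖f‖ ≤ ρ * |s| ∧ ‖(2 * τ) • mode m 1‖ < ρ := by
  have hg := norm_mode_one_pos m
  -- One constant dominates all the operator norms involved. The last entry bounds the amplitude
  -- `|s|` by the norm of the solution.
  obtain ⟨K, hK⟩ : ∃ K : ℝ, ∀ x ∈ ({1, ‖solveMode m‖, ‖solveRep m‖, ‖mode m 1‖,
      ‖toZeroAtInftyCLM ℝ ℂ ℂ (wave m 1)‖, 1 + ‖groundCoeff m‖ * ‖mode m 1‖, 2 * (m : ℝ) + 5,
      (1 + ‖solveMode m‖ * (2 * m + 5)) / ‖mode m 1‖} : Set ℝ), x ≤ K :=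
    (Set.toFinite _).bddAbove
  simp only [mem_insert_iff, mem_singleton_iff, forall_eq_or_imp, forall_eq] at hK
  obtain ⟨hK1, hK2, hK3, hK4, hK5, hK6, hK7, hK8⟩ := hK
  refine ⟨ρ / (4 * K + 16 * K ^ 6), by positivity, fun τ s f hτ hW hf hfW h => ?_⟩
  set δ := ρ / (4 * K + 16 * K ^ 6) with hδ
  have hδ0 : 0 < δ := by positivity
  have hn : ‖f‖ ≤ K * δ := hfW.trans (by gcongr)
  have hs : |s| ≤ K * δ := by
    have h1 : |s| * ‖mode m 1‖ ≤ (1 + ‖solveMode m‖ * (2 * m + 5)) * δ := by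
      refine (abs_amplitude_le s f).trans ?_
      calc _ ≤ δ + ‖solveMode m‖ * ((2 * m + 5) * δ) := by
            gcongr
            exact hfW.trans (by gcongr)
        _ = _ := by ring
    rw [← le_div_iff₀ hg, mul_div_right_comm] at h1
    exact h1.trans (by gcongr)
  have hmode : ‖modeSum m s f‖ ≤ K * |s| + K * ‖f‖ := by
    refine (norm_add_le _ _).trans (add_le_add ?_ ?_)
    · rw [norm_smul, mul_comm, Real.norm_eq_abs]
      gcongr
    · exact ((solveMode m).le_opNorm f).trans (by gcongr)
  have hrep : ‖repSum m s f‖ ≤ K * |s| + K * ‖f‖ := by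
    refine (norm_add_le _ _).trans (add_le_add ?_ ?_)
    · rw [norm_smul, mul_comm, Real.norm_eq_abs]
      gcongr
    · exact ((solveRep m).le_opNorm f).trans (by gcongr)
  have key : ‖f‖ ≤ 2 * |τ| * (K * ‖f‖) +
      2 * (K * ((K * |s| + K * ‖f‖) ^ 2 * (K * |s| + K * ‖f‖))) := by
    have h1 : f = (2 * τ) • solveMode m f -
        (2 : ℝ) • perp m (cubic m (repSum m s f) (modeSum m s f)) := by
      rw [← perp_source, ← h, perp_eq_self hf]
    have h2 : ‖f‖ ≤ ‖(2 * τ) • solveMode m f‖ +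
        ‖(2 : ℝ) • perp m (cubic m (repSum m s f) (modeSum m s f))‖ := by
      conv_lhs => rw [h1]
      exact norm_sub_le _ _
    refine h2.trans ?_
    rw [norm_smul, norm_smul, Real.norm_eq_abs, Real.norm_eq_abs, abs_mul, abs_two]
    gcongr
    · exact ((solveMode m).le_opNorm f).trans (by gcongr)
    · refine (norm_perp_le m _).trans ?_
      gcongr
      exact (norm_cubic_le m _ _).trans (by gcongr)
  obtain ⟨h1, h2, h3⟩ := le_of_cubic_bound hK1 hρ hρ1 hδ (abs_nonneg s) hτ.le (abs_nonneg τ) hs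
    (norm_nonneg f) hn (by positivity) le_rfl key
  refine ⟨h1, h2, lt_of_le_of_lt ?_ h3⟩
  rw [norm_smul, Real.norm_eq_abs, abs_mul, abs_two]
  gcongr

end Vortex

end

/-! ### Assembly of the theorem -/

theorem theorem3p1 (m : ℕ) (hm : 1 ≤ m) :
    ∃ w₀ : Vortex.X m, Vortex.IsProfile w₀ (Vortex.groundState m) ∧
    ∃ (ε δ : ℝ) (τ : ℝ → ℝ) (z : ℝ → Vortex.X m), 0 < ε ∧ 0 < δ ∧
      ContDiffOn ℝ 1 τ (Ioo (-ε) ε) ∧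
      ContDiffOn ℝ 1 z (Ioo (-ε) ε) ∧
      τ 0 = 0 ∧ HasDerivAt τ 0 0 ∧ z 0 = 0 ∧
      (∀ s ∈ Ioo (-ε) ε, Vortex.l2Inner (z s) w₀ = 0) ∧
      -- every point of the curve is a solution
      (∀ s ∈ Ioo (-ε) ε, ∃ w : ℝ → ℝ, Vortex.IsProfile (s • w₀ + s • z s) w ∧
        Vortex.SolvesRadialEquation m ((m : ℝ) + 1 + τ s) w ∧
        Vortex.SatisfiesBoundaryConditions w) ∧
      -- every nontrivial solution close to the bifurcation point lies on the curve
      (∀ (μ : ℝ) (W : Vortex.X m) (w : ℝ → ℝ), |μ - ((m : ℝ) + 1)| < δ → ‖W‖ < δ →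
        Vortex.IsProfile W w → Vortex.SolvesRadialEquation m μ w →
        W = 0 ∨ ∃ s ∈ Ioo (-ε) ε, μ = (m : ℝ) + 1 + τ s ∧ W = s • w₀ + s • z s) := by
  refine ⟨Vortex.groundX m, Vortex.isProfile_groundX m, ?_⟩
  obtain ⟨ψ, hψ0, hψd, hψc, hψ, huniq⟩ := Vortex.exists_curve m
  obtain ⟨ε, hε, hball⟩ := Metric.eventually_nhds_iff_ball.mp
    (hψ.and (hψc.eventually (by simp)))
  have hI : ∀ s ∈ Ioo (-ε) ε, s ∈ Metric.ball (0 : ℝ) ε := fun s hs => by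
    rwa [Real.ball_eq_Ioo, zero_sub, zero_add]
  obtain ⟨η, hη, hη'⟩ := Metric.eventually_nhds_iff_ball.mp huniq
  -- The bound `ε / 2` keeps `s` in the parameter interval; `η / 2` is needed because `y` is a sum
  -- of two terms of size at most `ρ` and must lie in the uniqueness ball of radius `η`.
  set ρ := min 1 (min (ε / 2) (η / 2)) with hρ
  have hρ0 : 0 < ρ := by positivity
  obtain ⟨δ, hδ, hsmall⟩ := Vortex.exists_small m hρ0 (min_le_left _ _)
  have hρε : ρ ≤ ε / 2 := (min_le_right _ _).trans (min_le_left _ _)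
  have hρη : ρ ≤ η / 2 := (min_le_right _ _).trans (min_le_right _ _)
  have hψC : ContDiffOn ℝ 1 ψ (Ioo (-ε) ε) := fun s hs =>
    (hball s (hI s hs)).2.contDiffWithinAt
  -- `solve` annihilates `w₀`, so the data `ψ s` and its part orthogonal to `w₀` give the same
  -- element of `X m`.
  have hcurve : ∀ s : ℝ, s • Vortex.groundX m + s • Vortex.solve m (ψ s) =
      s • Vortex.groundX m + Vortex.solve m (s • Vortex.perp m (ψ s)) := fun s => by
    rw [map_smul, Vortex.solve_perp]
  refine ⟨ε, δ, fun s => -Vortex.groundCoeff m (ψ s) / 2, fun s => Vortex.solve m (ψ s), hε, hδ,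
    (((Vortex.groundCoeff m).contDiff.comp_contDiffOn hψC).neg).div_const 2,
    (Vortex.solve m).contDiff.comp_contDiffOn hψC, ?_, ?_, ?_, ?_, ?_, ?_⟩
  · simp [hψ0]
  · have h := ((Vortex.groundCoeff m).hasFDerivAt.comp_hasDerivAt 0 hψd).neg.div_const 2
    simpa using h
  · simp [hψ0]
  · exact fun s _ => Vortex.inner_solveJet_one m (ψ s)
  · intro s hs
    simp only [hcurve]
    have h0 : Vortex.groundCoeff m (s • Vortex.perp m (ψ s)) = 0 := by
      rw [map_smul, Vortex.groundCoeff_perp, smul_zero]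
    exact ⟨_, Vortex.isProfile_smul_groundX_add_solve m s _,
      Vortex.solvesRadialEquation_profileSum h0
        (Vortex.eq_source_of_curveEq (hball s (hI s hs)).1),
      Vortex.satisfiesBoundaryConditions_profileSum m s _⟩
  · intro μ W w hμ hW hw hsol
    obtain ⟨s, f, hWf, hf, hfW⟩ := Vortex.exists_eq_smul_groundX_add_solve W
    set τ := μ - ((m : ℝ) + 1) with hτ
    have hμτ : μ = m + 1 + τ := by rw [hτ]; ring
    rw [hμτ] at hsol
    rw [hWf] at hw hW hfW
    have hsrc := Vortex.eq_source_of_solves hf hw hsol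
    obtain ⟨hs, hfs, hτs⟩ := hsmall τ s f hμ hW hf hfW hsrc
    rcases eq_or_ne s 0 with hs0 | hs0
    · left
      -- The estimate `‖f‖ ≤ ρ|s|` forces `f = 0` when the amplitude vanishes.
      rw [hs0, abs_zero, mul_zero, norm_le_zero_iff] at hfs
      rw [hWf, hs0, hfs, zero_smul, map_zero, add_zero]
    · right
      -- This inverts the substitution of `curveEq`: the part of `y` off `w₀` is `f / s`, and its
      -- ground coefficient is `-2τ`.
      set y := s⁻¹ • f - (2 * τ) • Vortex.mode m 1 with hy
      have hy1 : ‖y‖ < 2 * ρ := by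
        refine (norm_sub_le _ _).trans_lt ?_
        have h1 : ‖s⁻¹ • f‖ ≤ ρ := by
          rw [norm_smul, norm_inv, Real.norm_eq_abs, inv_mul_le_iff₀ (abs_pos.mpr hs0), mul_comm]
          exact hfs
        linarith
      have hψy : ψ s = y := by
        refine hη' (s, y) ?_ (Vortex.curveEq_of_eq_source hs0 hf hsrc)
        rw [mem_ball_zero_iff, Prod.norm_def, max_lt_iff, Real.norm_eq_abs]
        exact ⟨by linarith, by linarith⟩
      have hg : Vortex.groundCoeff m y = -(2 * τ) := by
        rw [hy, map_sub, map_smul, map_smul, hf, Vortex.groundCoeff_one, smul_zero, zero_sub,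
          smul_eq_mul, mul_one]
      refine ⟨s, abs_lt.mp (by linarith), ?_, ?_⟩
      · beta_reduce
        rw [hψy, hg, hμτ]
        ring
      · beta_reduce
        rw [hcurve, hψy, Vortex.perp, hg, hy, hWf]
        congr 2
        rw [smul_sub, smul_sub, smul_inv_smul₀ hs0]
        module
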